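/- **Setting.** Let $n,m\ge 0$. An *instance* $(\mathbf a,\mathbf b,\mathbf w,f)$ consists of vectors $\mathbf a,\mathbf b\in\mathbb R^n$, weights $w_1\ge\dots\ge w_n\ge 0$ and a concave, continuously differentiable function $f$ that is strictly increasing in each coordinate, on a domain $D$ which is either $\{\alpha,\beta\ge 0\}$ or $\{\alpha,\beta>0\}$. For a ranking (permutation) $\pi$ of $[n]$ put $\mathsf{cs}_{\mathbf w}(\mathbf v,\pi)=\sum_j w_jv_{\pi(j)}$, $\mathsf{cs}^*_{\mathbf w}(\mathbf v)=\max_\pi \mathsf{cs}_{\mathbf w}(\mathbf v,\pi)$ and $g_\pi=(\mathsf{cs}_{\mathbf w}(\mathbf a,\pi),\mathsf{cs}_{\mathbf w}(\mathbf b,\pi))$; it is assumed that $g_\pi\in D$ for all $\pi$. The Fenchel dual is $f^*(\mu,\nu)=\sup_{(\alpha,\beta)\in D}(\mu\alpha+\nu\beta+f(\alpha,\beta))\in(-\infty,\infty]$, and $\partial h(z)$ denotes the set of subgradients of $h:\mathbb R^2\to\mathbb R$ at $z$. Let $(\mathbf a_i,\mathbf b_i,\mathbf w_i,f_i)$, $i\in[m]$,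 be instances, let $F$ be a function with the same properties as the $f_i$, and fix $p,q>0$. Put $\mathsf C_i(z_1,z_2)=\mathsf{cs}^*_{\mathbf w_i}(z_1\mathbf a_i+z_2\mathbf b_i)$, $$\Psi_i(p_i,q_i)=\mathsf C_i(p+p_i,q+q_i)+f_i^*(-p_i,-q_i),\qquad \Psi(p,q,p_1,q_1,\dots,p_m,q_m)=F^*(-p,-q)+\sum_{i=1}^m\Psi_i(p_i,q_i),$$ where all $p_i,q_i$ range over the positive reals. **Proposition.** 1. *(Splitting)* The minimum of $\Psi$ over all $p_i,q_i>0$ is attained and equals $F^*(-p,-q)+\sum_i\min_{p_i,q_i>0}\Psi_i(p_i,q_i)$. If every $(p_i,q_i)$ minimises $\Psi_i$, then the tuple minimises $\Psi$; the converse holds if $F^*(-p,-q)<\infty$. If $\Psi_i(p_i,q_i)\le\min\Psi_i+\varepsilon_i$ for all $i$, then the tuple minimises $\Psi$ up to $\sum_i\varepsilon_i$. 2. *(Fixed points)* For every $i$, the inclusion $$(p_i,q_i)\in\nabla f_i\bigl(\partial \mathsf C_i(p+p_i,q+q_i)\bigr)$$ has a solution $p_i,q_i>0$ with $\Psi_i(p_i,q_i)<\infty$,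 and every solution with $p_i,q_i>0$ minimises $\Psi_i$. Conversely, every minimiser with $p_i,q_i>0$ is a solution if all scores $\mathsf{cs}_{\mathbf w_i}(\mathbf a_i,\pi),\mathsf{cs}_{\mathbf w_i}(\mathbf b_i,\pi)$ are positive. Within the positive quadrant, the set $\partial \mathsf C_i(p+p_i,q+q_i)$ depends only on the ratio $(q+q_i)/(p+p_i)$, that is, it is constant along each ray through $(-p,-q)$. 3. *(Efficient solution of each piece)* Consider programs for a real RAM (registers and arrays of natural numbers, with addition, subtraction, halving and comparison, and of real numbers, with exact $+,-,\times,/$ and comparison, each step at unit cost) that may evaluate $f_i$ and $\nabla f_i$ at unit cost per evaluation. The input is $n,\mathbf a_i,\mathbf b_i,\mathbf w_i,p,q$ and an accuracy $\varepsilon>0$. To *solve* the instance is to halt with - two rankings $\sigma,\tau$ such that for some point $g$ of the segment $[g_\sigma,g_\tau]$ one has $\nabla f_i(g)\in(0,\infty)^2$ and $g\in\partial \mathsf C_i\bigl((p,q)+\nabla f_i(g)\bigr)$, so that $(p_i,q_i)=\nabla f_i(g)$ is an exact minimiser of $\Psi_i$; - numbers $p_i,q_i>0$ with $\Psi_i(p_i,q_i)\le\min\Psi_i+\varepsilon$;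 - a number $v$ with $|v-\min\Psi_i|\le\varepsilon$. Let $S_i=\max_{\sigma,\tau}\langle (p,q)+\nabla f_i(g_\sigma),\,g_\tau-g_\sigma\rangle$. There are two fixed programs, the second one with access to a sequence of independent uniform random numbers in $[0,1]$, an absolute constant $C$, and constants $C_d$ depending only on $d\in\mathbb N$, such that: - the first program solves every instance in which all entries of $\mathbf a_i,\mathbf b_i$ are integers of absolute value at most $B$ in at most $C\bigl((n+1)\log(n+2)\log(B+2)+\log(2+S_i/\varepsilon)\bigr)$ steps; - the second program solves every instance (with arbitrary real entries) for every outcome of the random numbers, and for every $d$ it takes at most $C_d\bigl((n+1)\log^2(n+2)+\log(2+S_i/\varepsilon)\bigr)$ steps with probability at least $1-(n+2)^{-d}$. -/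

import Mathlib

open MeasureTheory

/-! ## Rankings, scores, Fenchel duals -/

/-- The open positive quadrant. -/
def posQuad : Set (ℝ × ℝ) := {x | 0 < x.1 ∧ 0 < x.2}

/-- The closed nonnegative quadrant. -/
def closedQuad : Set (ℝ × ℝ) := {x | 0 ≤ x.1 ∧ 0 ≤ x.2}

/-- The pairing of vectors of the plane. -/
def dot (x y : ℝ × ℝ) : ℝ := x.1 * y.1 + x.2 * y.2

/-- Cumulative score of the ranking `σ`, where `σ j` is the result shown at position `j`. -/
def cs {n : ℕ} (w v : Fin n → ℝ) (σ : Equiv.Perm (Fin n)) : ℝ := ∑ j, w j * v (σ j)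

/-- Best cumulative score over all rankings. -/
noncomputable def csStar {n : ℕ} (w v : Fin n → ℝ) : ℝ :=
  Finset.univ.sup' Finset.univ_nonempty (cs w v)

/-- The gradient of `f` relative to the domain `D`. -/
noncomputable def grad (D : Set (ℝ × ℝ)) (f : ℝ × ℝ → ℝ) (x : ℝ × ℝ) : ℝ × ℝ :=
  (fderivWithin ℝ f D x (1, 0), fderivWithin ℝ f D x (0, 1))

/-- An aggregation function: concave, strictly increasing in each coordinate, continuously
differentiable.  Its domain is the closed quadrant, or the open one (such as for `log (α β)`). -/
def IsObjective (D : Set (ℝ × ℝ)) (f : ℝ × ℝ → ℝ) : Prop :=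
  (D = closedQuad ∨ D = posQuad) ∧ ConcaveOn ℝ D f ∧
  (∀ α α' β, (α, β) ∈ D → (α', β) ∈ D → α < α' → f (α, β) < f (α', β)) ∧
  (∀ α β β', (α, β) ∈ D → (α, β') ∈ D → β < β' → f (α, β) < f (α, β')) ∧
  ContDiffOn ℝ 1 f D

/-- The Fenchel dual `f^*(μ) = sup_{x ∈ D} (μ ⬝ x + f x)`, possibly `+∞`. -/
noncomputable def fenchel (D : Set (ℝ × ℝ)) (f : ℝ × ℝ → ℝ) (μ : ℝ × ℝ) : EReal :=
  ⨆ x ∈ D, ((dot μ x + f x : ℝ) : EReal)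

/-- The set of subgradients of `g` at `x`. -/
def subgrad (g : ℝ × ℝ → ℝ) (x : ℝ × ℝ) : Set (ℝ × ℝ) :=
  {v | ∀ y, g x + dot v y ≤ g (x + y)}

/-- The data of one ranking instance with `n` results. -/
structure RankInstance (n : ℕ) where
  /-- scores for the first objective -/
  a : Fin n → ℝ
  /-- scores for the second objective -/
  b : Fin n → ℝ
  /-- position weights -/
  w : Fin n → ℝ
  /-- domain of the aggregation function -/
  dom : Set (ℝ × ℝ)
  /-- aggregation function -/
  f : ℝ × ℝ → ℝ

namespace RankInstance

variable {n : ℕ} (I : RankInstance n)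

/-- The pair of cumulative scores of a ranking. -/
def score (σ : Equiv.Perm (Fin n)) : ℝ × ℝ := (cs I.w I.a σ, cs I.w I.b σ)

/-- Weights are nonnegative and decreasing, the aggregation function is admissible, and it is
defined at the scores of every ranking. -/
def Valid : Prop :=
  Antitone I.w ∧ (∀ j, 0 ≤ I.w j) ∧ IsObjective I.dom I.f ∧ ∀ σ, I.score σ ∈ I.dom

/-- The function `z = (z₁, z₂) ↦ cs^*_w (z₁ a + z₂ b)`. -/
noncomputable def support (z : ℝ × ℝ) : ℝ := csStar I.w (fun j => z.1 * I.a j + z.2 * I.b j)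

/-- The gradient of the aggregation function. -/
noncomputable def gradient : ℝ × ℝ → ℝ × ℝ := grad I.dom I.f

/-- The term of `Ψ` that belongs to this instance, for global dual variables `P = (p, q)` and
local dual variables `x = (p_i, q_i)`. -/
noncomputable def localObj (P x : ℝ × ℝ) : EReal :=
  (I.support (P + x) : EReal) + fenchel I.dom I.f (-x)

/-- The infimum of the term of this instance over positive local dual variables. -/
noncomputable def localMin (P : ℝ × ℝ) : EReal := ⨅ x ∈ posQuad, I.localObj P x

/-- `x` solves the fixed point inclusion `x ∈ ∇f (∂ cs^* (P + x))`. -/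
def IsFixedPoint (P x : ℝ × ℝ) : Prop := x ∈ I.gradient '' subgrad I.support (P + x)

/-- The largest slope of `y ↦ P ⬝ y + f y` at the score of a ranking in the direction of the
score of another ranking. -/
noncomputable def slope (P : ℝ × ℝ) : ℝ :=
  (Finset.univ : Finset (Equiv.Perm (Fin n) × Equiv.Perm (Fin n))).sup' Finset.univ_nonempty
    fun στ => dot (P + I.gradient (I.score στ.1)) (I.score στ.2 - I.score στ.1)

end RankInstance

/-- The dual objective `Ψ(p, q, p_1, q_1, …, p_m, q_m)`, with `P = (p, q)`, `x i = (p_i, q_i)`. -/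
noncomputable def Psi {m n : ℕ} (I : Fin m → RankInstance n) (domF : Set (ℝ × ℝ))
    (F : ℝ × ℝ → ℝ) (P : ℝ × ℝ) (x : Fin m → ℝ × ℝ) : EReal :=
  fenchel domF F (-P) + ∑ i, (I i).localObj P (x i)

/-- The tuples of positive local dual variables. -/
def posTuples (m : ℕ) : Set (Fin m → ℝ × ℝ) := {x | ∀ i, x i ∈ posQuad}

/-! ## A real RAM

Programs have registers and arrays of natural numbers (for indices) and of real numbers.  Natural
numbers can be added, subtracted, halved and compared; real numbers can be added, subtracted,
multiplied, divided and compared exactly, but not rounded.  The aggregation function and its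
gradient are available at the price of one step per evaluation.  A program is one fixed piece of
finite code, so that its expressions have bounded size, and the evaluation of an
expression in an assignment or test is part of that one step. -/

namespace RealRAM

/-- Memory: numbered registers and numbered arrays, of natural numbers and of real numbers. -/
structure State where
  /-- registers for natural numbers -/
  nreg : ℕ → ℕ
  /-- registers for real numbers -/
  rreg : ℕ → ℝ
  /-- arrays of natural numbers: array number, then index -/
  narr : ℕ → ℕ → ℕ
  /-- arrays of real numbers: array number, then index -/
  rarr : ℕ → ℕ → ℝ

/-- Expressions with natural number values. -/
inductive NExpr where
  | const (k : ℕ)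
  | reg (x : ℕ)
  | get (A : ℕ) (e : NExpr)
  | add (e₁ e₂ : NExpr)
  | sub (e₁ e₂ : NExpr)
  | half (e : NExpr)

/-- Value of an expression; subtraction is truncated at `0`. -/
def NExpr.eval (s : State) : NExpr → ℕ
  | const k => k
  | reg x => s.nreg x
  | get A e => s.narr A (e.eval s)
  | add e₁ e₂ => e₁.eval s + e₂.eval s
  | sub e₁ e₂ => e₁.eval s - e₂.eval s
  | half e => e.eval s / 2

/-- Expressions with real values; the only constants are natural numbers. -/
inductive RExpr where
  | ofNat (e : NExpr)
  | reg (x : ℕ)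
  | get (A : ℕ) (e : NExpr)
  | add (e₁ e₂ : RExpr)
  | sub (e₁ e₂ : RExpr)
  | mul (e₁ e₂ : RExpr)
  | div (e₁ e₂ : RExpr)

/-- Value of an expression. -/
noncomputable def RExpr.eval (s : State) : RExpr → ℝ
  | ofNat e => (e.eval s : ℝ)
  | reg x => s.rreg x
  | get A e => s.rarr A (e.eval s)
  | add e₁ e₂ => e₁.eval s + e₂.eval s
  | sub e₁ e₂ => e₁.eval s - e₂.eval s
  | mul e₁ e₂ => e₁.eval s * e₂.eval s
  | div e₁ e₂ => e₁.eval s / e₂.eval s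

/-- Tests. -/
inductive Test where
  | nle (e₁ e₂ : NExpr)
  | rle (e₁ e₂ : RExpr)
  | neg (c : Test)
  | and (c₁ c₂ : Test)

/-- Truth of a test. -/
def Test.holds (s : State) : Test → Prop
  | nle e₁ e₂ => e₁.eval s ≤ e₂.eval s
  | rle e₁ e₂ => e₁.eval s ≤ e₂.eval s
  | neg c => ¬ c.holds s
  | and c₁ c₂ => c₁.holds s ∧ c₂.holds s

/-- Programs. -/
inductive Prog where
  | skip
  | setN (x : ℕ) (e : NExpr)
  | setR (x : ℕ) (e : RExpr)
  | putN (A : ℕ) (k e : NExpr)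
  | putR (A : ℕ) (k : NExpr) (e : RExpr)
  | callF (x : ℕ) (e₁ e₂ : RExpr)
  | callGrad (x y : ℕ) (e₁ e₂ : RExpr)
  | seq (c₁ c₂ : Prog)
  | ite (b : Test) (c₁ c₂ : Prog)
  | loop (b : Test) (c : Prog)

open Function in
/-- `Exec f f' c s s' t`: with `f` and `f'` as the aggregation function and its gradient, the
program `c` started in memory `s` halts in memory `s'` after exactly `t` steps. -/
inductive Exec (f : ℝ × ℝ → ℝ) (f' : ℝ × ℝ → ℝ × ℝ) : Prog → State → State → ℕ → Prop
  | skip (s : State) : Exec f f' .skip s s 1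
  | setN (s : State) (x : ℕ) (e : NExpr) :
      Exec f f' (.setN x e) s { s with nreg := update s.nreg x (e.eval s) } 1
  | setR (s : State) (x : ℕ) (e : RExpr) :
      Exec f f' (.setR x e) s { s with rreg := update s.rreg x (e.eval s) } 1
  | putN (s : State) (A : ℕ) (k e : NExpr) :
      Exec f f' (.putN A k e) s
        { s with narr := update s.narr A (update (s.narr A) (k.eval s) (e.eval s)) } 1
  | putR (s : State) (A : ℕ) (k : NExpr) (e : RExpr) :
      Exec f f' (.putR A k e) s
        { s with rarr := update s.rarr A (update (s.rarr A) (k.eval s) (e.eval s)) } 1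
  | callF (s : State) (x : ℕ) (e₁ e₂ : RExpr) :
      Exec f f' (.callF x e₁ e₂) s
        { s with rreg := update s.rreg x (f (e₁.eval s, e₂.eval s)) } 1
  | callGrad (s : State) (x y : ℕ) (e₁ e₂ : RExpr) :
      Exec f f' (.callGrad x y e₁ e₂) s
        { s with
          rreg := update (update s.rreg x (f' (e₁.eval s, e₂.eval s)).1) y
            (f' (e₁.eval s, e₂.eval s)).2 } 1
  | seq {c₁ c₂ : Prog} {s₀ s₁ s₂ : State} {t₁ t₂ : ℕ} :
      Exec f f' c₁ s₀ s₁ t₁ → Exec f f' c₂ s₁ s₂ t₂ → Exec f f' (.seq c₁ c₂) s₀ s₂ (t₁ + t₂)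
  | ite_true {b : Test} {c₁ c₂ : Prog} {s s' : State} {t : ℕ} :
      b.holds s → Exec f f' c₁ s s' t → Exec f f' (.ite b c₁ c₂) s s' (t + 1)
  | ite_false {b : Test} {c₁ c₂ : Prog} {s s' : State} {t : ℕ} :
      ¬ b.holds s → Exec f f' c₂ s s' t → Exec f f' (.ite b c₁ c₂) s s' (t + 1)
  | loop_done {b : Test} {c : Prog} {s : State} :
      ¬ b.holds s → Exec f f' (.loop b c) s s 1
  | loop_step {b : Test} {c : Prog} {s₀ s₁ s₂ : State} {t₁ t₂ : ℕ} :
      b.holds s₀ → Exec f f' c s₀ s₁ t₁ → Exec f f' (.loop b c) s₁ s₂ t₂ →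
        Exec f f' (.loop b c) s₀ s₂ (t₁ + t₂ + 1)

/-- A program has at most one run from a given memory. -/
theorem Exec.unique {f : ℝ × ℝ → ℝ} {f' : ℝ × ℝ → ℝ × ℝ} {c : Prog} {s s₁ s₂ : State}
    {t₁ t₂ : ℕ} (h₁ : Exec f f' c s s₁ t₁) (h₂ : Exec f f' c s s₂ t₂) : s₁ = s₂ ∧ t₁ = t₂ := by
  induction h₁ generalizing s₂ t₂ with
  | skip | setN | setR | putN | putR | callF | callGrad => cases h₂; exact ⟨rfl, rfl⟩
  | seq _ _ ih₁ ih₂ =>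
    cases h₂ with
    | seq k₁ k₂ =>
      obtain ⟨rfl, rfl⟩ := ih₁ k₁
      obtain ⟨rfl, rfl⟩ := ih₂ k₂
      exact ⟨rfl, rfl⟩
  | ite_true hb _ ih =>
    cases h₂ with
    | ite_true _ k => obtain ⟨rfl, rfl⟩ := ih k; exact ⟨rfl, rfl⟩
    | ite_false hb' _ => exact absurd hb hb'
  | ite_false hb _ ih =>
    cases h₂ with
    | ite_true hb' _ => exact absurd hb' hb
    | ite_false _ k => obtain ⟨rfl, rfl⟩ := ih k; exact ⟨rfl, rfl⟩
  | loop_done hb =>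
    cases h₂ with
    | loop_done _ => exact ⟨rfl, rfl⟩
    | loop_step hb' _ _ => exact absurd hb' hb
  | loop_step hb _ _ ih₁ ih₂ =>
    cases h₂ with
    | loop_done hb' => exact absurd hb hb'
    | loop_step _ k₁ k₂ =>
      obtain ⟨rfl, rfl⟩ := ih₁ k₁
      obtain ⟨rfl, rfl⟩ := ih₂ k₂
      exact ⟨rfl, rfl⟩

/-- A vector as an array, with `0` beyond its length. -/
def toArray {n : ℕ} (v : Fin n → ℝ) (k : ℕ) : ℝ := if h : k < n then v ⟨k, h⟩ else 0

/-- Initial memory: the number `n` of results in a register, the numbers `p`, `q` and the accuracy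
`ε` in real registers, the vectors `a`, `b`, `w` in arrays, and a fourth array `ω` for random
numbers; everything else is `0`. -/
def start {n : ℕ} (I : RankInstance n) (P : ℝ × ℝ) (ε : ℝ) (ω : ℕ → ℝ) : State where
  nreg := fun x => if x = 0 then n else 0
  rreg := fun x => if x = 0 then P.1 else if x = 1 then P.2 else if x = 2 then ε else 0
  narr := fun _ _ => 0
  rarr := fun A => if A = 0 then toArray I.a else if A = 1 then toArray I.b
    else if A = 2 then toArray I.w else if A = 3 then ω else fun _ => 0

/-- The final memory `s` solves the local problem of the instance.
* Two rankings `σ`, `τ` stand in the first two arrays, and the gradient of `f` at some point of the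
  segment between their scores is an exact solution of the fixed point inclusion.
* The first two real registers hold positive local dual variables whose objective value is within
  `ε` of the minimum.
* The third real register holds the minimum up to an error of at most `ε`. -/
def Solves {n : ℕ} (I : RankInstance n) (P : ℝ × ℝ) (ε : ℝ) (s : State) : Prop :=
  (∃ σ τ : Equiv.Perm (Fin n),
    (∀ j : Fin n, s.narr 0 j = (σ j : ℕ)) ∧ (∀ j : Fin n, s.narr 1 j = (τ j : ℕ)) ∧
    ∃ g ∈ segment ℝ (I.score σ) (I.score τ),
      I.gradient g ∈ posQuad ∧ g ∈ subgrad I.support (P + I.gradient g)) ∧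
  (s.rreg 0, s.rreg 1) ∈ posQuad ∧
  I.localObj P (s.rreg 0, s.rreg 1) ≤ I.localMin P + (ε : EReal) ∧
  ((s.rreg 2 - ε : ℝ) : EReal) ≤ I.localMin P ∧ I.localMin P ≤ ((s.rreg 2 + ε : ℝ) : EReal)

/-- The law of a sequence of independent random numbers, uniform in `[0, 1]`. -/
noncomputable def tapeLaw : Measure (ℕ → unitInterval) :=
  Measure.infinitePi fun _ => (volume : Measure unitInterval)

end RealRAM

/-! Maximising `P ⬝ g + f g` over the convex hull of the scores is the concave problem dual to
minimising `Ψ_i`. Weak duality (`value_le_localObj`) holds at every point of the hull. Equality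
holds at `x = ∇f(g)` as soon as `g` maximises the linear functional `P + ∇f(g)` over the hull, which
is what membership of `g` in the subdifferential of the support function at `P + ∇f(g)` means
(`mem_subgrad_support_iff`). One such `g` therefore makes the local minimum finite and attained. The
splitting of `Ψ` follows because each pair of dual variables enters a single summand. Existence of
`g` is a by-product of the termination of the algorithm (`exists_mem_subgrad`).

The search runs over directions `(1 - t, t)`, for which exactly the sorted orders matter. A stage
has an interval of parameters with an optimal ranking at each end, such that the gradient direction
at the lower ranking is not below the lower end and that at the upper ranking is not above the upper
end. A query at `t` sorts both rankings stably at `t`. Either one of the two gradients allows one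
side of `t` to be kept, or they lie strictly on different sides of `(1 - t, t)`. In the latter case
the intermediate value theorem gives a point between the two scores whose gradient direction is `(1
- t, t)`, and all points between them are optimal for this direction
(`Finished.exists_mem_subgrad`). If both end rankings coincide, this ranking is optimal on the whole
cone between the end directions, which contains its own gradient direction (`Active.dot_direction`).

Progress is measured by the pairs that the two end rankings order differently. Each has one critical
parameter inside the interval, and a query at `t` retains only pairs with critical parameter
strictly on one side of `t` (`Active.potential_query_le`). Pivots are critical parameters of
inversions, so every round makes progress and the search ends on every tape. For integral scores, a
second query at the midpoint halves the interval, and distinct critical parameters are fractions too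
far apart for a short interval. For real scores, a pivot is drawn in linear time from a family that
contains at least half of the inversions (`card_inversions_le`, `pick_injOn`). This reduces the
number of inversions to at most 7/8 on average, and Markov's inequality gives logarithmically many
rounds with high probability. Each round costs a bounded number of merge sorts.

The exact point on the final segment is not computed. Bisection encloses it until the slope at one
end is at most `ε`, and interpolating between the two end gradients so that the total direction is
orthogonal to the segment gives dual variables with duality gap at most that slope
(`Bracket.localObj_le`). -/

namespace RealRAM

/-! ### Timed Hoare logic for the real RAM -/

variable {f : ℝ × ℝ → ℝ} {f' : ℝ × ℝ → ℝ × ℝ}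

/-- Started in `s`, the program halts after at most `T` steps in a memory that satisfies `Q`. -/
def Halts (f : ℝ × ℝ → ℝ) (f' : ℝ × ℝ → ℝ × ℝ) (c : Prog) (s : State) (T : ℕ)
    (Q : State → Prop) : Prop :=
  ∃ s' t, Exec f f' c s s' t ∧ t ≤ T ∧ Q s'

theorem Halts.mono {c : Prog} {s : State} {T T' : ℕ} {Q Q' : State → Prop}
    (h : Halts f f' c s T Q) (hT : T ≤ T') (hQ : ∀ s', Q s' → Q' s') : Halts f f' c s T' Q' := by
  obtain ⟨s', t, he, ht, hq⟩ := h
  exact ⟨s', t, he, ht.trans hT, hQ _ hq⟩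

theorem Halts.seq {c₁ c₂ : Prog} {s : State} {T₁ T₂ : ℕ} {R Q : State → Prop}
    (h₁ : Halts f f' c₁ s T₁ R) (h₂ : ∀ s', R s' → Halts f f' c₂ s' T₂ Q) :
    Halts f f' (.seq c₁ c₂) s (T₁ + T₂) Q := by
  obtain ⟨s₁, t₁, he₁, ht₁, hr⟩ := h₁
  obtain ⟨s₂, t₂, he₂, ht₂, hq⟩ := h₂ s₁ hr
  exact ⟨s₂, t₁ + t₂, he₁.seq he₂, by omega, hq⟩

theorem Halts.ite {b : Test} {c₁ c₂ : Prog} {s : State} {T : ℕ} {Q : State → Prop}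
    (h₁ : b.holds s → Halts f f' c₁ s T Q) (h₂ : ¬ b.holds s → Halts f f' c₂ s T Q) :
    Halts f f' (.ite b c₁ c₂) s (T + 1) Q := by
  by_cases hb : b.holds s
  · obtain ⟨s', t, he, ht, hq⟩ := h₁ hb
    exact ⟨s', t + 1, .ite_true hb he, by omega, hq⟩
  · obtain ⟨s', t, he, ht, hq⟩ := h₂ hb
    exact ⟨s', t + 1, .ite_false hb he, by omega, hq⟩

/-- A loop with invariant `Inv k` before pass number `k` that stops after at most `N` passes. -/
theorem Halts.loop {b : Test} {c : Prog} {T : ℕ} (Inv : ℕ → State → Prop) (N : ℕ)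
    (hN : ∀ s, Inv N s → ¬ b.holds s)
    (hstep : ∀ k < N, ∀ s, Inv k s → b.holds s → Halts f f' c s T (Inv (k + 1))) (s : State)
    (h0 : Inv 0 s) :
    Halts f f' (.loop b c) s (N * (T + 1) + 1)
      (fun s' => ¬ b.holds s' ∧ ∃ k ≤ N, Inv k s') := by
  suffices H : ∀ j, j ≤ N → ∀ s, Inv (N - j) s →
      Halts f f' (.loop b c) s (j * (T + 1) + 1)
        (fun s' => ¬ b.holds s' ∧ ∃ k ≤ N, Inv k s') by
    exact H N le_rfl s (by simpa using h0)
  intro j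
  induction j with
  | zero => exact fun _ s hs => ⟨s, 1, .loop_done (hN s hs), by simp, hN s hs, N, le_rfl, hs⟩
  | succ j ih =>
    intro hj s hs
    by_cases hb : b.holds s
    · obtain ⟨s₁, t₁, he₁, ht₁, hi⟩ := hstep (N - (j + 1)) (by omega) s hs hb
      rw [show N - (j + 1) + 1 = N - j by omega] at hi
      obtain ⟨s₂, t₂, he₂, ht₂, hq⟩ := ih (by omega) s₁ hi
      refine ⟨s₂, t₁ + t₂ + 1, .loop_step hb he₁ he₂, ?_, hq⟩
      rw [Nat.succ_mul]
      omega
    · exact ⟨s, 1, .loop_done hb, by omega, hb, _, by omega, hs⟩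

/-- Natural number registers that a program may write to. -/
def Prog.wn : Prog → List ℕ
  | .setN x _ => [x]
  | .seq c₁ c₂ | .ite _ c₁ c₂ => c₁.wn ++ c₂.wn
  | .loop _ c => c.wn
  | _ => []

/-- Real registers that a program may write to. -/
def Prog.wr : Prog → List ℕ
  | .setR x _ | .callF x _ _ => [x]
  | .callGrad x y _ _ => [x, y]
  | .seq c₁ c₂ | .ite _ c₁ c₂ => c₁.wr ++ c₂.wr
  | .loop _ c => c.wr
  | _ => []

/-- Arrays of natural numbers that a program may write to. -/
def Prog.wna : Prog → List ℕ
  | .putN A _ _ => [A]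
  | .seq c₁ c₂ | .ite _ c₁ c₂ => c₁.wna ++ c₂.wna
  | .loop _ c => c.wna
  | _ => []

/-- Arrays of real numbers that a program may write to. -/
def Prog.wra : Prog → List ℕ
  | .putR A _ _ => [A]
  | .seq c₁ c₂ | .ite _ c₁ c₂ => c₁.wra ++ c₂.wra
  | .loop _ c => c.wra
  | _ => []

/-- The memories `s` and `s'` agree outside the places that `c` may write to. -/
structure Frame (c : Prog) (s s' : State) : Prop where
  nreg : ∀ x, x ∉ c.wn → s'.nreg x = s.nreg x
  rreg : ∀ x, x ∉ c.wr → s'.rreg x = s.rreg x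
  narr : ∀ A, A ∉ c.wna → s'.narr A = s.narr A
  rarr : ∀ A, A ∉ c.wra → s'.rarr A = s.rarr A

/-- The places a program may write to are read off its text as lists. For concrete programs,
preservation of the rest of the memory is then settled by `decide`. -/
theorem Exec.frame {c : Prog} {s s' : State} {t : ℕ} (h : Exec f f' c s s' t) :
    Frame c s s' := by
  induction h with
  | skip | setN | setR | putN | putR | callF | callGrad =>
    constructor <;> intro x hx <;>
      simp_all [Prog.wn, Prog.wr, Prog.wna, Prog.wra]
  | seq _ _ h₁ h₂ =>
    constructor <;> intro x hx <;>
      simp only [Prog.wn, Prog.wr, Prog.wna, Prog.wra, List.mem_append, not_or] at hx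
    · rw [h₂.nreg x hx.2, h₁.nreg x hx.1]
    · rw [h₂.rreg x hx.2, h₁.rreg x hx.1]
    · rw [h₂.narr x hx.2, h₁.narr x hx.1]
    · rw [h₂.rarr x hx.2, h₁.rarr x hx.1]
  | ite_true _ _ h =>
    constructor <;> intro x hx <;>
      simp only [Prog.wn, Prog.wr, Prog.wna, Prog.wra, List.mem_append, not_or] at hx
    exacts [h.nreg x hx.1, h.rreg x hx.1, h.narr x hx.1, h.rarr x hx.1]
  | ite_false _ _ h =>
    constructor <;> intro x hx <;>
      simp only [Prog.wn, Prog.wr, Prog.wna, Prog.wra, List.mem_append, not_or] at hx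
    exacts [h.nreg x hx.2, h.rreg x hx.2, h.narr x hx.2, h.rarr x hx.2]
  | loop_done => exact ⟨fun _ _ => rfl, fun _ _ => rfl, fun _ _ => rfl, fun _ _ => rfl⟩
  | loop_step _ _ _ h₁ h₂ =>
    constructor <;> intro x hx
    · rw [h₂.nreg x hx, h₁.nreg x hx]
    · rw [h₂.rreg x hx, h₁.rreg x hx]
    · rw [h₂.narr x hx, h₁.narr x hx]
    · rw [h₂.rarr x hx, h₁.rarr x hx]

theorem Halts.frame {c : Prog} {s : State} {T : ℕ} {Q : State → Prop} (h : Halts f f' c s T Q) :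
    Halts f f' c s T (fun s' => Q s' ∧ Frame c s s') := by
  obtain ⟨s', t, he, ht, hq⟩ := h
  exact ⟨s', t, he, ht, hq, he.frame⟩

/-- The program contains no loop. -/
def Prog.loopFree : Prog → Bool
  | .seq c₁ c₂ | .ite _ c₁ c₂ => c₁.loopFree && c₂.loopFree
  | .loop _ _ => false
  | _ => true

/-- An upper bound for the running time of a program without loops. -/
def Prog.size : Prog → ℕ
  | .seq c₁ c₂ => c₁.size + c₂.size
  | .ite _ c₁ c₂ => c₁.size + c₂.size + 1
  | _ => 1

open Function in
open Classical in
/-- The final memory of a program without loops. -/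
noncomputable def Prog.effect (f : ℝ × ℝ → ℝ) (f' : ℝ × ℝ → ℝ × ℝ) : Prog → State → State
  | .skip, s => s
  | .setN x e, s => { s with nreg := update s.nreg x (e.eval s) }
  | .setR x e, s => { s with rreg := update s.rreg x (e.eval s) }
  | .putN A k e, s => { s with narr := update s.narr A (update (s.narr A) (k.eval s) (e.eval s)) }
  | .putR A k e, s => { s with rarr := update s.rarr A (update (s.rarr A) (k.eval s) (e.eval s)) }
  | .callF x e₁ e₂, s => { s with rreg := update s.rreg x (f (e₁.eval s, e₂.eval s)) }
  | .callGrad x y e₁ e₂, s =>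
    { s with
      rreg := update (update s.rreg x (f' (e₁.eval s, e₂.eval s)).1) y
        (f' (e₁.eval s, e₂.eval s)).2 }
  | .seq c₁ c₂, s => c₂.effect f f' (c₁.effect f f' s)
  | .ite b c₁ c₂, s => if b.holds s then c₁.effect f f' s else c₂.effect f f' s
  | .loop _ _, s => s

/-- A loop-free program is a function of the memory, so the correctness of such a block reduces to
simplifying `Prog.effect`. -/
theorem exec_effect {c : Prog} (hc : c.loopFree) (s : State) :
    ∃ t ≤ c.size, Exec f f' c s (c.effect f f' s) t := by
  induction c generalizing s with
  | skip => exact ⟨1, le_rfl, .skip s⟩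
  | setN => exact ⟨1, le_rfl, .setN _ _ _⟩
  | setR => exact ⟨1, le_rfl, .setR _ _ _⟩
  | putN => exact ⟨1, le_rfl, .putN _ _ _ _⟩
  | putR => exact ⟨1, le_rfl, .putR _ _ _ _⟩
  | callF => exact ⟨1, le_rfl, .callF _ _ _ _⟩
  | callGrad => exact ⟨1, le_rfl, .callGrad _ _ _ _ _⟩
  | seq c₁ c₂ h₁ h₂ =>
    simp only [Prog.loopFree, Bool.and_eq_true] at hc
    obtain ⟨t₁, ht₁, he₁⟩ := h₁ hc.1 s
    obtain ⟨t₂, ht₂, he₂⟩ := h₂ hc.2 (c₁.effect f f' s)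
    exact ⟨t₁ + t₂, by simp only [Prog.size]; omega, he₁.seq he₂⟩
  | ite b c₁ c₂ h₁ h₂ =>
    simp only [Prog.loopFree, Bool.and_eq_true] at hc
    by_cases hb : b.holds s
    · obtain ⟨t, ht, he⟩ := h₁ hc.1 s
      refine ⟨t + 1, by simp only [Prog.size]; omega, ?_⟩
      simpa only [Prog.effect, if_pos hb] using Exec.ite_true hb he
    · obtain ⟨t, ht, he⟩ := h₂ hc.2 s
      refine ⟨t + 1, by simp only [Prog.size]; omega, ?_⟩
      simpa only [Prog.effect, if_neg hb] using Exec.ite_false hb he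
  | loop => simp [Prog.loopFree] at hc

theorem Halts.of_effect {c : Prog} (hc : c.loopFree) {s : State} {Q : State → Prop}
    (h : Q (c.effect f f' s)) : Halts f f' c s c.size Q := by
  obtain ⟨t, ht, he⟩ := exec_effect (f := f) (f' := f') hc s
  exact ⟨_, t, he, ht, h⟩

/-- Repeat `c` with register `1` running through the numbers below register `0`. -/
def forLoop (c : Prog) : Prog :=
  .seq (.setN 1 (.const 0))
    (.loop (.neg (.nle (.reg 0) (.reg 1))) (.seq c (.setN 1 (.add (.reg 1) (.const 1)))))

/-- The memory `s` with `k` in register `1`. -/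
def State.setCounter (s : State) (k : ℕ) : State :=
  { s with nreg := Function.update s.nreg 1 k }

/-- A pass costs the body, the increment and the test, whence `c.size + 2`; the final `2` pays for
the initialisation and the last test. -/
theorem Halts.forLoop {c : Prog} (hc : c.loopFree) (h0 : 0 ∉ c.wn) (h1 : 1 ∉ c.wn)
    (Inv : ℕ → State → Prop) {n : ℕ} {s : State} (hn : s.nreg 0 = n)
    (hinit : Inv 0 (s.setCounter 0))
    (hstep : ∀ k < n, ∀ s, s.nreg 0 = n → s.nreg 1 = k → Inv k s →
      Inv (k + 1) ((c.effect f f' s).setCounter (k + 1))) :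
    Halts f f' (forLoop c) s (n * (c.size + 2) + 2)
      (fun s' => Inv n s' ∧ Frame (RealRAM.forLoop c) s s') := by
  apply Halts.frame
  have key := Halts.loop (f := f) (f' := f') (b := .neg (.nle (.reg 0) (.reg 1)))
    (c := .seq c (.setN 1 (.add (.reg 1) (.const 1)))) (T := c.size + 1)
    (fun k s => s.nreg 0 = n ∧ s.nreg 1 = k ∧ Inv k s) n
    (fun s hs => by simp [Test.holds, NExpr.eval, hs.1, hs.2.1])
    (fun k hk s hs _ => by
      refine Halts.seq (T₁ := c.size) (R := fun s' => s' = c.effect f f' s)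
        (Halts.of_effect hc rfl) ?_
      rintro s' rfl
      obtain ⟨t, -, he⟩ := exec_effect (f := f) (f' := f') hc s
      have hfr := he.frame
      have e0 : (c.effect f f' s).nreg 0 = n := (hfr.nreg 0 h0).trans hs.1
      have e1 : (c.effect f f' s).nreg 1 = k := (hfr.nreg 1 h1).trans hs.2.1
      refine ⟨_, 1, .setN _ _ _, le_rfl, by simpa using e0, by simp [NExpr.eval, e1], ?_⟩
      have := hstep k hk s hs.1 hs.2.1 hs.2.2
      simpa [NExpr.eval, e1, State.setCounter] using this)
  have := Halts.seq (f := f) (f' := f') (T₁ := 1) (c₁ := .setN 1 (.const 0))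
    (s := s) (R := fun s' => s' = s.setCounter 0)
    ⟨_, 1, .setN _ _ _, le_rfl, rfl⟩ (fun s' hs' => key s' (by
      subst hs'
      exact ⟨by simpa [State.setCounter] using hn, by simp [State.setCounter], hinit⟩))
  refine this.mono (by rw [show c.size + 1 + 1 = c.size + 2 by rfl]; omega) ?_
  rintro s' ⟨hb, k, hk, hs0, hs1, hI⟩
  simp only [Test.holds, NExpr.eval, hs0, hs1, not_not] at hb
  obtain rfl : k = n := le_antisymm hk hb
  exact hI

end RealRAM

/-! ## Stable sorting -/

/-- Index `p` precedes index `q` when sorting by decreasing key, with ties broken by the index. -/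
def Before (κ : ℕ → ℝ) (p q : ℕ) : Prop := κ q < κ p ∨ κ p = κ q ∧ p < q

theorem Before.trans {κ : ℕ → ℝ} {p q r : ℕ} (h₁ : Before κ p q) (h₂ : Before κ q r) :
    Before κ p r := by
  rcases h₁ with h₁ | ⟨h₁, h₁'⟩ <;> rcases h₂ with h₂ | ⟨h₂, h₂'⟩
  · exact .inl (h₂.trans h₁)
  · exact .inl (h₂ ▸ h₁)
  · exact .inl (h₁ ▸ h₂)
  · exact .inr ⟨h₁.trans h₂, h₁'.trans h₂'⟩

/-- The array `Z` permutes every block of `W` consecutive indices below `n` and sorts it. -/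
structure BlockSorted (κ : ℕ → ℝ) (n W : ℕ) (Z : ℕ → ℕ) : Prop where
  mem : ∀ c k, c * W ≤ k → k < c * W + W → k < n → c * W ≤ Z k ∧ Z k < c * W + W ∧ Z k < n
  sorted : ∀ c k k', c * W ≤ k → k < k' → k' < c * W + W → k' < n → Before κ (Z k) (Z k')

/-- The state of merging the blocks of length `W` of `Z` into blocks of length `2 * W` of `Y`: the
first `k` entries of `Y` are known, and the next one is the better of entries `i` and `j`. -/
structure Merging (κ : ℕ → ℝ) (n W : ℕ) (Z Y : ℕ → ℕ) (c k i j : ℕ) : Prop where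
  le_k : c * (2 * W) ≤ k
  k_le : k ≤ c * (2 * W) + 2 * W
  le_i : c * (2 * W) ≤ i
  i_le : i ≤ c * (2 * W) + W
  le_j : c * (2 * W) + W ≤ j
  j_le : j ≤ c * (2 * W) + 2 * W
  sum : k + (c * (2 * W) + W) = i + j
  j_le_n : j ≤ n ∨ j = c * (2 * W) + W
  mem : ∀ c m, c * (2 * W) ≤ m → m < c * (2 * W) + 2 * W → m < k →
    c * (2 * W) ≤ Y m ∧ Y m < c * (2 * W) + 2 * W ∧ Y m < n
  sorted : ∀ c m m', c * (2 * W) ≤ m → m < m' → m' < c * (2 * W) + 2 * W → m' < k →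
    Before κ (Y m) (Y m')
  left : ∀ m q, c * (2 * W) ≤ m → m < k → i ≤ q → q < c * (2 * W) + W → q < n →
    Before κ (Y m) (Z q)
  right : ∀ m q, c * (2 * W) ≤ m → m < k → j ≤ q → q < c * (2 * W) + 2 * W → q < n →
    Before κ (Y m) (Z q)

theorem block_unique {c c' V k : ℕ} (h₁ : c * V ≤ k) (h₂ : k < c * V + V) (h₁' : c' * V ≤ k)
    (h₂' : k < c' * V + V) : c = c' := by
  by_contra hne
  rcases Nat.lt_or_gt_of_ne hne with h | h
  · have := Nat.mul_le_mul_right V (Nat.succ_le_of_lt h)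
    rw [Nat.succ_mul] at this
    omega
  · have := Nat.mul_le_mul_right V (Nat.succ_le_of_lt h)
    rw [Nat.succ_mul] at this
    omega

namespace Merging

variable {κ : ℕ → ℝ} {n W : ℕ} {Z Y : ℕ → ℕ} {c k i j : ℕ}

theorem start (hW : 0 < W) : Merging κ n W Z Y 0 0 0 W := by
  constructor <;> simp; omega

theorem next_block (h : Merging κ n W Z Y c k i j) (hk : k = c * (2 * W) + 2 * W) :
    Merging κ n W Z Y (c + 1) k k (k + W) := by
  have e : (c + 1) * (2 * W) = k := by rw [hk]; ring
  have := h.le_k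
  constructor
  all_goals try rw [e]
  all_goals try omega
  · exact h.mem
  · exact h.sorted

/-- Common bookkeeping of both merge moves: the new entry must come after the entries already placed
in the block and before everything still waiting in either source block. -/
theorem push (h : Merging κ n W Z Y c k i j) (hk : k < c * (2 * W) + 2 * W) {x i' j' : ℕ}
    (hx : c * (2 * W) ≤ x ∧ x < c * (2 * W) + 2 * W ∧ x < n)
    (hlast : ∀ m, c * (2 * W) ≤ m → m < k → Before κ (Y m) x)
    (hi : i ≤ i') (hi' : i' ≤ c * (2 * W) + W) (hj : j ≤ j') (hj' : j' ≤ c * (2 * W) + 2 * W)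
    (hjn : j' ≤ n ∨ j' = c * (2 * W) + W) (hsum : i' + j' = i + j + 1)
    (hl : ∀ q, i' ≤ q → q < c * (2 * W) + W → q < n → Before κ x (Z q))
    (hr : ∀ q, j' ≤ q → q < c * (2 * W) + 2 * W → q < n → Before κ x (Z q)) :
    Merging κ n W Z (Function.update Y k x) c (k + 1) i' j' := by
  have := h.sum
  have := h.le_k
  have := h.le_i
  have := h.le_j
  refine ⟨by omega, by omega, by omega, hi', by omega, hj', by omega, hjn, ?_, ?_, ?_, ?_⟩
  · intro c' m h₁ h₂ h₃
    by_cases e : m = k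
    · subst e
      obtain rfl := block_unique h₁ h₂ h.le_k hk
      simpa using hx
    · rw [Function.update_of_ne e]
      exact h.mem c' m h₁ h₂ (by omega)
  · intro c' m m' h₁ h₂ h₃ h₄
    rw [Function.update_of_ne (show m ≠ k by omega)]
    by_cases e : m' = k
    · subst e
      obtain rfl := block_unique (h₁.trans h₂.le) h₃ h.le_k hk
      simpa using hlast m h₁ h₂
    · rw [Function.update_of_ne e]
      exact h.sorted c' m m' h₁ h₂ h₃ (by omega)
  · intro m q h₁ h₂ h₃ h₄ h₅
    by_cases e : m = k
    · subst e
      simpa using hl q h₃ h₄ h₅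
    · rw [Function.update_of_ne e]
      exact h.left m q h₁ (by omega) (by omega) h₄ h₅
  · intro m q h₁ h₂ h₃ h₄ h₅
    by_cases e : m = k
    · subst e
      simpa using hr q h₃ h₄ h₅
    · rw [Function.update_of_ne e]
      exact h.right m q h₁ (by omega) (by omega) h₄ h₅

theorem left_mem (hZ : BlockSorted κ n W Z) {q : ℕ} (h₁ : c * (2 * W) ≤ q)
    (h₂ : q < c * (2 * W) + W) (h₃ : q < n) :
    c * (2 * W) ≤ Z q ∧ Z q < c * (2 * W) + W ∧ Z q < n := by
  have e : 2 * c * W = c * (2 * W) := by ring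
  have := hZ.mem (2 * c) q (by omega) (by omega) h₃
  rwa [e] at this

theorem right_mem (hZ : BlockSorted κ n W Z) {q : ℕ} (h₁ : c * (2 * W) + W ≤ q)
    (h₂ : q < c * (2 * W) + 2 * W) (h₃ : q < n) :
    c * (2 * W) + W ≤ Z q ∧ Z q < c * (2 * W) + 2 * W ∧ Z q < n := by
  have e : (2 * c + 1) * W = c * (2 * W) + W := by ring
  have := hZ.mem (2 * c + 1) q (by omega) (by omega) h₃
  omega

theorem left_sorted (hZ : BlockSorted κ n W Z) {q q' : ℕ} (h₁ : c * (2 * W) ≤ q) (h : q < q')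
    (h₂ : q' < c * (2 * W) + W) (h₃ : q' < n) : Before κ (Z q) (Z q') := by
  have e : 2 * c * W = c * (2 * W) := by ring
  exact hZ.sorted (2 * c) q q' (by omega) h (by omega) h₃

theorem right_sorted (hZ : BlockSorted κ n W Z) {q q' : ℕ} (h₁ : c * (2 * W) + W ≤ q)
    (h : q < q') (h₂ : q' < c * (2 * W) + 2 * W) (h₃ : q' < n) : Before κ (Z q) (Z q') := by
  have e : (2 * c + 1) * W = c * (2 * W) + W := by ring
  exact hZ.sorted (2 * c + 1) q q' (by omega) h (by omega) h₃

/-- On equal keys the left entry wins. This agrees with the tie-breaking by index because each block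
permutes its own indices, so all indices on the left are smaller. -/
theorem take_left (hZ : BlockSorted κ n W Z) (h : Merging κ n W Z Y c k i j)
    (hk : k < c * (2 * W) + 2 * W) (hn : k < n) (hi : i < c * (2 * W) + W)
    (hij : ¬ (j < c * (2 * W) + 2 * W ∧ j < n ∧ ¬ κ (Z j) ≤ κ (Z i))) :
    Merging κ n W Z (Function.update Y k (Z i)) c (k + 1) (i + 1) j := by
  have := h.sum
  have := h.le_i
  have := h.le_j
  have hin : i < n := by omega
  have hm := left_mem hZ h.le_i hi hin
  refine h.push hk ⟨hm.1, by omega, hm.2.2⟩ (fun m h₁ h₂ => h.left m i h₁ h₂ le_rfl hi hin)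
    (by omega) (by omega) le_rfl h.j_le h.j_le_n (by omega) (fun q h₁ h₂ h₃ =>
      left_sorted hZ h.le_i (by omega) h₂ h₃) (fun q h₁ h₂ h₃ => ?_)
  have hkey : κ (Z j) ≤ κ (Z i) := by
    by_contra hlt
    exact hij ⟨by omega, by omega, hlt⟩
  have hmj := right_mem hZ h.le_j (q := j) (by omega) (by omega)
  have hb : Before κ (Z i) (Z j) := by
    rcases hkey.lt_or_eq with hlt | heq
    · exact .inl hlt
    · exact .inr ⟨heq.symm, by omega⟩
  rcases h₁.lt_or_eq with hlt | rfl
  · exact hb.trans (right_sorted hZ h.le_j hlt h₂ h₃)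
  · exact hb

/-- Either the left block is used up, which forces `j = k`, or the right key is strictly larger. -/
theorem take_right (hZ : BlockSorted κ n W Z) (h : Merging κ n W Z Y c k i j)
    (hk : k < c * (2 * W) + 2 * W) (hn : k < n)
    (hij : i < c * (2 * W) + W → j < c * (2 * W) + 2 * W ∧ j < n ∧ ¬ κ (Z j) ≤ κ (Z i)) :
    Merging κ n W Z (Function.update Y k (Z j)) c (k + 1) i (j + 1) := by
  have := h.sum
  have := h.le_i
  have := h.i_le
  have := h.le_j
  have hj : j < c * (2 * W) + 2 * W ∧ j < n := by
    by_cases hi : i < c * (2 * W) + W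
    · exact ⟨(hij hi).1, (hij hi).2.1⟩
    · omega
  have hm := right_mem hZ h.le_j hj.1 hj.2
  refine h.push hk ⟨by omega, hm.2.1, hm.2.2⟩
    (fun m h₁ h₂ => h.right m j h₁ h₂ le_rfl hj.1 hj.2)
    le_rfl (by omega) (by omega) (by omega) (by omega) (by omega) (fun q h₁ h₂ h₃ => ?_)
    (fun q h₁ h₂ h₃ => right_sorted hZ h.le_j (by omega) h₂ h₃)
  have hb : Before κ (Z j) (Z i) := .inl (not_le.1 (hij (by omega)).2.2)
  rcases h₁.lt_or_eq with hlt | rfl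
  · exact hb.trans (left_sorted hZ h.le_i hlt h₂ h₃)
  · exact hb

theorem finish (h : Merging κ n W Z Y c n i j) : BlockSorted κ n (2 * W) Y :=
  ⟨fun c k h₁ h₂ h₃ => h.mem c k h₁ h₂ h₃, fun c k k' h₁ h₂ h₃ h₄ => h.sorted c k k' h₁ h₂ h₃ h₄⟩

end Merging

theorem BlockSorted.congr {κ : ℕ → ℝ} {n W : ℕ} {Z Y : ℕ → ℕ} (h : BlockSorted κ n W Z)
    (hY : ∀ k < n, Y k = Z k) : BlockSorted κ n W Y := by
  refine ⟨fun c k h₁ h₂ h₃ => ?_, fun c k k' h₁ h₂ h₃ h₄ => ?_⟩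
  · rw [hY k h₃]
    exact h.mem c k h₁ h₂ h₃
  · rw [hY k (by omega), hY k' h₄]
    exact h.sorted c k k' h₁ h₂ h₃ h₄

theorem BlockSorted.one (κ : ℕ → ℝ) {n : ℕ} {Z : ℕ → ℕ} (hZ : ∀ k < n, Z k = k) :
    BlockSorted κ n 1 Z := by
  refine ⟨fun c k h₁ h₂ h₃ => ?_, fun c k k' h₁ h₂ h₃ h₄ => by omega⟩
  rw [hZ k h₃]
  omega

/-! ### Merge sort as a program -/

namespace RealRAM

variable {f : ℝ × ℝ → ℝ} {f' : ℝ × ℝ → ℝ × ℝ}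

/-- Move one entry of array `2` to array `3`, as part of a merge. -/
def mergeTake : Prog :=
  .ite (.and (.neg (.nle (.reg 4) (.reg 3)))
      (.neg (.and (.neg (.nle (.reg 6) (.reg 5))) (.and (.neg (.nle (.reg 0) (.reg 5)))
        (.neg (.rle (.get 4 (.get 2 (.reg 5))) (.get 4 (.get 2 (.reg 3)))))))))
    (.seq (.putN 3 (.reg 1) (.get 2 (.reg 3))) (.setN 3 (.add (.reg 3) (.const 1))))
    (.seq (.putN 3 (.reg 1) (.get 2 (.reg 5))) (.setN 5 (.add (.reg 5) (.const 1))))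

/-- Go on to the next pair of blocks if the present one is merged. -/
def mergeReset : Prog :=
  .ite (.nle (.reg 6) (.add (.reg 1) (.const 1)))
    (.seq (.setN 3 (.reg 6)) (.seq (.setN 4 (.add (.reg 6) (.reg 2)))
      (.seq (.setN 5 (.add (.reg 6) (.reg 2)))
        (.setN 6 (.add (.reg 6) (.add (.reg 2) (.reg 2)))))))
    .skip

/-- Copy array `A` to array `B`. -/
def copyArray (A B : ℕ) : Prog := forLoop (.putN B (.reg 1) (.get A (.reg 1)))

theorem halts_copyArray {A B : ℕ} (hAB : A ≠ B) {n : ℕ} {s : State} (hn : s.nreg 0 = n) :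
    Halts f f' (copyArray A B) s (n * 3 + 2) (fun s' =>
      (∀ k < n, s'.narr B k = s.narr A k) ∧ Frame (copyArray A B) s s') := by
  refine (Halts.forLoop rfl (by simp [Prog.wn]) (by simp [Prog.wn])
    (fun k s' => s'.narr A = s.narr A ∧ ∀ m < k, s'.narr B m = s.narr A m) hn
    (by simp [State.setCounter]) ?_).mono le_rfl (fun s' h => ⟨h.1.2, h.2⟩)
  rintro k hk s' h0 h1 ⟨hA, hB⟩
  refine ⟨by simpa [Prog.effect, State.setCounter, hAB] using hA, fun m hm => ?_⟩
  by_cases e : m = k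
  · simp [Prog.effect, State.setCounter, NExpr.eval, h1, hA, e]
  · simpa [Prog.effect, State.setCounter, NExpr.eval, h1, e] using hB m (by omega)

/-- Merge adjacent blocks of array `2`; the length of the blocks is in register `2`. -/
def mergePass : Prog :=
  .seq (.seq (.seq (.setN 3 (.const 0)) (.setN 4 (.reg 2)))
      (.seq (.setN 5 (.reg 2)) (.setN 6 (.add (.reg 2) (.reg 2)))))
    (.seq (forLoop (.seq mergeTake mergeReset)) (copyArray 3 2))

/-- Registers `3` and `5` are the two read positions, registers `4` and `6` the ends of the two
source blocks, and the loop counter is the write position. -/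
theorem halts_mergePass {n W : ℕ} {κ : ℕ → ℝ} {s : State} (hn : s.nreg 0 = n)
    (hW : s.nreg 2 = W) (hWpos : 0 < W) (hκ : s.rarr 4 = κ)
    (hZ : BlockSorted κ n W (s.narr 2)) :
    Halts f f' mergePass s (19 * (n + 1)) (fun s' =>
      BlockSorted κ n (2 * W) (s'.narr 2) ∧ Frame mergePass s s') := by
  apply Halts.frame
  refine ((Halts.of_effect (c := .seq (.seq (.setN 3 (.const 0)) (.setN 4 (.reg 2)))
      (.seq (.setN 5 (.reg 2)) (.setN 6 (.add (.reg 2) (.reg 2))))) rfl (Q := fun s' =>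
      s'.nreg 0 = n ∧ s'.nreg 2 = W ∧ s'.narr = s.narr ∧ s'.rarr = s.rarr ∧ s'.nreg 3 = 0 ∧
      s'.nreg 4 = W ∧ s'.nreg 5 = W ∧ s'.nreg 6 = W + W)
      (by simp [Prog.effect, NExpr.eval, hn, hW])).seq
    (T₂ := n * ((Prog.seq mergeTake mergeReset).size + 2) + 2 + (n * 3 + 2)) (Q := fun s' =>
      BlockSorted κ n (2 * W) (s'.narr 2)) ?_).mono
    (by simp only [Prog.size, mergeTake, mergeReset]; omega) (fun s' h => h)
  rintro s₁ ⟨h0, h2, hna, hra, h3, h4, h5, h6⟩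
  refine ((Halts.forLoop (c := .seq mergeTake mergeReset) rfl (by decide) (by decide)
    (fun k s' => s'.nreg 2 = W ∧ s'.narr 2 = s.narr 2 ∧ s'.rarr 4 = κ ∧
      ∃ c, Merging κ n W (s.narr 2) (s'.narr 3) c k (s'.nreg 3) (s'.nreg 5) ∧
        k < c * (2 * W) + 2 * W ∧ s'.nreg 4 = c * (2 * W) + W ∧
        s'.nreg 6 = c * (2 * W) + 2 * W) h0 ?_ ?_).seq (T₂ := n * 3 + 2) (Q := fun s' =>
      BlockSorted κ n (2 * W) (s'.narr 2)) ?_).mono le_rfl (fun s' h => h)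
  · refine ⟨by simpa [State.setCounter] using h2, by simp [State.setCounter, hna],
      by simp [State.setCounter, hra, hκ], 0, ?_, by omega, by simp [State.setCounter, h4],
      by simp [State.setCounter, h6]; omega⟩
    simpa [State.setCounter, h3, h5] using Merging.start hWpos
  · rintro k hk s' h0 h1 ⟨h2, hZ', hκ', c, hM, hkc, h4, h6⟩
    have hcase : ∃ i j x, Merging κ n W (s.narr 2) (Function.update (s'.narr 3) k x) c (k + 1) i j ∧
        mergeTake.effect f f' s' = { s' with
            nreg := Function.update (Function.update s'.nreg 3 i) 5 j
            narr := Function.update s'.narr 3 (Function.update (s'.narr 3) k x) } := by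
      by_cases hb : s'.nreg 3 < c * (2 * W) + W ∧ ¬ (s'.nreg 5 < c * (2 * W) + 2 * W ∧
          s'.nreg 5 < n ∧ ¬ κ (s.narr 2 (s'.nreg 5)) ≤ κ (s.narr 2 (s'.nreg 3)))
      · refine ⟨_, _, _, hM.take_left hZ hkc hk hb.1 hb.2, ?_⟩
        rw [mergeTake, Prog.effect, if_pos]
        · simp only [Prog.effect, NExpr.eval, h1, hZ']
          congr 1
          ext x
          simp only [Function.update_apply]
          split_ifs <;> simp_all
        · simpa [Test.holds, NExpr.eval, RExpr.eval, h0, h4, h6, hκ', hZ'] using hb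
      · refine ⟨_, _, _, hM.take_right hZ hkc hk fun hi => by tauto, ?_⟩
        rw [mergeTake, Prog.effect, if_neg]
        · simp only [Prog.effect, NExpr.eval, h1, hZ']
          congr 1
          ext x
          simp only [Function.update_apply]
          split_ifs <;> simp_all
        · simpa [Test.holds, NExpr.eval, RExpr.eval, h0, h4, h6, hκ', hZ'] using hb
    obtain ⟨i, j, x, hM', he⟩ := hcase
    rw [Prog.effect, he]
    -- The counter is incremented only after the body, so the pair of blocks is complete when `k +
    -- 1` reaches its end.
    by_cases hend : k + 1 = c * (2 * W) + 2 * W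
    · rw [mergeReset, Prog.effect, if_pos (by simp [Test.holds, NExpr.eval, h6, h1, hend])]
      refine ⟨by simpa [State.setCounter, Prog.effect] using h2,
        by simpa [State.setCounter, Prog.effect] using hZ',
        by simpa [State.setCounter, Prog.effect] using hκ', c + 1, ?_, ?_, ?_, ?_⟩
      · simpa [State.setCounter, Prog.effect, NExpr.eval, h6, h2, ← hend] using
          hM'.next_block hend
      · rw [add_mul]; omega
      · simp [State.setCounter, Prog.effect, NExpr.eval, h6, h2, add_mul]
      · simp [State.setCounter, Prog.effect, NExpr.eval, h6, h2, add_mul]; omega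
    · rw [mergeReset, Prog.effect, if_neg (by simp [Test.holds, NExpr.eval, h6, h1]; omega)]
      refine ⟨by simpa [State.setCounter, Prog.effect] using h2,
        by simpa [State.setCounter, Prog.effect] using hZ',
        by simpa [State.setCounter, Prog.effect] using hκ', c, ?_, by omega, ?_, ?_⟩
      · simpa [State.setCounter, Prog.effect] using hM'
      · simpa [State.setCounter, Prog.effect] using h4
      · simpa [State.setCounter, Prog.effect] using h6
  · rintro s₂ ⟨⟨-, -, -, c, hM, -⟩, hfr⟩
    refine (halts_copyArray (by decide) ((hfr.nreg 0 (by decide)).trans h0)).mono le_rfl ?_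
    rintro s₃ ⟨hc, -⟩
    exact hM.finish.congr hc

/-- Merge sort: array `2` receives the indices below `n`, sorted by their keys in array `4`. -/
def sortIndices : Prog :=
  .seq (forLoop (.putN 2 (.reg 1) (.reg 1))) (.seq (.setN 2 (.const 1))
    (.loop (.neg (.nle (.reg 0) (.reg 2))) (.seq mergePass (.setN 2 (.add (.reg 2) (.reg 2))))))

/-- The block length doubles in each pass, so after at most `Nat.clog 2 n` passes block `0` is the
whole array. -/
theorem halts_sortIndices {n : ℕ} {κ : ℕ → ℝ} {s : State} (hn : s.nreg 0 = n)
    (hκ : s.rarr 4 = κ) :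
    Halts f f' sortIndices s (21 * (n + 1) * (Nat.clog 2 n + 1)) (fun s' =>
      ((∀ k < n, s'.narr 2 k < n) ∧
        ∀ k k', k < k' → k' < n → Before κ (s'.narr 2 k) (s'.narr 2 k')) ∧
      Frame sortIndices s s') := by
  apply Halts.frame
  refine ((Halts.forLoop (c := .putN 2 (.reg 1) (.reg 1)) rfl (by decide) (by decide)
    (fun k s' => ∀ m < k, s'.narr 2 m = m) hn (by simp) ?_).seq
    (T₂ := 1 + (Nat.clog 2 n * (19 * (n + 1) + 1 + 1) + 1))
    (Q := fun s' => (∀ k < n, s'.narr 2 k < n) ∧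
        ∀ k k', k < k' → k' < n → Before κ (s'.narr 2 k) (s'.narr 2 k')) ?_).mono ?_ fun _ h => h
  · intro k hk s' h0 h1 hI m hm
    by_cases e : m = k
    · simp [Prog.effect, State.setCounter, NExpr.eval, h1, e]
    · simpa [Prog.effect, State.setCounter, NExpr.eval, h1, e] using hI m (by omega)
  · rintro s₁ ⟨hI, hfr⟩
    refine (Halts.of_effect (c := .setN 2 (.const 1)) rfl (Q := fun s' => s'.nreg 0 = n ∧
      s'.nreg 2 = 1 ∧ s'.rarr 4 = κ ∧ ∀ m < n, s'.narr 2 m = m) ?_).seq ?_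
    · have h0 := hfr.nreg 0 (by decide)
      have h4 := hfr.rarr 4 (by decide)
      simp only [Prog.effect, NExpr.eval]
      refine ⟨by simpa using h0.trans hn, by simp, h4.trans hκ, hI⟩
    · rintro s₂ ⟨h0, h2, h4, hI⟩
      refine (Halts.loop (T := 19 * (n + 1) + 1) (fun h s' => s'.nreg 0 = n ∧
        s'.nreg 2 = 2 ^ h ∧ s'.rarr 4 = κ ∧ BlockSorted κ n (2 ^ h) (s'.narr 2))
        (Nat.clog 2 n) ?_ ?_ s₂ ⟨h0, by simpa using h2, h4, by simpa using .one κ hI⟩).mono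
        le_rfl ?_
      · rintro s' ⟨h0, h2, -⟩
        simp only [Test.holds, NExpr.eval, h0, h2, not_not]
        exact Nat.le_pow_clog (by norm_num) n
      · rintro h - s' ⟨h0, h2, h4, hs⟩ -
        refine (halts_mergePass h0 h2 (by positivity) h4 hs).seq (T₂ := 1) ?_
        rintro s'' ⟨hs', hfr⟩
        have k0 := (hfr.nreg 0 (by decide)).trans h0
        have k2 := (hfr.nreg 2 (by decide)).trans h2
        have k4 := (hfr.rarr 4 (by decide)).trans h4
        refine Halts.of_effect (c := .setN 2 (.add (.reg 2) (.reg 2))) rfl ?_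
        refine ⟨by simpa [Prog.effect] using k0, ?_, by simpa [Prog.effect] using k4, ?_⟩
        · simp only [Prog.effect, NExpr.eval, k2, Function.update_self]
          rw [pow_succ]; omega
        · simpa only [Prog.effect, pow_succ, mul_comm] using hs'
      · rintro s' ⟨hb, h, -, h0, h2, -, hs⟩
        simp only [Test.holds, NExpr.eval, h0, h2, not_not] at hb
        exact ⟨fun k hk => (hs.mem 0 k (by omega) (by omega) hk).2.2,
          fun k k' h₁ h₂ => hs.sorted 0 k k' (by omega) h₁ (by omega) h₂⟩
  · simp only [Prog.size]
    have : Nat.clog 2 n * (19 * (n + 1) + 1 + 1) ≤ 21 * (n + 1) * Nat.clog 2 n := by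
      rw [mul_comm]
      exact Nat.mul_le_mul_right _ (by omega)
    rw [Nat.mul_add _ (Nat.clog 2 n) 1, Nat.mul_one]
    omega

end RealRAM

/-! ## Gradients of aggregation functions -/

theorem dot_comm (x y : ℝ × ℝ) : dot x y = dot y x := by simp only [dot]; ring

theorem dot_add (x y z : ℝ × ℝ) : dot x (y + z) = dot x y + dot x z := by
  simp only [dot, Prod.fst_add, Prod.snd_add]; ring

theorem add_dot (x y z : ℝ × ℝ) : dot (x + y) z = dot x z + dot y z := by
  simp only [dot, Prod.fst_add, Prod.snd_add]; ring

theorem dot_sub (x y z : ℝ × ℝ) : dot x (y - z) = dot x y - dot x z := by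
  simp only [dot, Prod.fst_sub, Prod.snd_sub]; ring

theorem sub_dot (x y z : ℝ × ℝ) : dot (x - y) z = dot x z - dot y z := by
  simp only [dot, Prod.fst_sub, Prod.snd_sub]; ring

theorem dot_smul (c : ℝ) (x y : ℝ × ℝ) : dot x (c • y) = c * dot x y := by
  simp only [dot, Prod.smul_fst, Prod.smul_snd, smul_eq_mul]; ring

theorem smul_dot (c : ℝ) (x y : ℝ × ℝ) : dot (c • x) y = c * dot x y := by
  simp only [dot, Prod.smul_fst, Prod.smul_snd, smul_eq_mul]; ring

theorem neg_dot (x y : ℝ × ℝ) : dot (-x) y = -dot x y := by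
  simp only [dot, Prod.fst_neg, Prod.snd_neg]; ring

theorem dot_neg (x y : ℝ × ℝ) : dot x (-y) = -dot x y := by
  simp only [dot, Prod.fst_neg, Prod.snd_neg]; ring

theorem closedQuad_eq : closedQuad = Set.Ici (0 : ℝ) ×ˢ Set.Ici (0 : ℝ) := rfl

theorem posQuad_eq : posQuad = Set.Ioi (0 : ℝ) ×ˢ Set.Ioi (0 : ℝ) := rfl

theorem convex_posQuad : Convex ℝ posQuad := by
  rw [posQuad_eq]
  exact (convex_Ioi 0).prod (convex_Ioi 0)

theorem add_mem_posQuad {x y : ℝ × ℝ} (hx : x ∈ posQuad) (hy : y ∈ posQuad) : x + y ∈ posQuad :=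
  ⟨add_pos hx.1 hy.1, add_pos hx.2 hy.2⟩

namespace IsObjective

variable {D : Set (ℝ × ℝ)} {f : ℝ × ℝ → ℝ}

theorem uniqueDiffOn (h : IsObjective D f) : UniqueDiffOn ℝ D := by
  rcases h.1 with rfl | rfl
  · rw [closedQuad_eq]
    exact (uniqueDiffOn_Ici 0).prod (uniqueDiffOn_Ici 0)
  · rw [posQuad_eq]
    exact (uniqueDiffOn_Ioi 0).prod (uniqueDiffOn_Ioi 0)

theorem posQuad_subset (h : IsObjective D f) : posQuad ⊆ D := by
  rcases h.1 with rfl | rfl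
  · exact fun x hx => ⟨hx.1.le, hx.2.le⟩
  · exact subset_rfl

theorem mem_of_le (h : IsObjective D f) {x y : ℝ × ℝ} (hx : x ∈ D) (h₁ : x.1 ≤ y.1)
    (h₂ : x.2 ≤ y.2) : y ∈ D := by
  rcases h.1 with rfl | rfl
  · exact ⟨hx.1.trans h₁, hx.2.trans h₂⟩
  · exact ⟨hx.1.trans_le h₁, hx.2.trans_le h₂⟩

theorem fderivWithin_apply_eq (x v : ℝ × ℝ) : fderivWithin ℝ f D x v = dot (grad D f x) v := by
  have : v = v.1 • ((1 : ℝ), (0 : ℝ)) + v.2 • ((0 : ℝ), (1 : ℝ)) := by ext <;> simp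
  rw [this, map_add, map_smul, map_smul]
  simp only [dot, grad, smul_eq_mul, Prod.fst_add, Prod.snd_add, Prod.smul_fst, Prod.smul_snd]
  ring

theorem continuousOn_grad (h : IsObjective D f) : ContinuousOn (grad D f) D := by
  have := h.2.2.2.2.continuousOn_fderivWithin h.uniqueDiffOn le_rfl
  exact (this.clm_apply continuousOn_const).prodMk (this.clm_apply continuousOn_const)

/-- The graph of a concave function lies below its tangent planes. -/
theorem le_tangent (h : IsObjective D f) {x y : ℝ × ℝ} (hx : x ∈ D) (hy : y ∈ D) :
    f y ≤ f x + dot (grad D f x) (y - x) := by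
  rw [← fderivWithin_apply_eq]
  have hd : HasFDerivWithinAt f (fderivWithin ℝ f D x) D x :=
    ((h.2.2.2.2.differentiableOn one_ne_zero) x hx).hasFDerivWithinAt
  have hline : HasDerivWithinAt (fun s : ℝ => x + s • (y - x)) (y - x) (Set.Icc 0 1) 0 := by
    simpa using (((hasDerivAt_id (0 : ℝ)).smul_const (y - x)).const_add x).hasDerivWithinAt
  have hmaps : Set.MapsTo (fun s : ℝ => x + s • (y - x)) (Set.Icc 0 1) D := fun s hs =>
    h.2.1.1.add_smul_sub_mem hx hy hs
  have hcomp := HasFDerivWithinAt.comp_hasDerivWithinAt (l := f) (l' := fderivWithin ℝ f D x)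
    (0 : ℝ) (by simpa using hd) hline hmaps
  -- The directional derivative is a limit of difference quotients, each at least `f y - f x` by
  -- concavity. The limit is one-sided, which covers boundary points of the closed quadrant.
  rw [hasDerivWithinAt_iff_tendsto_slope] at hcomp
  have hne : Filter.NeBot (nhdsWithin (0 : ℝ) (Set.Icc 0 1 \ {0})) := by
    rw [Set.Icc_sdiff_left]
    exact left_nhdsWithin_Ioc_neBot one_pos
  have := ge_of_tendsto (b := f y - f x) hcomp (by
    filter_upwards [self_mem_nhdsWithin] with s hs
    have hs0 : 0 < s := lt_of_le_of_ne hs.1.1 (Ne.symm hs.2)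
    have hc := h.2.1.2 hx hy (sub_nonneg.2 hs.1.2) hs0.le (by ring)
    have e : (1 - s) • x + s • y = x + s • (y - x) := by module
    rw [e] at hc
    simp only [slope, Function.comp, vsub_eq_sub, sub_zero, zero_smul, add_zero, smul_eq_mul] at hc ⊢
    rw [← div_eq_inv_mul, le_div_iff₀ hs0]
    linarith)
  linarith

/-- By the tangent inequality, each partial derivative is at least the increase of `f` over a unit
step, which strict monotonicity makes positive. -/
theorem grad_mem_posQuad (h : IsObjective D f) {x : ℝ × ℝ} (hx : x ∈ D) :
    grad D f x ∈ posQuad := by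
  have h₁ : (x.1 + 1, x.2) ∈ D := h.mem_of_le hx (by simp) le_rfl
  have h₂ : (x.1, x.2 + 1) ∈ D := h.mem_of_le hx le_rfl (by simp)
  have t₁ := h.le_tangent hx h₁
  have t₂ := h.le_tangent hx h₂
  have s₁ := h.2.2.1 x.1 (x.1 + 1) x.2 hx h₁ (by simp)
  have s₂ := h.2.2.2.1 x.1 x.2 (x.2 + 1) hx h₂ (by simp)
  simp only [dot, Prod.fst_sub, Prod.snd_sub] at t₁ t₂
  constructor
  · have : f x < f x + (grad D f x).1 := s₁.trans_le (t₁.trans (le_of_eq (by ring)))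
    linarith
  · have : f x < f x + (grad D f x).2 := s₂.trans_le (t₂.trans (le_of_eq (by ring)))
    linarith

/-- The gradient of a concave function is monotonically decreasing. -/
theorem grad_anti (h : IsObjective D f) {x y : ℝ × ℝ} (hx : x ∈ D) (hy : y ∈ D) :
    dot (grad D f y) (y - x) ≤ dot (grad D f x) (y - x) := by
  have h₁ := h.le_tangent hx hy
  have h₂ := h.le_tangent hy hx
  rw [← neg_sub y x, dot_neg] at h₂
  linarith

theorem le_fenchel {μ x : ℝ × ℝ} (hx : x ∈ D) : ((dot μ x + f x : ℝ) : EReal) ≤ fenchel D f μ :=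
  le_iSup₂ (f := fun x (_ : x ∈ D) => ((dot μ x + f x : ℝ) : EReal)) x hx

theorem fenchel_ne_bot (h : IsObjective D f) (μ : ℝ × ℝ) : fenchel D f μ ≠ ⊥ := by
  have : ((1, 1) : ℝ × ℝ) ∈ D := h.posQuad_subset ⟨one_pos, one_pos⟩
  exact ne_bot_of_le_ne_bot (EReal.coe_ne_bot _) (le_fenchel this)

/-- The dual of `f` at a gradient. -/
theorem fenchel_neg_grad (h : IsObjective D f) {x : ℝ × ℝ} (hx : x ∈ D) :
    fenchel D f (-grad D f x) = ((f x - dot (grad D f x) x : ℝ) : EReal) := by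
  apply le_antisymm
  · refine iSup₂_le fun y hy => EReal.coe_le_coe_iff.2 ?_
    have := h.le_tangent hx hy
    rw [dot_sub] at this
    rw [neg_dot]
    linarith
  · refine le_trans (EReal.coe_le_coe_iff.2 ?_) (le_fenchel (μ := -grad D f x) hx)
    rw [neg_dot]
    linarith

/-- A tangent plane at an interior point is given by the gradient. -/
theorem grad_eq_of_le (h : IsObjective D f) {x v : ℝ × ℝ} (hx : x ∈ posQuad)
    (hv : ∀ y ∈ D, f y - dot v y ≤ f x - dot v x) : grad D f x = v := by
  have hD : D ∈ nhds x := by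
    refine Filter.mem_of_superset ?_ h.posQuad_subset
    rw [posQuad_eq]
    exact (isOpen_Ioi.prod isOpen_Ioi).mem_nhds hx
  have hxD : x ∈ D := mem_of_mem_nhds hD
  have hd : HasFDerivAt f (fderivWithin ℝ f D x) x :=
    (((h.2.2.2.2.differentiableOn one_ne_zero) x hxD).hasFDerivWithinAt).hasFDerivAt hD
  let l : ℝ × ℝ →L[ℝ] ℝ := v.1 • ContinuousLinearMap.fst ℝ ℝ ℝ + v.2 • ContinuousLinearMap.snd ℝ ℝ ℝ
  have hl : ∀ y, l y = dot v y := fun y => by simp [l, dot]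
  have hmax : IsLocalMax (fun y => f y - l y) x := by
    filter_upwards [hD] with y hy
    simpa only [hl] using hv y hy
  have h0 := hmax.hasFDerivAt_eq_zero (hd.sub l.hasFDerivAt)
  have e : ∀ y, dot (grad D f x) y = dot v y := fun y => by
    rw [← fderivWithin_apply_eq, ← hl, sub_eq_zero.1 h0]
  have e₁ := e (1, 0)
  have e₂ := e (0, 1)
  simp only [dot, mul_one, mul_zero, add_zero, zero_add] at e₁ e₂
  exact Prod.ext e₁ e₂

end IsObjective

/-! ### The score polytope, its support function and duality -/

namespace RankInstance

variable {n : ℕ} (I : RankInstance n)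

/-- The primal objective at a pair of cumulative scores. -/
def value (P g : ℝ × ℝ) : ℝ := dot P g + I.f g

/-- The convex hull of the scores of all rankings. -/
def hull : Set (ℝ × ℝ) := convexHull ℝ (Set.range I.score)

/-- The gradient of the primal objective. -/
noncomputable def direction (P g : ℝ × ℝ) : ℝ × ℝ := P + I.gradient g

theorem cs_combination (z : ℝ × ℝ) (σ : Equiv.Perm (Fin n)) :
    cs I.w (fun j => z.1 * I.a j + z.2 * I.b j) σ = dot z (I.score σ) := by
  simp only [cs, dot, score, Finset.mul_sum, ← Finset.sum_add_distrib]
  exact Finset.sum_congr rfl fun j _ => by ring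

theorem dot_score_le (z : ℝ × ℝ) (σ : Equiv.Perm (Fin n)) : dot z (I.score σ) ≤ I.support z := by
  rw [← cs_combination]
  exact Finset.le_sup' (cs I.w _) (Finset.mem_univ σ)

theorem exists_support_eq (z : ℝ × ℝ) : ∃ σ, I.support z = dot z (I.score σ) := by
  obtain ⟨σ, -, h⟩ := Finset.exists_mem_eq_sup' Finset.univ_nonempty
    (cs I.w fun j => z.1 * I.a j + z.2 * I.b j)
  exact ⟨σ, h.trans (I.cs_combination z σ)⟩

theorem score_mem_hull (σ : Equiv.Perm (Fin n)) : I.score σ ∈ I.hull :=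
  subset_convexHull ℝ _ ⟨σ, rfl⟩

theorem dot_le_support {g : ℝ × ℝ} (hg : g ∈ I.hull) (z : ℝ × ℝ) : dot z g ≤ I.support z := by
  have hc : Convex ℝ {g : ℝ × ℝ | dot z g ≤ I.support z} := by
    refine convex_halfSpace_le (f := dot z) ⟨dot_add z, fun c x => ?_⟩ _
    simp [dot_smul]
  exact convexHull_min (Set.range_subset_iff.2 (I.dot_score_le z)) hc hg

theorem hull_subset_dom (hI : I.Valid) : I.hull ⊆ I.dom :=
  convexHull_min (Set.range_subset_iff.2 hI.2.2.2) hI.2.2.1.2.1.1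

theorem segment_subset_hull (σ τ : Equiv.Perm (Fin n)) :
    segment ℝ (I.score σ) (I.score τ) ⊆ I.hull :=
  (convex_convexHull ℝ _).segment_subset (I.score_mem_hull σ) (I.score_mem_hull τ)

theorem support_add_le (y z : ℝ × ℝ) : I.support (y + z) ≤ I.support y + I.support z := by
  obtain ⟨σ, hσ⟩ := I.exists_support_eq (y + z)
  rw [hσ, add_dot]
  exact add_le_add (I.dot_score_le y σ) (I.dot_score_le z σ)

theorem support_zero : I.support 0 = 0 := by
  obtain ⟨σ, hσ⟩ := I.exists_support_eq 0
  simpa [dot] using hσ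

theorem support_smul {c : ℝ} (hc : 0 ≤ c) (z : ℝ × ℝ) : I.support (c • z) = c * I.support z := by
  obtain ⟨σ, hσ⟩ := I.exists_support_eq (c • z)
  obtain ⟨τ, hτ⟩ := I.exists_support_eq z
  apply le_antisymm
  · rw [hσ, smul_dot]
    exact mul_le_mul_of_nonneg_left (I.dot_score_le z σ) hc
  · rw [hτ, ← smul_dot]
    exact I.dot_score_le _ τ

/-- A point outside the hull is separated from it by a linear functional. -/
theorem mem_hull_of_dot_le {v : ℝ × ℝ} (hv : ∀ y, dot v y ≤ I.support y) : v ∈ I.hull := by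
  by_contra hn
  have hclosed : IsClosed I.hull := (Set.finite_range I.score).isClosed_convexHull ℝ
  obtain ⟨l, u, hl, hu⟩ := geometric_hahn_banach_closed_point (convex_convexHull ℝ _) hclosed hn
  have hdot : ∀ x, l x = dot (l (1, 0), l (0, 1)) x := fun x => by
    have : x = x.1 • ((1 : ℝ), (0 : ℝ)) + x.2 • ((0 : ℝ), (1 : ℝ)) := by ext <;> simp
    conv_lhs => rw [this]
    rw [map_add, map_smul, map_smul]
    simp only [dot, smul_eq_mul]
    ring
  obtain ⟨σ, hσ⟩ := I.exists_support_eq (l (1, 0), l (0, 1))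
  have h₁ := hl _ (I.score_mem_hull σ)
  have h₂ := hv (l (1, 0), l (0, 1))
  rw [hdot, ← hσ] at h₁
  rw [hdot, dot_comm] at hu
  linarith

/-- The subgradients form the face of the hull in direction `z`. Subadditivity of the support
function puts a subgradient into the hull, and testing with `-z` shows that it is extremal. -/
theorem mem_subgrad_support_iff {z v : ℝ × ℝ} :
    v ∈ subgrad I.support z ↔ v ∈ I.hull ∧ dot z v = I.support z := by
  constructor
  · intro h
    have hh : v ∈ I.hull := I.mem_hull_of_dot_le fun y => by
      have := h y
      have := I.support_add_le z y
      linarith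
    have := h (-z)
    rw [add_neg_cancel, I.support_zero, dot_neg, dot_comm] at this
    exact ⟨hh, le_antisymm (I.dot_le_support hh z) (by linarith)⟩
  · rintro ⟨hv, he⟩ y
    have := I.dot_le_support hv (z + y)
    rw [add_dot, dot_comm y v] at this
    linarith

theorem subgrad_support_smul {c : ℝ} (hc : 0 < c) (z : ℝ × ℝ) :
    subgrad I.support (c • z) = subgrad I.support z := by
  ext v
  rw [mem_subgrad_support_iff, mem_subgrad_support_iff, smul_dot, I.support_smul hc.le,
    mul_right_inj' hc.ne']

/-- Weak duality. -/
theorem value_le_localObj (hI : I.Valid) (P x : ℝ × ℝ) {g : ℝ × ℝ} (hg : g ∈ I.hull) :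
    ((I.value P g : ℝ) : EReal) ≤ I.localObj P x := by
  have h₁ := I.dot_le_support hg (P + x)
  have h₂ := IsObjective.le_fenchel (f := I.f) (μ := -x) (I.hull_subset_dom hI hg)
  refine le_trans ?_ (add_le_add (EReal.coe_le_coe_iff.2 h₁) h₂)
  rw [← EReal.coe_add, EReal.coe_le_coe_iff, value, add_dot, neg_dot]
  linarith

theorem value_le_localMin (hI : I.Valid) (P : ℝ × ℝ) {g : ℝ × ℝ} (hg : g ∈ I.hull) :
    ((I.value P g : ℝ) : EReal) ≤ I.localMin P :=
  le_iInf₂ fun x _ => I.value_le_localObj hI P x hg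

theorem gradient_mem_posQuad (hI : I.Valid) {g : ℝ × ℝ} (hg : g ∈ I.hull) :
    I.gradient g ∈ posQuad := hI.2.2.1.grad_mem_posQuad (I.hull_subset_dom hI hg)

/-- Strong duality at an exact solution. -/
theorem localObj_gradient (hI : I.Valid) {P g : ℝ × ℝ}
    (hg : g ∈ subgrad I.support (P + I.gradient g)) :
    I.localObj P (I.gradient g) = ((I.value P g : ℝ) : EReal) := by
  obtain ⟨hh, he⟩ := I.mem_subgrad_support_iff.1 hg
  rw [localObj, ← he, gradient, hI.2.2.1.fenchel_neg_grad (I.hull_subset_dom hI hh),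
    ← EReal.coe_add, EReal.coe_eq_coe_iff, value, add_dot]
  ring

/-- Weak duality bounds the infimum from below, and the gradient at `g` is a positive competitor
that attains the bound. -/
theorem localMin_eq (hI : I.Valid) {P g : ℝ × ℝ}
    (hg : g ∈ subgrad I.support (P + I.gradient g)) :
    I.localMin P = ((I.value P g : ℝ) : EReal) := by
  have hh := (I.mem_subgrad_support_iff.1 hg).1
  refine le_antisymm ?_ (I.value_le_localMin hI P hh)
  rw [← I.localObj_gradient hI hg]
  exact iInf₂_le (f := fun x (_ : x ∈ posQuad) => I.localObj P x) _ (I.gradient_mem_posQuad hI hh)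

theorem IsFixedPoint.isMinOn (hI : I.Valid) {P x : ℝ × ℝ} (h : I.IsFixedPoint P x) :
    IsMinOn (I.localObj P) posQuad x := by
  obtain ⟨g, hg, rfl⟩ := h
  intro y _
  show I.localObj P (I.gradient g) ≤ I.localObj P y
  rw [I.localObj_gradient hI hg]
  exact I.value_le_localObj hI P y (I.mem_subgrad_support_iff.1 hg).1

/-- The minimiser `x` is paired with a known solution `g`. Equality in weak duality puts `g` into
the face for `P + x` and makes `y ↦ f y - x ⬝ y` maximal at `g`. Positive scores make `g` an
interior point, where this determines the gradient. -/
theorem isFixedPoint_of_isMinOn (hI : I.Valid) {P x g : ℝ × ℝ} (hpos : ∀ σ, I.score σ ∈ posQuad)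
    (hmin : IsMinOn (I.localObj P) posQuad x)
    (hg : g ∈ subgrad I.support (P + I.gradient g)) : I.IsFixedPoint P x := by
  have hh := (I.mem_subgrad_support_iff.1 hg).1
  have hgpos : g ∈ posQuad := convexHull_min (Set.range_subset_iff.2 hpos) convex_posQuad hh
  have hle : I.localObj P x ≤ ((I.value P g : ℝ) : EReal) := by
    rw [← I.localObj_gradient hI hg]
    exact hmin (I.gradient_mem_posQuad hI hh)
  have key : ∀ y ∈ I.dom, I.support (P + x) + (I.f y - dot x y) ≤ I.value P g := fun y hy => by
    have h₂ := IsObjective.le_fenchel (f := I.f) (μ := -x) hy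
    have := (add_le_add (le_refl ((I.support (P + x) : ℝ) : EReal)) h₂).trans hle
    rw [← EReal.coe_add, EReal.coe_le_coe_iff, neg_dot] at this
    linarith
  have hsup := I.dot_le_support hh (P + x)
  have k := key g (I.hull_subset_dom hI hh)
  rw [add_dot] at hsup
  simp only [value] at k key
  refine ⟨g, I.mem_subgrad_support_iff.2 ⟨hh, ?_⟩, hI.2.2.1.grad_eq_of_le hgpos fun y hy => ?_⟩
  · rw [add_dot]; linarith
  · have := key y hy
    linarith

end RankInstance

/-! ## Stable sorting of rankings -/

section Resort

variable {n : ℕ}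

/-- Sort a ranking by decreasing key; ties keep their order. -/
noncomputable def resort (κ : Fin n → ℝ) (L : Equiv.Perm (Fin n)) : Equiv.Perm (Fin n) :=
  L * Tuple.sort fun p => -κ (L p)

/-- Stability of `Tuple.sort` gives one implication. The other follows because positions are totally
ordered and the relation on the right is asymmetric. -/
theorem resort_symm_lt_iff (κ : Fin n → ℝ) (L : Equiv.Perm (Fin n)) (x y : Fin n) :
    (resort κ L).symm x < (resort κ L).symm y ↔
      κ y < κ x ∨ κ x = κ y ∧ L.symm x < L.symm y := by
  have half : ∀ x y, (resort κ L).symm x < (resort κ L).symm y →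
      κ y < κ x ∨ κ x = κ y ∧ L.symm x < L.symm y := by
    intro x y h
    obtain ⟨hm, hs⟩ := Tuple.eq_sort_iff.1 (rfl : Tuple.sort (fun p => -κ (L p)) = _)
    have h₁ := hm h.le
    have h₂ := hs _ _ h
    simp only [Function.comp_apply] at h₁ h₂
    have e : ∀ z, Tuple.sort (fun p => -κ (L p)) ((resort κ L).symm z) = L.symm z := fun z => by
      rw [Equiv.eq_symm_apply]
      exact (resort κ L).apply_symm_apply z
    simp only [e, Equiv.apply_symm_apply, neg_le_neg_iff, neg_inj] at h₁ h₂
    exact h₁.lt_or_eq.imp id fun h => ⟨h.symm, h₂ h.symm⟩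
  refine ⟨half x y, fun h => ?_⟩
  by_contra hn
  rcases (not_lt.1 hn).lt_or_eq with hlt | heq
  · rcases half y x hlt with h' | ⟨h', h''⟩ <;> rcases h with h | ⟨h, h₂⟩
    · exact lt_asymm h h'
    · exact h'.ne h
    · exact h.ne h'
    · exact lt_asymm h₂ h''
  · obtain rfl := (resort κ L).symm.injective heq
    rcases h with h | ⟨-, h⟩ <;> exact lt_irrefl _ h

/-- The pairs that the ranking `L` has in this order, but `H` has in the other order. -/
def inversions (L H : Equiv.Perm (Fin n)) : Finset (Fin n × Fin n) :=
  {e | L.symm e.1 < L.symm e.2 ∧ H.symm e.2 < H.symm e.1}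

theorem mem_inversions {L H : Equiv.Perm (Fin n)} {x y : Fin n} :
    (x, y) ∈ inversions L H ↔ L.symm x < L.symm y ∧ H.symm y < H.symm x := by
  simp [inversions]

end Resort

/-! ## The search for an optimal pair of rankings -/

/-- A stage of the search: the optimal direction lies between `(1 - lo, lo)` and `(1 - hi, hi)`,
for which `L` and `H` are optimal rankings, unless the search is finished. -/
structure Conf (n : ℕ) where
  /-- lower end of the search interval -/
  lo : ℝ
  /-- upper end of the search interval -/
  hi : ℝ
  /-- ranking at the lower end -/
  L : Equiv.Perm (Fin n)
  /-- ranking at the upper end -/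
  H : Equiv.Perm (Fin n)
  /-- an optimal point has been found on the segment between the scores of `L` and `H` -/
  fin : Bool

namespace RankInstance

variable {n : ℕ} (I : RankInstance n)

/-- Score of a single result in the direction `(1 - t, t)`. -/
def key (t : ℝ) (x : Fin n) : ℝ := (1 - t) * I.a x + t * I.b x

/-- The ranking `L` is sorted by decreasing scores in the direction `(1 - t, t)`. -/
def SortedAt (t : ℝ) (L : Equiv.Perm (Fin n)) : Prop :=
  ∀ x y, L.symm x < L.symm y → I.key t y ≤ I.key t x

theorem sortedAt_resort (t : ℝ) (L : Equiv.Perm (Fin n)) : I.SortedAt t (resort (I.key t) L) := by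
  intro x y h
  rcases (resort_symm_lt_iff _ _ _ _).1 h with h | ⟨h, -⟩
  exacts [h.le, h.ge]

/-- Rearrangement inequality: weights and sorted scores are both decreasing. -/
theorem SortedAt.dot_score (hI : I.Valid) {t : ℝ} {L : Equiv.Perm (Fin n)} (h : I.SortedAt t L) :
    dot (1 - t, t) (I.score L) = I.support (1 - t, t) := by
  refine le_antisymm (I.dot_score_le _ _) (Finset.sup'_le Finset.univ_nonempty _ fun σ _ => ?_)
  rw [← cs_combination]
  have hanti : Antitone fun j => I.key t (L j) := by
    intro p q hpq
    rcases hpq.lt_or_eq with hlt | rfl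
    · exact h _ _ (by simpa using hlt)
    · exact le_rfl
  have := (hI.1.monovary hanti).sum_mul_comp_perm_le_sum_mul (σ := σ.trans L.symm)
  simpa [cs, key] using this

/-- `(1 - t, t)` is at or below the direction of the gradient at `g`. -/
def AboveDir (P : ℝ × ℝ) (t : ℝ) (g : ℝ × ℝ) : Prop :=
  t * (I.direction P g).1 ≤ (1 - t) * (I.direction P g).2

/-- `(1 - t, t)` is at or above the direction of the gradient at `g`. -/
def BelowDir (P : ℝ × ℝ) (t : ℝ) (g : ℝ × ℝ) : Prop :=
  (1 - t) * (I.direction P g).2 ≤ t * (I.direction P g).1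

open Classical in
/-- Compare the optimal direction with `(1 - t, t)`. -/
noncomputable def query (P : ℝ × ℝ) (c : Conf n) (t : ℝ) : Conf n :=
  if I.BelowDir P t (I.score (resort (I.key t) c.L)) then
    { c with hi := t, H := resort (I.key t) c.L }
  else if I.AboveDir P t (I.score (resort (I.key t) c.H)) then
    { c with lo := t, L := resort (I.key t) c.H }
  else { c with L := resort (I.key t) c.L, H := resort (I.key t) c.H, fin := true }

/-- The invariant of the search as long as it is not finished. -/
structure Active (P : ℝ × ℝ) (c : Conf n) : Prop where
  fin : c.fin = false
  lo_nonneg : 0 ≤ c.lo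
  lt : c.lo < c.hi
  hi_le : c.hi ≤ 1
  sorted_lo : I.SortedAt c.lo c.L
  sorted_hi : I.SortedAt c.hi c.H
  above : I.AboveDir P c.lo (I.score c.L)
  below : I.BelowDir P c.hi (I.score c.H)
  strict_lo : ∀ x y, (x, y) ∈ inversions c.L c.H → I.key c.lo y < I.key c.lo x
  strict_hi : ∀ x y, (x, y) ∈ inversions c.L c.H → I.key c.hi x < I.key c.hi y

/-- The direction of the gradient agrees with a common normal of the two rankings at some point
between their scores. -/
def Finished (P : ℝ × ℝ) (c : Conf n) : Prop :=
  ∃ t, 0 < t ∧ t < 1 ∧ I.SortedAt t c.L ∧ I.SortedAt t c.H ∧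
    ¬ I.BelowDir P t (I.score c.L) ∧ ¬ I.AboveDir P t (I.score c.H)

/-- The invariant of the search. -/
def Good (P : ℝ × ℝ) (c : Conf n) : Prop := I.Active P c ∨ c.fin = true ∧ I.Finished P c

theorem key_sub_key (s t : ℝ) (x y : Fin n) :
    I.key s x - I.key s y =
      I.key t x - I.key t y - (s - t) * ((I.a x - I.a y) - (I.b x - I.b y)) := by
  simp only [key]; ring

variable {I} {P : ℝ × ℝ} {c : Conf n} {t : ℝ}

/-- The score difference of two results is affine in `t` with slope minus this gap. On an inversion
it is positive at `lo` and negative at `hi`. So the denominator of `crit` is positive. -/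
theorem Active.gap_pos (h : I.Active P c) {x y : Fin n} (hxy : (x, y) ∈ inversions c.L c.H) :
    0 < (I.a x - I.a y) - (I.b x - I.b y) := by
  have h₁ := h.strict_lo x y hxy
  have h₂ := h.strict_hi x y hxy
  have h₃ := I.key_sub_key c.lo c.hi x y
  have h₄ := h.lt
  by_contra hn
  nlinarith

/-- A stable sort reverses a pair only if its score difference is strictly negative at `t`. This
difference is nonnegative at `lo` and affine, so it is also negative at `hi`, and `H` reverses the
pair too. -/
theorem Active.mem_of_left (h : I.Active P c) (h₁ : c.lo < t) (h₂ : t < c.hi) {x y : Fin n}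
    (hxy : (x, y) ∈ inversions c.L (resort (I.key t) c.L)) :
    (x, y) ∈ inversions c.L c.H ∧ I.key t x < I.key t y := by
  obtain ⟨ha, hb⟩ := mem_inversions.1 hxy
  have hlt : I.key t x < I.key t y := by
    rcases (resort_symm_lt_iff _ _ _ _).1 hb with hb | ⟨-, hb⟩
    · exact hb
    · exact absurd ha hb.asymm
  refine ⟨mem_inversions.2 ⟨ha, ?_⟩, hlt⟩
  have h₃ := h.sorted_lo x y ha
  have h₄ := I.key_sub_key c.lo t x y
  have h₅ := I.key_sub_key c.hi t x y
  have hpos : 0 < (I.a x - I.a y) - (I.b x - I.b y) := by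
    by_contra hn
    nlinarith
  have h₆ : I.key c.hi x < I.key c.hi y := by nlinarith
  by_contra hn
  rcases (not_lt.1 hn).lt_or_eq with hlt' | heq
  · exact absurd (h.sorted_hi x y hlt') (not_le.2 h₆)
  · rw [c.H.symm.injective heq] at hlt
    exact lt_irrefl _ hlt

theorem Active.mem_of_right (h : I.Active P c) (h₁ : c.lo < t) (h₂ : t < c.hi) {x y : Fin n}
    (hxy : (x, y) ∈ inversions (resort (I.key t) c.H) c.H) :
    (x, y) ∈ inversions c.L c.H ∧ I.key t y < I.key t x := by
  obtain ⟨ha, hb⟩ := mem_inversions.1 hxy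
  have hlt : I.key t y < I.key t x := by
    rcases (resort_symm_lt_iff _ _ _ _).1 ha with ha | ⟨-, ha⟩
    · exact ha
    · exact absurd ha hb.asymm
  refine ⟨mem_inversions.2 ⟨?_, hb⟩, hlt⟩
  have h₃ := h.sorted_hi y x hb
  have h₄ := I.key_sub_key c.lo t x y
  have h₅ := I.key_sub_key c.hi t x y
  have hpos : 0 < (I.a x - I.a y) - (I.b x - I.b y) := by
    by_contra hn
    nlinarith
  have h₆ : I.key c.lo y < I.key c.lo x := by nlinarith
  by_contra hn
  rcases (not_lt.1 hn).lt_or_eq with hlt' | heq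
  · exact absurd (h.sorted_lo y x hlt') (not_le.2 h₆)
  · rw [c.L.symm.injective heq] at hlt
    exact lt_irrefl _ hlt

theorem Active.good_query (h : I.Active P c) (h₁ : c.lo < t) (h₂ : t < c.hi) :
    I.Good P (I.query P c t) := by
  have := h.lo_nonneg
  have := h.hi_le
  unfold query
  split_ifs with hb ha
  · refine .inl ⟨h.fin, h.lo_nonneg, h₁, by simp only; linarith, h.sorted_lo,
      I.sortedAt_resort _ _, h.above, hb, fun x y hxy => ?_, fun x y hxy => ?_⟩
    · exact h.strict_lo x y (h.mem_of_left h₁ h₂ hxy).1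
    · exact (h.mem_of_left h₁ h₂ hxy).2
  · refine .inl ⟨h.fin, by simp only; linarith, h₂, h.hi_le, I.sortedAt_resort _ _, h.sorted_hi,
      ha, h.below, fun x y hxy => ?_, fun x y hxy => ?_⟩
    · exact (h.mem_of_right h₁ h₂ hxy).2
    · exact h.strict_hi x y (h.mem_of_right h₁ h₂ hxy).1
  · exact .inr ⟨rfl, t, by linarith, by linarith, I.sortedAt_resort _ _, I.sortedAt_resort _ _,
      hb, ha⟩

/-- The number of pairs that still have to be compared. -/
def potential (c : Conf n) : ℕ := if c.fin then 0 else (inversions c.L c.H).card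

variable (I) in
/-- The parameter of the direction in which two results have equal scores. -/
noncomputable def crit (e : Fin n × Fin n) : ℝ :=
  (I.a e.1 - I.a e.2) / ((I.a e.1 - I.a e.2) - (I.b e.1 - I.b e.2))

theorem Active.crit_lt_iff (h : I.Active P c) {e : Fin n × Fin n} (he : e ∈ inversions c.L c.H)
    (t : ℝ) : I.crit e < t ↔ I.key t e.1 < I.key t e.2 := by
  rw [crit, div_lt_iff₀ (h.gap_pos he), key, key]
  constructor <;> intro h <;> linarith

theorem Active.lt_crit_iff (h : I.Active P c) {e : Fin n × Fin n} (he : e ∈ inversions c.L c.H)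
    (t : ℝ) : t < I.crit e ↔ I.key t e.2 < I.key t e.1 := by
  rw [crit, lt_div_iff₀ (h.gap_pos he), key, key]
  constructor <;> intro h <;> linarith

theorem Active.lo_lt_crit (h : I.Active P c) {e : Fin n × Fin n}
    (he : e ∈ inversions c.L c.H) : c.lo < I.crit e :=
  (h.lt_crit_iff he _).2 (h.strict_lo _ _ he)

theorem Active.crit_lt_hi (h : I.Active P c) {e : Fin n × Fin n}
    (he : e ∈ inversions c.L c.H) : I.crit e < c.hi :=
  (h.crit_lt_iff he _).2 (h.strict_hi _ _ he)

-- The inversions left after a query are old ones with critical parameter strictly on the retained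
-- side. Pairs tied at `t` drop out because ties keep their order.
open Classical in
theorem Active.potential_query_le (h : I.Active P c) (h₁ : c.lo < t) (h₂ : t < c.hi) :
    potential (I.query P c t) ≤
      max ((inversions c.L c.H).filter fun e => I.crit e < t).card
        ((inversions c.L c.H).filter fun e => t < I.crit e).card := by
  unfold query
  split_ifs with hb ha
  · refine le_max_of_le_left ?_
    simp only [potential, h.fin, Bool.false_eq_true, if_false]
    refine Finset.card_le_card fun e he => ?_
    obtain ⟨h₃, h₄⟩ := h.mem_of_left h₁ h₂ he
    exact Finset.mem_filter.2 ⟨h₃, (h.crit_lt_iff h₃ t).2 h₄⟩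
  · refine le_max_of_le_right ?_
    simp only [potential, h.fin, Bool.false_eq_true, if_false]
    refine Finset.card_le_card fun e he => ?_
    obtain ⟨h₃, h₄⟩ := h.mem_of_right h₁ h₂ he
    exact Finset.mem_filter.2 ⟨h₃, (h.lt_crit_iff h₃ t).2 h₄⟩
  · simp [potential]

theorem Active.potential_eq (h : I.Active P c) : potential c = (inversions c.L c.H).card := by
  simp [potential, h.fin]

theorem Active.potential_query_le_self (h : I.Active P c) (h₁ : c.lo < t) (h₂ : t < c.hi) :
    potential (I.query P c t) ≤ potential c := by
  rw [h.potential_eq]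
  exact (h.potential_query_le h₁ h₂).trans
    (max_le (Finset.card_filter_le _ _) (Finset.card_filter_le _ _))

/-- At its own critical parameter the pair `e` is tied, so it is lost on either outcome. -/
theorem Active.potential_query_lt (h : I.Active P c) {e : Fin n × Fin n}
    (he : e ∈ inversions c.L c.H) : potential (I.query P c (I.crit e)) < potential c := by
  classical
  rw [h.potential_eq]
  refine (h.potential_query_le (h.lo_lt_crit he) (h.crit_lt_hi he)).trans_lt (max_lt ?_ ?_) <;>
    exact Finset.card_lt_card (Finset.filter_ssubset.2 ⟨e, he, lt_irrefl _⟩)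

/-- A query shortens the search interval to one side of `t`. -/
theorem query_cases (I : RankInstance n) (P : ℝ × ℝ) (c : Conf n) (t : ℝ) :
    (I.query P c t).fin = true ∨
      (I.query P c t).lo = c.lo ∧ (I.query P c t).hi = t ∨
      (I.query P c t).lo = t ∧ (I.query P c t).hi = c.hi := by
  unfold query
  split_ifs <;> simp

/-- Without inversions, `H⁻¹ ∘ L` is a strictly increasing bijection of `Fin n`, hence the identity.
-/
theorem inversions_eq_empty_iff {L H : Equiv.Perm (Fin n)} : inversions L H = ∅ ↔ L = H := by
  constructor
  · intro h
    have hm : StrictMono fun p => H.symm (L p) := by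
      intro p q hpq
      by_contra hn
      have hne : H.symm (L q) ≠ H.symm (L p) := fun e => hpq.ne' (L.injective (H.symm.injective e))
      have : (L p, L q) ∈ inversions L H :=
        mem_inversions.2 ⟨by simpa using hpq, lt_of_le_of_ne (not_lt.1 hn) hne⟩
      rw [h] at this
      exact Finset.notMem_empty _ this
    have hid : (fun p => H.symm (L p)) = id := by
      have hr : Set.range (fun p => H.symm (L p)) = Set.range (id : Fin n → Fin n) := by
        rw [Set.range_id]
        exact (L.trans H.symm).surjective.range_eq
      exact hm.range_inj strictMono_id |>.1 hr
    ext p : 1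
    have := congrFun hid p
    simpa [Equiv.symm_apply_eq] using this
  · rintro rfl
    refine Finset.eq_empty_of_forall_notMem fun e he => ?_
    obtain ⟨h₁, h₂⟩ := (mem_inversions (x := e.1) (y := e.2)).1 he
    exact lt_asymm h₁ h₂

/-- The search is done. -/
def Done (c : Conf n) : Prop := c.fin = true ∨ c.L = c.H

theorem done_iff {c : Conf n} : Done c ↔ potential c = 0 := by
  unfold Done potential
  split_ifs with h <;> simp [h, inversions_eq_empty_iff]

/-! ### Correctness of the result -/

/-- The gradient direction lies in the cone spanned by the two end directions. A ranking that is
optimal at both ends is optimal on this cone, since the support function is sublinear. -/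
theorem Active.dot_direction (hI : I.Valid) (h : I.Active P c) (hL : c.L = c.H) :
    dot (I.direction P (I.score c.L)) (I.score c.L) =
      I.support (I.direction P (I.score c.L)) := by
  refine le_antisymm (I.dot_score_le _ _) ?_
  set d := I.direction P (I.score c.L) with hd
  have h₁ : c.lo * d.1 ≤ (1 - c.lo) * d.2 := h.above
  have h₂ : (1 - c.hi) * d.2 ≤ c.hi * d.1 := by
    have := h.below
    rwa [← hL] at this
  have hlt := sub_pos.2 h.lt
  -- Coordinates of `d` by Cramer's rule; the determinant of the two end directions is `hi - lo`.
  set α := (c.hi * d.1 - (1 - c.hi) * d.2) / (c.hi - c.lo)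
  set β := ((1 - c.lo) * d.2 - c.lo * d.1) / (c.hi - c.lo)
  have hα : 0 ≤ α := div_nonneg (by linarith) hlt.le
  have hβ : 0 ≤ β := div_nonneg (by linarith) hlt.le
  have hdec : d = α • (1 - c.lo, c.lo) + β • (1 - c.hi, c.hi) := by
    ext <;> simp only [α, β, Prod.fst_add, Prod.snd_add, Prod.smul_mk, smul_eq_mul] <;>
      field_simp <;> ring
  have s₁ := h.sorted_lo.dot_score I hI
  have s₂ := h.sorted_hi.dot_score I hI
  rw [← hL] at s₂
  conv_lhs => rw [hdec]
  refine (I.support_add_le _ _).trans ?_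
  rw [I.support_smul hα, I.support_smul hβ, ← s₁, ← s₂, ← smul_dot, ← smul_dot, ← add_dot,
    ← hdec]

theorem Active.score_mem_subgrad (hI : I.Valid) (h : I.Active P c) (hL : c.L = c.H) :
    I.score c.L ∈ subgrad I.support (P + I.gradient (I.score c.L)) :=
  I.mem_subgrad_support_iff.2 ⟨I.score_mem_hull _, h.dot_direction hI hL⟩

theorem direction_mem_posQuad (hI : I.Valid) (hP : P ∈ posQuad) {g : ℝ × ℝ} (hg : g ∈ I.hull) :
    I.direction P g ∈ posQuad := add_mem_posQuad hP (I.gradient_mem_posQuad hI hg)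

/-- A positive vector with equal pairings with the scores of two rankings that are both optimal in
the direction `(1 - t, t)` is a multiple of this direction. -/
theorem dot_eq_support_of_parallel {z g : ℝ × ℝ} (hz : z ∈ posQuad)
    (hzt : t * z.1 = (1 - t) * z.2) (hg : dot (1 - t, t) g = I.support (1 - t, t)) :
    dot z g = I.support z := by
  have hz' : z = (z.1 + z.2) • (1 - t, t) := by
    ext <;> simp only [Prod.smul_mk, smul_eq_mul] <;> linarith
  rw [hz', smul_dot, hg, I.support_smul (by have := hz.1; have := hz.2; linarith)]

theorem dot_eq_support_of_mem_segment {L H : Equiv.Perm (Fin n)} (hI : I.Valid)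
    (hL : I.SortedAt t L) (hH : I.SortedAt t H) {g : ℝ × ℝ}
    (hg : g ∈ segment ℝ (I.score L) (I.score H)) :
    dot (1 - t, t) g = I.support (1 - t, t) := by
  obtain ⟨u, v, -, -, huv, rfl⟩ := hg
  rw [dot_add, dot_smul, dot_smul, hL.dot_score I hI, hH.dot_score I hI, ← add_mul, huv, one_mul]

/-- Along the segment, the deviation `(1 - t) * d.2 - t * d.1` of the gradient direction `d` is
continuous and changes from positive to negative. At a zero, `d` is a multiple of `(1 - t, t)`, for
which the whole segment is optimal. -/
theorem Finished.exists_mem_subgrad (hI : I.Valid) (hP : P ∈ posQuad) (h : I.Finished P c) :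
    ∃ g ∈ segment ℝ (I.score c.L) (I.score c.H),
      g ∈ subgrad I.support (P + I.gradient g) := by
  obtain ⟨t, -, -, hL, hH, hb, ha⟩ := h
  have hmaps : Set.MapsTo (AffineMap.lineMap (I.score c.L) (I.score c.H)) (Set.Icc (0 : ℝ) 1)
      I.hull := by
    intro s hs
    apply I.segment_subset_hull c.L c.H
    rw [segment_eq_image_lineMap]
    exact ⟨s, hs, rfl⟩
  have hcont : ContinuousOn (fun s : ℝ => I.direction P
      (AffineMap.lineMap (I.score c.L) (I.score c.H) s)) (Set.Icc 0 1) := by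
    refine continuousOn_const.add ?_
    exact hI.2.2.1.continuousOn_grad.comp (AffineMap.lineMap_continuous.continuousOn)
      (hmaps.mono_right (I.hull_subset_dom hI))
  have hcont' : ContinuousOn (fun s : ℝ =>
      (1 - t) * (I.direction P (AffineMap.lineMap (I.score c.L) (I.score c.H) s)).2 -
        t * (I.direction P (AffineMap.lineMap (I.score c.L) (I.score c.H) s)).1)
      (Set.Icc 0 1) :=
    (continuousOn_const.mul (continuous_snd.comp_continuousOn hcont)).sub
      (continuousOn_const.mul (continuous_fst.comp_continuousOn hcont))
  obtain ⟨s, hs, h0⟩ := intermediate_value_Icc' zero_le_one hcont' (show (0 : ℝ) ∈ Set.Icc _ _ by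
    simp only [AboveDir, BelowDir, not_le] at ha hb
    simp only [AffineMap.lineMap_apply_zero, AffineMap.lineMap_apply_one]
    constructor <;> linarith)
  simp only at h0
  refine ⟨AffineMap.lineMap (I.score c.L) (I.score c.H) s, ?_, ?_⟩
  · rw [segment_eq_image_lineMap]
    exact ⟨s, hs, rfl⟩
  · refine I.mem_subgrad_support_iff.2 ⟨hmaps hs, dot_eq_support_of_parallel (t := t)
      (direction_mem_posQuad hI hP (hmaps hs)) (by rw [← direction]; linarith) ?_⟩
    refine dot_eq_support_of_mem_segment hI hL hH ?_
    rw [segment_eq_image_lineMap]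
    exact ⟨s, hs, rfl⟩

theorem Good.exists_mem_subgrad (hI : I.Valid) (hP : P ∈ posQuad) (h : I.Good P c)
    (hs : Done c) : ∃ g ∈ segment ℝ (I.score c.L) (I.score c.H),
      g ∈ subgrad I.support (P + I.gradient g) := by
  rcases h with h | ⟨-, h⟩
  · have hL : c.L = c.H := hs.resolve_left (by simp [h.fin])
    exact ⟨_, left_mem_segment ℝ _ _, h.score_mem_subgrad hI hL⟩
  · exact h.exists_mem_subgrad hI hP

/-! ### The start of the search -/

/-- The first stage of the search. -/
noncomputable def initConf (I : RankInstance n) : Conf n where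
  lo := 0
  hi := 1
  L := resort (I.key 0) (resort (I.key 1) 1)
  H := resort (I.key 1) (resort (I.key 0) (resort (I.key 1) 1))
  fin := false

/-- The preliminary sort by `b` breaks ties of `a` in `L` by decreasing `b`. So a pair tied in `a`
is never reversed in `H`, which gives the strict inequality at the lower end. -/
theorem active_initConf (hI : I.Valid) (hP : P ∈ posQuad) : I.Active P I.initConf := by
  have hd : ∀ σ, I.direction P (I.score σ) ∈ posQuad := fun σ =>
    direction_mem_posQuad hI hP (I.score_mem_hull σ)
  have hkey : ∀ x y, (x, y) ∈ inversions I.initConf.L I.initConf.H →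
      I.key 0 y < I.key 0 x ∧ I.key 1 x < I.key 1 y := by
    intro x y hxy
    obtain ⟨h₁, h₂⟩ := mem_inversions.1 hxy
    have h₃ : I.key 1 x < I.key 1 y := by
      rcases (resort_symm_lt_iff _ _ _ _).1 h₂ with h₂ | ⟨-, h₂⟩
      · exact h₂
      · exact absurd h₁ h₂.asymm
    refine ⟨?_, h₃⟩
    rcases (resort_symm_lt_iff _ _ _ _).1 h₁ with h₁ | ⟨-, h₁⟩
    · exact h₁
    · rcases (resort_symm_lt_iff _ _ _ _).1 h₁ with h₁ | ⟨h₁, -⟩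
      · exact absurd h₁ h₃.asymm
      · exact absurd h₁ h₃.ne
  refine ⟨rfl, le_rfl, zero_lt_one, le_rfl, I.sortedAt_resort _ _, I.sortedAt_resort _ _, ?_, ?_,
    fun x y h => (hkey x y h).1, fun x y h => (hkey x y h).2⟩
  · have := (hd I.initConf.L).2
    simpa [AboveDir, initConf] using this.le
  · have := (hd I.initConf.H).1
    simpa [BelowDir, initConf] using this.le

end RankInstance

/-! ## Selecting an inversion -/

open Classical in
/-- The last number below `n` with property `p`, or `0` if there is none. -/
noncomputable def lastSat (p : ℕ → Prop) : ℕ → ℕ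
  | 0 => 0
  | k + 1 => if p k then k else lastSat p k

theorem lastSat_spec {p : ℕ → Prop} {n : ℕ} (h : ∃ k < n, p k) :
    lastSat p n < n ∧ p (lastSat p n) ∧ ∀ k, lastSat p n < k → k < n → ¬ p k := by
  induction n with
  | zero => simp at h
  | succ n ih =>
    rw [lastSat]
    split_ifs with hp
    · exact ⟨by omega, hp, fun k h₁ h₂ => by omega⟩
    · obtain ⟨k, hk, hpk⟩ := h
      have hkn : k < n := by
        rcases Nat.lt_succ_iff_lt_or_eq.1 hk with h | rfl
        · exact h
        · exact absurd hpk hp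
      obtain ⟨h₁, h₂, h₃⟩ := ih ⟨k, hkn, hpk⟩
      refine ⟨by omega, h₂, fun j h₄ h₅ => ?_⟩
      rcases Nat.lt_succ_iff_lt_or_eq.1 h₅ with h | rfl
      · exact h₃ j h₄ h
      · exact hp

/-- Given weights `δ` of the numbers below `n`, this is the one in whose section of the cumulated
weights `v` lies. -/
noncomputable def weightedIndex (δ : ℕ → ℕ) (n v : ℕ) : ℕ :=
  lastSat (fun p => 0 < δ p ∧ ∑ q ∈ Finset.range p, δ q ≤ v) n

/-- The first positive weight at or after `m` has only zero weights between `m` and itself. -/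
theorem exists_pos_sum_eq {δ : ℕ → ℕ} {m n : ℕ} (hmn : m ≤ n)
    (h : ∑ q ∈ Finset.range m, δ q < ∑ q ∈ Finset.range n, δ q) :
    ∃ p, m ≤ p ∧ p < n ∧ 0 < δ p ∧ ∑ q ∈ Finset.range p, δ q = ∑ q ∈ Finset.range m, δ q := by
  induction n, hmn using Nat.le_induction with
  | base => exact absurd h (lt_irrefl _)
  | succ n hmn ih =>
    by_cases h' : ∑ q ∈ Finset.range m, δ q < ∑ q ∈ Finset.range n, δ q
    · obtain ⟨p, h₁, h₂, h₃⟩ := ih h'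
      exact ⟨p, h₁, by omega, h₃⟩
    · rw [Finset.sum_range_succ] at h
      have hle : ∑ q ∈ Finset.range m, δ q ≤ ∑ q ∈ Finset.range n, δ q :=
        Finset.sum_le_sum_of_subset (Finset.range_subset_range.2 hmn)
      exact ⟨n, hmn, by omega, by omega, by omega⟩

theorem weightedIndex_spec {δ : ℕ → ℕ} {n : ℕ} (h : 0 < ∑ q ∈ Finset.range n, δ q) (v : ℕ) :
    weightedIndex δ n v < n ∧ 0 < δ (weightedIndex δ n v) ∧
      ∑ q ∈ Finset.range (weightedIndex δ n v), δ q ≤ v := by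
  obtain ⟨p, -, h₁, h₂, h₃⟩ := exists_pos_sum_eq (δ := δ) (Nat.zero_le n) (by simpa using h)
  obtain ⟨k₁, k₂, -⟩ := lastSat_spec
    (p := fun p => 0 < δ p ∧ ∑ q ∈ Finset.range p, δ q ≤ v) ⟨p, h₁, h₂, by simp [h₃]⟩
  exact ⟨k₁, k₂⟩

/-- Otherwise the next positive weight would also qualify, against the choice of the last index. -/
theorem lt_weightedIndex_succ {δ : ℕ → ℕ} {n v : ℕ} (h : v < ∑ q ∈ Finset.range n, δ q) :
    v < ∑ q ∈ Finset.range (weightedIndex δ n v + 1), δ q := by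
  obtain ⟨p, -, h₁, h₂, h₃⟩ := exists_pos_sum_eq (δ := δ) (Nat.zero_le n)
    (by simpa using (Nat.zero_le v).trans_lt h)
  obtain ⟨k₁, -, k₃⟩ := lastSat_spec
    (p := fun p => 0 < δ p ∧ ∑ q ∈ Finset.range p, δ q ≤ v) ⟨p, h₁, h₂, by simp [h₃]⟩
  by_contra hn
  obtain ⟨q, h₄, h₅, h₆, h₇⟩ := exists_pos_sum_eq (δ := δ) (m := weightedIndex δ n v + 1)
    (Nat.succ_le_of_lt k₁) ((not_lt.1 hn).trans_lt h)
  exact k₃ q (by unfold weightedIndex at h₄; omega) h₅ ⟨h₆, h₇.le.trans (not_lt.1 hn)⟩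

section PickPair

variable (π : ℕ → ℕ) (n : ℕ)

/-- Total distance by which the map `π` moves numbers below `n` upwards. -/
def totalExcess : ℕ := ∑ p ∈ Finset.range n, (π p - p)

/-- The indicator of the numbers `q` that form an inversion of `π` with a smaller number `i`. -/
def partner (i q : ℕ) : ℕ := if i < q ∧ π q < π i then 1 else 0

/-- First entry of the inversion of `π` number `v`. -/
noncomputable def pickLeft (v : ℕ) : ℕ := weightedIndex (fun p => π p - p) n v

/-- Second entry of the inversion of `π` number `v`. -/
noncomputable def pickRight (v : ℕ) : ℕ :=
  weightedIndex (partner π (pickLeft π n v)) n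
    (v - ∑ q ∈ Finset.range (pickLeft π n v), (π q - q))

variable {π n}

theorem image_range_eq (hmap : ∀ p < n, π p < n) (hinj : Set.InjOn π (Set.Iio n)) :
    (Finset.range n).image π = Finset.range n := by
  refine Finset.eq_of_subset_of_card_le (fun x hx => ?_) ?_
  · obtain ⟨p, hp, rfl⟩ := Finset.mem_image.1 hx
    exact Finset.mem_range.2 (hmap p (Finset.mem_range.1 hp))
  · rw [Finset.card_image_of_injOn (hinj.mono fun x hx => by simpa using hx)]

/-- Of the `π i` values below `π i`, at most `i` occur at positions before `i`; the others occur at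
later positions and form inversions. -/
theorem sub_le_sum_partner (hmap : ∀ p < n, π p < n) (hinj : Set.InjOn π (Set.Iio n)) {i : ℕ}
    (hi : i < n) : π i - i ≤ ∑ q ∈ Finset.range n, partner π i q := by
  simp only [partner, Finset.sum_boole, Nat.cast_id]
  have h₁ : Finset.range (π i) ⊆ ((Finset.range n).filter fun q => π q < π i).image π := by
    intro v hv
    rw [Finset.mem_range] at hv
    have : v ∈ (Finset.range n).image π := by
      rw [image_range_eq hmap hinj, Finset.mem_range]
      exact hv.trans (hmap i hi)
    obtain ⟨q, hq, rfl⟩ := Finset.mem_image.1 this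
    exact Finset.mem_image_of_mem _ (Finset.mem_filter.2 ⟨hq, hv⟩)
  have h₂ := (Finset.card_le_card h₁).trans Finset.card_image_le
  have h₃ : ((Finset.range n).filter fun q => π q < π i) ⊆
      Finset.range i ∪ ((Finset.range n).filter fun q => i < q ∧ π q < π i) := by
    intro q hq
    obtain ⟨hq, hlt⟩ := Finset.mem_filter.1 hq
    rcases lt_trichotomy q i with h | rfl | h
    · exact Finset.mem_union_left _ (Finset.mem_range.2 h)
    · exact absurd hlt (lt_irrefl _)
    · exact Finset.mem_union_right _ (Finset.mem_filter.2 ⟨hq, h, hlt⟩)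
  have h₄ := (Finset.card_le_card h₃).trans (Finset.card_union_le _ _)
  simp only [Finset.card_range] at h₂ h₄
  omega

theorem pickLeft_spec (hD : 0 < totalExcess π n) (v : ℕ) :
    pickLeft π n v < n ∧ pickLeft π n v < π (pickLeft π n v) ∧
      ∑ q ∈ Finset.range (pickLeft π n v), (π q - q) ≤ v := by
  obtain ⟨h₁, h₂, h₃⟩ := weightedIndex_spec (δ := fun p => π p - p) hD v
  exact ⟨h₁, Nat.lt_of_sub_pos h₂, h₃⟩

theorem pickRight_spec (hmap : ∀ p < n, π p < n) (hinj : Set.InjOn π (Set.Iio n))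
    (hD : 0 < totalExcess π n) (v : ℕ) :
    pickRight π n v < n ∧ pickLeft π n v < pickRight π n v ∧
      π (pickRight π n v) < π (pickLeft π n v) := by
  obtain ⟨h₁, h₂, -⟩ := pickLeft_spec hD v
  have h₃ := sub_le_sum_partner hmap hinj h₁
  obtain ⟨k₁, k₂, -⟩ := weightedIndex_spec (δ := partner π (pickLeft π n v)) (n := n) (by omega)
    (v - ∑ q ∈ Finset.range (pickLeft π n v), (π q - q))
  refine ⟨k₁, ?_⟩
  change 0 < partner π (pickLeft π n v) (pickRight π n v) at k₂
  rw [partner] at k₂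
  split_ifs at k₂ with h
  · exact h
  · exact absurd k₂ (lt_irrefl _)

/-- The number `v` can be recovered as the sum of the excesses before the left entry plus the number
of partners before the right entry. The latter is exact because partners have weight one. -/
theorem pick_injOn (hmap : ∀ p < n, π p < n) (hinj : Set.InjOn π (Set.Iio n)) :
    Set.InjOn (fun v => (pickLeft π n v, pickRight π n v)) (Set.Iio (totalExcess π n)) := by
  have key : ∀ v < totalExcess π n, v = ∑ q ∈ Finset.range (pickLeft π n v), (π q - q) +
      ∑ q ∈ Finset.range (pickRight π n v), partner π (pickLeft π n v) q := by
    intro v hv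
    obtain ⟨h₁, h₂, h₃⟩ := pickLeft_spec (Nat.zero_lt_of_lt hv) v
    have h₄ : v < ∑ q ∈ Finset.range (pickLeft π n v + 1), (π q - q) :=
      lt_weightedIndex_succ (δ := fun p => π p - p) hv
    rw [Finset.sum_range_succ] at h₄
    have h₅ := sub_le_sum_partner hmap hinj h₁
    have h₆ : v - ∑ q ∈ Finset.range (pickLeft π n v), (π q - q) <
        ∑ q ∈ Finset.range (pickRight π n v + 1), partner π (pickLeft π n v) q :=
      lt_weightedIndex_succ (by omega)
    rw [Finset.sum_range_succ] at h₆
    have h₇ : ∑ q ∈ Finset.range (pickRight π n v), partner π (pickLeft π n v) q ≤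
        v - ∑ q ∈ Finset.range (pickLeft π n v), (π q - q) :=
      (weightedIndex_spec (by omega) _).2.2
    have h₈ : partner π (pickLeft π n v) (pickRight π n v) ≤ 1 := by
      unfold partner
      split_ifs <;> omega
    omega
  intro v hv v' hv' h
  simp only [Prod.mk.injEq] at h
  rw [key v hv, key v' hv', h.1, h.2]

/-- There are at most twice as many inversions as the total excess. -/
theorem card_inversions_le (hmap : ∀ p < n, π p < n) (hinj : Set.InjOn π (Set.Iio n)) :
    ((Finset.range n ×ˢ Finset.range n).filter fun e => e.1 < e.2 ∧ π e.2 < π e.1).card ≤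
      2 * totalExcess π n := by
  have hsum : ∑ p ∈ Finset.range n, π p = ∑ p ∈ Finset.range n, p := by
    conv_rhs => rw [← image_range_eq hmap hinj]
    rw [Finset.sum_image (hinj.mono fun x hx => by simpa using hx)]
  -- Upward and downward displacements of a permutation balance.
  have hdual : ∑ p ∈ Finset.range n, (p - π p) = totalExcess π n := by
    have : ∑ p ∈ Finset.range n, ((p - π p) + π p) = ∑ p ∈ Finset.range n, ((π p - p) + p) :=
      Finset.sum_congr rfl fun p _ => by omega
    rw [Finset.sum_add_distrib, Finset.sum_add_distrib, hsum] at this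
    exact Nat.add_right_cancel this
  -- An inversion `p < q` is charged to the upward displacement of `p` if `q ≤ π p`. Otherwise `π q
  -- < π p < q`, and it is charged to the downward displacement of `q`.
  have hsub : ((Finset.range n ×ˢ Finset.range n).filter fun e => e.1 < e.2 ∧ π e.2 < π e.1) ⊆
      ((Finset.range n).sigma fun p => Finset.Ioc p (π p)).image (fun e => (e.1, e.2)) ∪
      ((Finset.range n).sigma fun q => (Finset.range n).filter fun p => π q < π p ∧ π p < q).image
        (fun e => (e.2, e.1)) := by
    rintro ⟨p, q⟩ he
    simp only [Finset.mem_filter, Finset.mem_product, Finset.mem_range] at he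
    obtain ⟨⟨hp, hq⟩, h₁, h₂⟩ := he
    by_cases h : q ≤ π p
    · exact Finset.mem_union_left _ (Finset.mem_image.2 ⟨⟨p, q⟩, by simp [hp, h₁, h], rfl⟩)
    · exact Finset.mem_union_right _ (Finset.mem_image.2 ⟨⟨q, p⟩, by simp [hp, hq, h₂]; omega, rfl⟩)
  refine (Finset.card_le_card hsub).trans ((Finset.card_union_le _ _).trans ?_)
  rw [two_mul]
  refine add_le_add (Finset.card_image_le.trans ?_) (Finset.card_image_le.trans ?_)
  · rw [Finset.card_sigma]
    simp [totalExcess]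
  · rw [Finset.card_sigma, ← hdual]
    refine Finset.sum_le_sum fun q _ => ?_
    have : ((Finset.range n).filter fun p => π q < π p ∧ π p < q).image π ⊆
        Finset.Ioo (π q) q := by
      intro x hx
      obtain ⟨p, hp, rfl⟩ := Finset.mem_image.1 hx
      simpa using (Finset.mem_filter.1 hp).2
    have hc := Finset.card_le_card this
    rw [Finset.card_image_of_injOn (hinj.mono fun x hx => by simp_all), Nat.card_Ioo] at hc
    omega

end PickPair

/-! ## Random pivots -/

open Classical in
/-- On average, at most three quarters of the elements lie on the larger side of a pivot. -/
theorem sum_max_card_le {α : Type*} (v : α → ℝ) (T : Finset α) :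
    4 * ∑ e ∈ T, max (T.filter fun d => v d < v e).card (T.filter fun d => v e < v d).card ≤
      3 * T.card ^ 2 := by
  obtain ⟨k, hk⟩ : ∃ k, T.card = k := ⟨_, rfl⟩
  induction k using Nat.strong_induction_on generalizing T with
  | _ k ih =>
  rcases T.eq_empty_or_nonempty with rfl | hne
  · simp
  obtain ⟨x, hx, hxmin⟩ := T.exists_min_image v hne
  rcases (T.erase x).eq_empty_or_nonempty with he | hne'
  · have hT : T = {x} := by rw [← Finset.insert_erase hx, he]; rfl
    subst hT
    simp [Finset.filter_singleton]
  obtain ⟨y, hy, hymax⟩ := (T.erase x).exists_max_image v hne'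
  -- Induction by removing a minimal and a maximal element. Each of these contributes at most `k +
  -- 1` where `k = |T'|`, and every other term grows by at most one. The estimate closes because
  -- `3k² + 12k + 8 ≤ 3(k + 2)²`.
  set T' := (T.erase x).erase y with hT'
  have c₁ : T'.card + 2 = T.card := by
    have h₁ := Finset.card_erase_of_mem hy
    have h₂ := Finset.card_erase_of_mem hx
    have h₃ : 0 < (T.erase x).card := Finset.card_pos.2 hne'
    rw [hT', h₁]
    omega
  have hymax' : ∀ d ∈ T, v d ≤ v y := fun d hd => by
    by_cases e : d = x
    · rw [e]; exact hxmin y (Finset.mem_of_mem_erase hy)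
    · exact hymax d (Finset.mem_erase.2 ⟨e, hd⟩)
  have hbound : ∀ e ∈ T, max (T.filter fun d => v d < v e).card (T.filter fun d => v e < v d).card ≤
      T'.card + 1 := by
    intro e he
    have h₁ : ∀ p : α → Prop, ¬ p e → (T.filter p).card < T.card := fun p hp =>
      Finset.card_lt_card (Finset.filter_ssubset.2 ⟨e, he, hp⟩)
    have h₂ := h₁ (fun d => v d < v e) (lt_irrefl _)
    have h₃ := h₁ (fun d => v e < v d) (lt_irrefl _)
    rw [max_le_iff]
    omega
  have hstep : ∀ e ∈ T', max (T.filter fun d => v d < v e).card (T.filter fun d => v e < v d).card ≤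
      max (T'.filter fun d => v d < v e).card (T'.filter fun d => v e < v d).card + 1 := by
    intro e he
    have heT : e ∈ T := Finset.mem_of_mem_erase (Finset.mem_of_mem_erase he)
    have h₁ : (T.filter fun d => v d < v e) ⊆ insert x (T'.filter fun d => v d < v e) := by
      intro d hd
      obtain ⟨hd, hlt⟩ := Finset.mem_filter.1 hd
      by_cases e₁ : d = x
      · exact Finset.mem_insert.2 (.inl e₁)
      by_cases e₂ : d = y
      · exact absurd hlt (not_lt.2 (e₂ ▸ hymax' e heT))
      exact Finset.mem_insert_of_mem (Finset.mem_filter.2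
        ⟨Finset.mem_erase.2 ⟨e₂, Finset.mem_erase.2 ⟨e₁, hd⟩⟩, hlt⟩)
    have h₂ : (T.filter fun d => v e < v d) ⊆ insert y (T'.filter fun d => v e < v d) := by
      intro d hd
      obtain ⟨hd, hlt⟩ := Finset.mem_filter.1 hd
      by_cases e₂ : d = y
      · exact Finset.mem_insert.2 (.inl e₂)
      by_cases e₁ : d = x
      · exact absurd hlt (not_lt.2 (e₁ ▸ hxmin e heT))
      exact Finset.mem_insert_of_mem (Finset.mem_filter.2
        ⟨Finset.mem_erase.2 ⟨e₂, Finset.mem_erase.2 ⟨e₁, hd⟩⟩, hlt⟩)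
    have k₁ := (Finset.card_le_card h₁).trans (Finset.card_insert_le _ _)
    have k₂ := (Finset.card_le_card h₂).trans (Finset.card_insert_le _ _)
    omega
  have hrec := ih T'.card (by omega) T' rfl
  rw [← Finset.add_sum_erase T _ hx, ← Finset.add_sum_erase _ _ hy]
  have s₁ := Finset.sum_le_sum hstep
  rw [Finset.sum_add_distrib, Finset.sum_const, smul_eq_mul, mul_one] at s₁
  have s₂ := hbound x hx
  have s₃ := hbound y (Finset.mem_of_mem_erase hy)
  rw [← c₁]
  nlinarith

open Classical in
/-- A random pivot from a subset `T` of at least half of the elements of `S` excludes an eighth of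
the elements of `S`, on average. -/
theorem sum_max_card_subset_le {α : Type*} (v : α → ℝ) {S T : Finset α} (hT : T ⊆ S)
    (hcard : S.card ≤ 2 * T.card) :
    8 * ∑ e ∈ T, max (S.filter fun d => v d < v e).card (S.filter fun d => v e < v d).card ≤
      7 * (S.card * T.card) := by
  have hstep : ∀ e ∈ T, max (S.filter fun d => v d < v e).card (S.filter fun d => v e < v d).card ≤
      max (T.filter fun d => v d < v e).card (T.filter fun d => v e < v d).card +
        (S.card - T.card) := by
    intro e _
    have h₁ : ∀ p : α → Prop, (S.filter p).card ≤ (T.filter p).card + (S.card - T.card) := by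
      intro p
      rw [← Finset.card_sdiff_of_subset hT]
      refine (Finset.card_le_card (fun d hd => ?_)).trans (Finset.card_union_le _ _)
      obtain ⟨hd, hp⟩ := Finset.mem_filter.1 hd
      by_cases h : d ∈ T
      · exact Finset.mem_union_left _ (Finset.mem_filter.2 ⟨h, hp⟩)
      · exact Finset.mem_union_right _ (Finset.mem_sdiff.2 ⟨hd, h⟩)
    have k₁ := h₁ fun d => v d < v e
    have k₂ := h₁ fun d => v e < v d
    omega
  have s₁ := Finset.sum_le_sum hstep
  rw [Finset.sum_add_distrib, Finset.sum_const, smul_eq_mul] at s₁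
  have s₂ := sum_max_card_le v T
  obtain ⟨r, hr⟩ := Nat.exists_eq_add_of_le (Finset.card_le_card hT)
  rw [hr] at s₁ hcard ⊢
  rw [Nat.add_sub_cancel_left] at s₁
  -- `3/4 |T| + (|S| - |T|) ≤ 7/8 |S|`, because `T` has at least half of the elements.
  nlinarith

/-! ### Rounds of the search, with pivots drawn from the inversions -/

namespace RankInstance

variable {n : ℕ} (I : RankInstance n) (P : ℝ × ℝ) (c : Conf n)

/-- The position in `H` of the result at position `p` of `L`. -/
def relPos (c : Conf n) (p : ℕ) : ℕ := if h : p < n then c.H.symm (c.L ⟨p, h⟩) else 0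

theorem relPos_lt (p : ℕ) (hp : p < n) : relPos c p < n := by
  rw [relPos, dif_pos hp]
  exact Fin.is_lt _

theorem relPos_injOn : Set.InjOn (relPos c) (Set.Iio n) := by
  intro p hp q hq h
  rw [relPos, relPos, dif_pos (Set.mem_Iio.1 hp), dif_pos (Set.mem_Iio.1 hq), Fin.val_inj] at h
  simpa using c.L.injective (c.H.symm.injective h)

/-- Total distance by which results stand lower in `H` than in `L`. -/
def excess (c : Conf n) : ℕ := totalExcess (relPos c) n

theorem card_inversions_le_excess : (inversions c.L c.H).card ≤ 2 * excess c := by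
  refine le_trans ?_ (card_inversions_le (relPos_lt c) (relPos_injOn c))
  refine Finset.card_le_card_of_injOn (fun e => ((c.L.symm e.1 : ℕ), (c.L.symm e.2 : ℕ))) ?_ ?_
  · intro e he
    obtain ⟨h₁, h₂⟩ := (mem_inversions (x := e.1) (y := e.2)).1 he
    rw [Finset.mem_coe, Finset.mem_filter, Finset.mem_product]
    simpa [relPos] using And.intro h₁ h₂
  · intro e _ e' _ h
    simp only [Prod.mk.injEq, Fin.val_inj, EmbeddingLike.apply_eq_iff_eq] at h
    exact Prod.ext h.1 h.2

theorem excess_eq_zero_iff : excess c = 0 ↔ c.L = c.H := by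
  constructor
  · intro h
    have := card_inversions_le_excess c
    rw [h] at this
    exact inversions_eq_empty_iff.1 (Finset.card_eq_zero.1 (by omega))
  · intro h
    unfold excess totalExcess
    refine Finset.sum_eq_zero fun p hp => ?_
    rw [relPos, dif_pos (Finset.mem_range.1 hp), h]
    simp

/-- The inversion number `v`. -/
noncomputable def pivotPair (v : ℕ) (h : pickLeft (relPos c) n v < n ∧ pickRight (relPos c) n v < n) :
    Fin n × Fin n :=
  (c.L ⟨_, h.1⟩, c.L ⟨_, h.2⟩)

/-- The parameter of the direction in which the two results of inversion number `v` have equal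
scores. -/
noncomputable def pivot (v : ℕ) : ℝ :=
  if h : pickLeft (relPos c) n v < n ∧ pickRight (relPos c) n v < n then
    I.crit (pivotPair c v h) else 0

variable {c} in
theorem pick_lt (hD : 0 < excess c) (v : ℕ) :
    pickLeft (relPos c) n v < n ∧ pickRight (relPos c) n v < n :=
  ⟨(pickLeft_spec hD v).1, (pickRight_spec (relPos_lt c) (relPos_injOn c) hD v).1⟩

-- No upper bound on `v` is needed. In particular, `v = excess c`, which comes from the random
-- number `1`, still selects an inversion.
variable {c} in
theorem pivotPair_mem (hD : 0 < excess c) (v : ℕ) :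
    pivotPair c v (pick_lt hD v) ∈ inversions c.L c.H := by
  obtain ⟨h₁, h₂, h₃⟩ := pickRight_spec (relPos_lt c) (relPos_injOn c) hD v
  refine mem_inversions.2 ⟨by simpa using h₂, ?_⟩
  rwa [relPos, relPos, dif_pos (pick_lt hD v).1, dif_pos (pick_lt hD v).2] at h₃

open Classical in
/-- One round of the search: exclude inversion number `v`, and halve the interval. -/
noncomputable def advance (v : ℕ) : Conf n :=
  if Done c then c
  else if (I.query P c (I.pivot c v)).fin = true then I.query P c (I.pivot c v)
  else I.query P (I.query P c (I.pivot c v))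
    (((I.query P c (I.pivot c v)).lo + (I.query P c (I.pivot c v)).hi) / 2)

/-- Several rounds, with pivots determined by the tape `ω`. -/
noncomputable def run : ℕ → Conf n → (ℕ → ℝ) → Conf n
  | 0, c, _ => c
  | k + 1, c, ω => run k (I.advance P c ⌊ω 0 * excess c⌋₊) fun j => ω (j + 1)

variable {I P c}

theorem Good.active (h : I.Good P c) (hc : ¬ c.fin = true) : I.Active P c :=
  h.resolve_right fun h => hc h.1

theorem Good.active_of_not_done (h : I.Good P c) (hc : ¬ Done c) : I.Active P c :=
  h.active fun h => hc (.inl h)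

theorem excess_pos (hc : ¬ Done c) : 0 < excess c :=
  Nat.pos_of_ne_zero fun h => hc (.inr ((excess_eq_zero_iff c).1 h))

theorem Active.pivot_spec (h : I.Active P c) (hD : 0 < excess c) (v : ℕ) :
    I.pivot c v = I.crit (pivotPair c v (pick_lt hD v)) ∧ c.lo < I.pivot c v ∧
      I.pivot c v < c.hi := by
  have e : I.pivot c v = I.crit (pivotPair c v (pick_lt hD v)) := dif_pos _
  exact ⟨e, e ▸ h.lo_lt_crit (pivotPair_mem hD v), e ▸ h.crit_lt_hi (pivotPair_mem hD v)⟩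

theorem Good.advance (h : I.Good P c) (v : ℕ) : I.Good P (I.advance P c v) := by
  unfold RankInstance.advance
  split_ifs with h₁ h₂
  · exact h
  all_goals
    have ha := h.active_of_not_done h₁
    obtain ⟨-, h₃, h₄⟩ := ha.pivot_spec (excess_pos h₁) v
    have hq := ha.good_query h₃ h₄
  · exact hq
  · have ha' := hq.active h₂
    have := ha'.lt
    exact ha'.good_query (by linarith) (by linarith)

/-- The midpoint query never creates inversions, so the progress of a round can be measured on the
pivot query alone. -/
theorem Good.potential_advance_le (h : I.Good P c) (hc : ¬ Done c) (v : ℕ) :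
    potential (I.advance P c v) ≤ potential (I.query P c (I.pivot c v)) := by
  unfold RankInstance.advance
  rw [if_neg hc]
  split_ifs with h₂
  · exact le_rfl
  · have ha := h.active_of_not_done hc
    obtain ⟨-, h₃, h₄⟩ := ha.pivot_spec (excess_pos hc) v
    have ha' := (ha.good_query h₃ h₄).active h₂
    have := ha'.lt
    exact ha'.potential_query_le_self (by linarith) (by linarith)

theorem Good.potential_advance_lt (h : I.Good P c) (hc : ¬ Done c) (v : ℕ) :
    potential (I.advance P c v) < potential c := by
  refine (h.potential_advance_le hc v).trans_lt ?_
  have ha := h.active_of_not_done hc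
  rw [(ha.pivot_spec (excess_pos hc) v).1]
  exact ha.potential_query_lt (pivotPair_mem (excess_pos hc) v)

/-- Distinct `v` select distinct inversions, so averaging over `v` is averaging over a set `T` of at
least half of the inversions, and the pivot estimate applies. -/
theorem Good.sum_potential_le (h : I.Good P c) (hc : ¬ Done c) :
    8 * ∑ v ∈ Finset.range (excess c), potential (I.advance P c v) ≤
      7 * (potential c * excess c) := by
  classical
  have ha := h.active_of_not_done hc
  have hD := excess_pos hc
  have hinj : Set.InjOn (fun v => pivotPair c v (pick_lt hD v)) (Finset.range (excess c)) := by
    intro v hv v' hv' he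
    refine pick_injOn (relPos_lt c) (relPos_injOn c) (Finset.mem_range.1 hv)
      (Finset.mem_range.1 hv') ?_
    simpa [pivotPair] using he
  set T := (Finset.range (excess c)).image fun v => pivotPair c v (pick_lt hD v) with hT
  have hcard : T.card = excess c := by rw [hT, Finset.card_image_of_injOn hinj, Finset.card_range]
  have hTS : T ⊆ inversions c.L c.H := by
    intro e he
    obtain ⟨v, -, rfl⟩ := Finset.mem_image.1 he
    exact pivotPair_mem hD v
  have hle := sum_max_card_subset_le I.crit hTS (by
    rw [hcard]
    exact card_inversions_le_excess c)
  rw [hcard, ← ha.potential_eq] at hle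
  refine le_trans (Nat.mul_le_mul_left 8 ?_) hle
  rw [hT, Finset.sum_image hinj]
  refine Finset.sum_le_sum fun v _ => (h.potential_advance_le hc v).trans ?_
  obtain ⟨h₁, h₂, h₃⟩ := ha.pivot_spec hD v
  have := ha.potential_query_le h₂ h₃
  rwa [h₁] at this ⊢

theorem advance_of_done (hc : Done c) (v : ℕ) : I.advance P c v = c := if_pos hc

theorem run_of_done (hc : Done c) (k : ℕ) (ω : ℕ → ℝ) : I.run P k c ω = c := by
  induction k generalizing ω with
  | zero => rfl
  | succ k ih => rw [run, advance_of_done hc, ih]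

theorem Good.done_run_potential (h : I.Good P c) {k : ℕ} (hk : potential c ≤ k) (ω : ℕ → ℝ) :
    Done (I.run P k c ω) := by
  induction k generalizing c ω with
  | zero => exact done_iff.2 (Nat.le_zero.1 hk)
  | succ k ih =>
    by_cases hc : Done c
    · rwa [run_of_done hc]
    · have := h.potential_advance_lt hc ⌊ω 0 * excess c⌋₊
      exact ih (h.advance _) (by omega) _

/-! ### Integral scores -/

theorem advance_width (h : I.Good P c) (hc : ¬ Done c) (v : ℕ) :
    Done (I.advance P c v) ∨
      (I.advance P c v).hi - (I.advance P c v).lo ≤ (c.hi - c.lo) / 2 := by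
  have ha := h.active_of_not_done hc
  obtain ⟨-, h₁, h₂⟩ := ha.pivot_spec (excess_pos hc) v
  unfold RankInstance.advance
  rw [if_neg hc]
  split_ifs with hf
  · exact .inl (.inl hf)
  · rcases I.query_cases P c (I.pivot c v) with h₃ | ⟨h₃, h₄⟩ | ⟨h₃, h₄⟩
    · exact absurd h₃ hf
    all_goals
      rcases I.query_cases P (I.query P c (I.pivot c v))
        (((I.query P c (I.pivot c v)).lo + (I.query P c (I.pivot c v)).hi) / 2)
        with h₅ | ⟨h₅, h₆⟩ | ⟨h₅, h₆⟩
      · exact .inl (.inl h₅)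
      all_goals
        right
        rw [h₅, h₆, h₃, h₄]
        linarith

/-- A narrow search interval contains at most one critical parameter if the scores are integers. -/
theorem Active.crit_eq {B : ℕ} (h : I.Active P c) (hA : ∀ j, ∃ k : ℤ, I.a j = k ∧ |k| ≤ B)
    (hB : ∀ j, ∃ k : ℤ, I.b j = k ∧ |k| ≤ B) (hw : 16 * (B : ℝ) ^ 2 * (c.hi - c.lo) < 1)
    {e d : Fin n × Fin n} (he : e ∈ inversions c.L c.H) (hd : d ∈ inversions c.L c.H) :
    ¬ I.crit e < I.crit d := by
  -- The denominator is a signed sum of four scores.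
  have hint : ∀ e ∈ inversions c.L c.H, ∃ p q : ℤ, I.crit e = p / q ∧ 0 < q ∧ q ≤ 4 * B := by
    intro e he
    have hgap := h.gap_pos (x := e.1) (y := e.2) he
    obtain ⟨k₁, e₁, b₁⟩ := hA e.1
    obtain ⟨k₂, e₂, b₂⟩ := hA e.2
    obtain ⟨k₃, e₃, b₃⟩ := hB e.1
    obtain ⟨k₄, e₄, b₄⟩ := hB e.2
    refine ⟨k₁ - k₂, (k₁ - k₂) - (k₃ - k₄), ?_, ?_, ?_⟩
    · rw [crit, e₁, e₂, e₃, e₄]; push_cast; rfl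
    · rw [e₁, e₂, e₃, e₄] at hgap
      exact_mod_cast hgap
    · rw [abs_le] at b₁ b₂ b₃ b₄
      omega
  intro hlt
  obtain ⟨p, q, h₁, h₂, h₃⟩ := hint e he
  obtain ⟨p', q', h₁', h₂', h₃'⟩ := hint d hd
  have hq : (0 : ℝ) < q := by exact_mod_cast h₂
  have hq' : (0 : ℝ) < q' := by exact_mod_cast h₂'
  have hqB : (q : ℝ) ≤ 4 * B := by exact_mod_cast h₃
  have hqB' : (q' : ℝ) ≤ 4 * B := by exact_mod_cast h₃'
  have hdiff : I.crit d - I.crit e < c.hi - c.lo := by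
    have := h.crit_lt_hi hd
    have := h.lo_lt_crit he
    linarith
  -- After clearing denominators, the difference is a positive integer, so distinct critical
  -- parameters are at least `1 / (16 B²)` apart.
  have hone : (1 : ℝ) ≤ (I.crit d - I.crit e) * (q * q') := by
    have e₁ : (I.crit d - I.crit e) * (q * q') = ((p' * q - p * q' : ℤ) : ℝ) := by
      rw [h₁, h₁']
      push_cast
      field_simp
    have h₄ : (0 : ℝ) < (I.crit d - I.crit e) * (q * q') := by
      have := sub_pos.2 hlt
      positivity
    rw [e₁] at h₄ ⊢
    exact_mod_cast Int.add_one_le_iff.2 (Int.cast_pos.1 h₄)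
  have hprod : (q : ℝ) * q' ≤ 16 * (B : ℝ) ^ 2 := by nlinarith
  have h₅ := sub_pos.2 hlt
  nlinarith

/-- All inversions share the critical parameter of the pivot, so none lies strictly on either side
of it. -/
theorem done_advance_of_width {B : ℕ} (h : I.Good P c)
    (hA : ∀ j, ∃ k : ℤ, I.a j = k ∧ |k| ≤ B) (hB : ∀ j, ∃ k : ℤ, I.b j = k ∧ |k| ≤ B)
    (hw : 16 * (B : ℝ) ^ 2 * (c.hi - c.lo) < 1) (v : ℕ) : Done (I.advance P c v) := by
  classical
  by_cases hc : Done c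
  · rwa [advance_of_done hc]
  have ha := h.active_of_not_done hc
  obtain ⟨h₁, h₂, h₃⟩ := ha.pivot_spec (excess_pos hc) v
  rw [done_iff, ← Nat.le_zero]
  refine (h.potential_advance_le hc v).trans ((ha.potential_query_le h₂ h₃).trans ?_)
  have hmem := pivotPair_mem (excess_pos hc) v
  rw [h₁, Finset.filter_false_of_mem fun e he => ha.crit_eq hA hB hw he hmem,
    Finset.filter_false_of_mem fun e he => ha.crit_eq hA hB hw hmem he]
  simp

/-- Each unfinished round halves the interval by its midpoint query; the additional round is the
pivot query in the short interval. -/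
theorem Good.done_run_of_int {B : ℕ} (h : I.Good P c)
    (hA : ∀ j, ∃ k : ℤ, I.a j = k ∧ |k| ≤ B) (hB : ∀ j, ∃ k : ℤ, I.b j = k ∧ |k| ≤ B) {k : ℕ}
    (hw : 16 * (B : ℝ) ^ 2 * (c.hi - c.lo) < 2 ^ k) (ω : ℕ → ℝ) :
    Done (I.run P (k + 1) c ω) := by
  induction k generalizing c ω with
  | zero => exact done_advance_of_width h hA hB (by simpa using hw) _
  | succ k ih =>
    by_cases hc : Done c
    · rwa [run_of_done hc]
    · rw [run]
      rcases advance_width h hc ⌊ω 0 * excess c⌋₊ with hs | hs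
      · rwa [run_of_done hs]
      · refine ih (h.advance _) ?_ _
        have : 16 * (B : ℝ) ^ 2 * ((c.hi - c.lo) / 2) < 2 ^ k := by
          rw [pow_succ _ k] at hw
          linarith
        exact lt_of_le_of_lt (mul_le_mul_of_nonneg_left hs (by positivity)) this

end RankInstance

/-! ## Random tapes -/

namespace RealRAM

open unitInterval ENNReal

/-- Put a number in front of a tape. -/
def consTape (p : I × (ℕ → I)) (k : ℕ) : I := Nat.casesOn k p.1 p.2

theorem measurable_consTape : Measurable consTape := by
  refine measurable_pi_lambda _ fun k => ?_
  cases k with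
  | zero => exact measurable_fst
  | succ k => exact (measurable_pi_apply k).comp measurable_snd

instance : IsProbabilityMeasure tapeLaw := by
  unfold tapeLaw
  infer_instance

/-- Checked on finite-dimensional boxes. Filling the coordinates outside `s` with the whole interval
turns the index set into an initial segment, from which the first factor splits off. -/
theorem map_consTape : ((volume : Measure I).prod tapeLaw).map consTape = tapeLaw := by
  classical
  refine Measure.eq_infinitePi _ fun s t ht => ?_
  rw [Measure.map_apply measurable_consTape (.pi s.countable_toSet fun i _ => ht i)]
  let t' : ℕ → Set I := fun i => if i ∈ s then t i else Set.univ
  have ht' : ∀ i, MeasurableSet (t' i) := fun i => by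
    simp only [t']
    split_ifs
    exacts [ht i, .univ]
  obtain ⟨m, hm⟩ : ∃ m, s ⊆ Finset.range (m + 1) := by
    obtain ⟨m, hm⟩ := s.exists_nat_subset_range
    exact ⟨m, hm.trans (Finset.range_subset_range.2 (Nat.le_succ m))⟩
  have hpre : consTape ⁻¹' Set.pi s t =
      t' 0 ×ˢ Set.pi (Finset.range m : Set ℕ) (fun i => t' (i + 1)) := by
    ext ⟨u, ω⟩
    simp only [Set.mem_preimage, Set.mem_pi, Finset.mem_coe, Set.mem_prod, Finset.mem_range, t']
    constructor
    · intro h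
      constructor
      · split_ifs with h0
        exacts [h 0 h0, trivial]
      · intro i _
        split_ifs with h1
        exacts [h (i + 1) h1, trivial]
    · rintro ⟨h0, h1⟩ k hk
      cases k with
      | zero => simpa [hk, consTape] using h0
      | succ i =>
        have hi : i < m := by simpa using hm hk
        simpa [hk, consTape] using h1 i hi
  rw [hpre, Measure.prod_prod, tapeLaw, Measure.infinitePi_pi (fun _ => volume) fun i _ => ht' _]
  have : ∏ i ∈ s, (volume : Measure I) (t i) =
      ∏ i ∈ Finset.range (m + 1), (volume : Measure I) (t' i) := by
    rw [← Finset.prod_subset hm]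
    · exact Finset.prod_congr rfl fun i hi => by simp [t', hi]
    · intro i _ hi
      simp [t', hi]
  rw [this, Finset.prod_range_succ', mul_comm]

theorem lintegral_tapeLaw {G : (ℕ → I) → ℝ≥0∞} (hG : Measurable G) :
    ∫⁻ ω, G ω ∂tapeLaw = ∫⁻ u : I, ∫⁻ ω, G (consTape (u, ω)) ∂tapeLaw := by
  conv_lhs => rw [← map_consTape]
  rw [lintegral_map hG measurable_consTape,
    lintegral_prod (fun p => G (consTape p)) (hG.comp measurable_consTape).aemeasurable]

/-- A uniform random number selects each of `D` numbers with equal probability. -/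
theorem lintegral_floor_le {D : ℕ} (hD : 0 < D) (g : ℕ → ℝ≥0∞) :
    ∫⁻ u : I, g ⌊(u : ℝ) * D⌋₊ ≤ (∑ v ∈ Finset.range D, g v) / D := by
  have hD' : (0 : ℝ) < D := by exact_mod_cast hD
  have hF : Measurable fun u : I => ⌊(u : ℝ) * D⌋₊ :=
    Nat.measurable_floor.comp (measurable_subtype_coe.mul_const _)
  rw [← lintegral_map (f := g) (measurable_of_countable _) hF, lintegral_countable']
  have hsmall : ∀ v, (volume : Measure I).map (fun u : I => ⌊(u : ℝ) * D⌋₊) {v} ≤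
      if v < D then (D : ℝ≥0∞)⁻¹ else 0 := by
    intro v
    rw [Measure.map_apply hF (measurableSet_singleton v)]
    have hsub : ∀ u : I, u ∈ (fun u : I => ⌊(u : ℝ) * D⌋₊) ⁻¹' {v} →
        (v : ℝ) / D ≤ u ∧ (u : ℝ) ≤ (v + 1) / D := by
      intro u hu
      have hu' : ⌊(u : ℝ) * D⌋₊ = v := hu
      rw [Nat.floor_eq_iff (mul_nonneg u.2.1 hD'.le)] at hu'
      exact ⟨by rw [div_le_iff₀ hD']; exact hu'.1, by rw [le_div_iff₀ hD']; exact hu'.2.le⟩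
    split_ifs with hv
    · have hv' : (v : ℝ) + 1 ≤ D := by exact_mod_cast hv
      let x : I := ⟨v / D, by positivity, by rw [div_le_one hD']; linarith⟩
      let y : I := ⟨(v + 1) / D, by positivity, by rw [div_le_one hD']; linarith⟩
      refine (measure_mono (t := Set.Icc x y) fun u hu => hsub u hu).trans ?_
      rw [unitInterval.volume_Icc]
      have : (y : ℝ) - x = (D : ℝ)⁻¹ := by simp only [x, y]; field_simp; ring
      rw [this, ENNReal.ofReal_inv_of_pos hD', ENNReal.ofReal_natCast]
    -- An index `v ≥ D` can only come from the endpoint `1`, a null set.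
    · have hv' : (D : ℝ) ≤ v := by exact_mod_cast not_lt.1 hv
      refine (measure_mono (t := {1}) fun u hu => ?_).trans (by simp)
      refine Subtype.ext (le_antisymm u.2.2 ?_)
      exact ((one_le_div hD').2 hv').trans (hsub u hu).1
  calc ∑' v, g v * (volume : Measure I).map (fun u : I => ⌊(u : ℝ) * D⌋₊) {v}
      ≤ ∑' v, g v * (if v < D then (D : ℝ≥0∞)⁻¹ else 0) :=
        ENNReal.tsum_le_tsum fun v => by gcongr; exact hsmall v
    _ = ∑ v ∈ Finset.range D, g v * (D : ℝ≥0∞)⁻¹ := by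
        rw [tsum_eq_sum (s := Finset.range D) fun v hv => by
          rw [if_neg (by simpa using hv), mul_zero]]
        exact Finset.sum_congr rfl fun v hv => by rw [if_pos (by simpa using hv)]
    _ = (∑ v ∈ Finset.range D, g v) / D := by rw [← Finset.sum_mul, div_eq_mul_inv]

end RealRAM

/-! ### Geometric decay of the expected number of inversions -/

namespace RankInstance

open ENNReal RealRAM

variable {n : ℕ} {I : RankInstance n} {P : ℝ × ℝ} {c : Conf n}

/-- The first tape entry enters only through a natural number, so by countability the induction
hypothesis for each fixed pivot number suffices. -/
theorem measurable_potential_run (k : ℕ) (c : Conf n) :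
    Measurable fun ω : ℕ → unitInterval =>
      (potential (I.run P k c fun j => (ω j : ℝ)) : ℝ≥0∞) := by
  induction k generalizing c with
  | zero => simp only [run, measurable_const]
  | succ k ih =>
    have h₁ : Measurable fun p : ℕ × (ℕ → unitInterval) =>
        (potential (I.run P k (I.advance P c p.1) fun j => (p.2 j : ℝ)) : ℝ≥0∞) :=
      by
      refine measurable_from_prod_countable_right fun v => ?_
      exact ih (I.advance P c v)
    have h₂ : Measurable fun ω : ℕ → unitInterval =>
        ((⌊(ω 0 : ℝ) * excess c⌋₊, fun j => ω (j + 1)) : ℕ × (ℕ → unitInterval)) := by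
      refine Measurable.prodMk ?_ (measurable_pi_lambda _ fun j => measurable_pi_apply _)
      exact Nat.measurable_floor.comp
        ((measurable_subtype_coe.comp (measurable_pi_apply 0)).mul_const _)
    have h₃ := h₁.comp h₂
    simp only [Function.comp_def] at h₃
    simpa only [run] using h₃

/-- The number of pairs that still have to be compared decreases geometrically on average. -/
theorem Good.lintegral_potential_le (h : I.Good P c) (k : ℕ) :
    ∫⁻ ω, (potential (I.run P k c fun j => (ω j : ℝ)) : ℝ≥0∞) ∂tapeLaw ≤
      (7 / 8) ^ k * potential c := by
  induction k generalizing c with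
  | zero => simp [run]
  | succ k ih =>
    by_cases hc : Done c
    · have : potential c = 0 := done_iff.1 hc
      simp [run_of_done hc, this]
    rw [lintegral_tapeLaw (measurable_potential_run (k + 1) c)]
    have hD := excess_pos hc
    calc ∫⁻ u : unitInterval, ∫⁻ ω, (potential (I.run P (k + 1) c
            fun j => (consTape (u, ω) j : ℝ)) : ℝ≥0∞) ∂tapeLaw
        ≤ ∫⁻ u : unitInterval, (7 / 8) ^ k *
            (potential (I.advance P c ⌊(u : ℝ) * excess c⌋₊) : ℝ≥0∞) :=
          lintegral_mono fun u => ih (h.advance _)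
      _ ≤ (∑ v ∈ Finset.range (excess c), (7 / 8) ^ k *
            (potential (I.advance P c v) : ℝ≥0∞)) / excess c :=
          lintegral_floor_le hD fun v => (7 / 8) ^ k * (potential (I.advance P c v) : ℝ≥0∞)
      _ = (7 / 8) ^ k * ((∑ v ∈ Finset.range (excess c),
            (potential (I.advance P c v) : ℝ≥0∞)) / excess c) := by
          rw [← Finset.mul_sum, mul_div_assoc]
      _ ≤ (7 / 8) ^ k * (7 / 8 * potential c) := by
          gcongr
          have hD0 : (excess c : ℝ≥0∞) ≠ 0 := by exact_mod_cast hD.ne'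
          rw [ENNReal.div_le_iff hD0 (ENNReal.natCast_ne_top _), ← Nat.cast_sum]
          have hs := h.sum_potential_le hc
          have hs' : (8 : ℝ≥0∞) * ((∑ v ∈ Finset.range (excess c),
              potential (I.advance P c v) : ℕ) : ℝ≥0∞) ≤ 7 * (potential c * excess c) := by
            exact_mod_cast hs
          rw [mul_assoc, ENNReal.div_eq_inv_mul, mul_assoc]
          rw [mul_comm (8 : ℝ≥0∞), ← ENNReal.le_div_iff_mul_le (by simp) (by simp),
            ENNReal.div_eq_inv_mul] at hs'
          exact hs'
      _ = (7 / 8) ^ (k + 1) * potential c := by rw [pow_succ, mul_assoc]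

/-- Markov's inequality at threshold `1`: an unfinished search has at least one inversion left. -/
theorem Good.measure_not_done_le (h : I.Good P c) (k : ℕ) :
    tapeLaw {ω | ¬ Done (I.run P k c fun j => (ω j : ℝ))} ≤ (7 / 8) ^ k * potential c := by
  refine le_trans ?_ (h.lintegral_potential_le k)
  have hm := mul_meas_ge_le_lintegral (μ := tapeLaw)
    (measurable_potential_run (I := I) (P := P) k c) 1
  rw [one_mul] at hm
  refine le_trans (measure_mono fun ω hω => ?_) hm
  have : potential (I.run P k c fun j => (ω j : ℝ)) ≠ 0 := fun h0 => hω (done_iff.2 h0)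
  show (1 : ℝ≥0∞) ≤ _
  exact_mod_cast Nat.one_le_iff_ne_zero.2 this

end RankInstance

/-! ## The program: sorting, scores, queries -/

namespace RealRAM

variable {n : ℕ} {I : RankInstance n} {P : ℝ × ℝ} {ε : ℝ} {ω : ℕ → ℝ} {s s' : State}

/-- The input is in its place. -/
structure HasInput (I : RankInstance n) (P : ℝ × ℝ) (ε : ℝ) (ω : ℕ → ℝ) (s : State) : Prop where
  size : s.nreg 0 = n
  fst : s.rreg 0 = P.1
  snd : s.rreg 1 = P.2
  eps : s.rreg 2 = ε
  a : s.rarr 0 = toArray I.a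
  b : s.rarr 1 = toArray I.b
  w : s.rarr 2 = toArray I.w
  tape : s.rarr 3 = ω

/-- The program does not write to the places of the input. -/
def Prog.keepsInput (c : Prog) : Bool :=
  !c.wn.contains 0 && !c.wr.contains 0 && !c.wr.contains 1 && !c.wr.contains 2 &&
    !c.wra.contains 0 && !c.wra.contains 1 && !c.wra.contains 2 && !c.wra.contains 3

theorem HasInput.frame {c : Prog} (h : HasInput I P ε ω s) (hf : Frame c s s')
    (hc : c.keepsInput) : HasInput I P ε ω s' := by
  simp only [Prog.keepsInput, Bool.and_eq_true, Bool.not_eq_true', List.contains_eq_mem,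
    decide_eq_false_iff_not] at hc
  obtain ⟨⟨⟨⟨⟨⟨⟨h₁, h₂⟩, h₃⟩, h₄⟩, h₅⟩, h₆⟩, h₇⟩, h₈⟩ := hc
  exact ⟨(hf.nreg 0 h₁).trans h.size, (hf.rreg 0 h₂).trans h.fst, (hf.rreg 1 h₃).trans h.snd,
    (hf.rreg 2 h₄).trans h.eps, (hf.rarr 0 h₅).trans h.a, (hf.rarr 1 h₆).trans h.b,
    (hf.rarr 2 h₇).trans h.w, (hf.rarr 3 h₈).trans h.tape⟩

theorem frame_effect {f : ℝ × ℝ → ℝ} {f' : ℝ × ℝ → ℝ × ℝ} {c : Prog} (hc : c.loopFree)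
    (s : State) : Frame c s (c.effect f f' s) := by
  obtain ⟨t, -, he⟩ := exec_effect (f := f) (f' := f') hc s
  exact he.frame

/-- The array `A` contains the ranking `L`. -/
def Holds (A : ℕ → ℕ) (L : Equiv.Perm (Fin n)) : Prop := ∀ j : Fin n, A j = L j

theorem Holds.congr {A B : ℕ → ℕ} {L : Equiv.Perm (Fin n)} (h : Holds A L)
    (hB : ∀ k < n, B k = A k) : Holds B L := fun j => (hB j j.2).trans (h j)

theorem toArray_val (v : Fin n → ℝ) (j : Fin n) : toArray v j = v j := by
  simp [toArray]

/-- Sort the ranking in array `src` by the scores in the direction given by real register `5`. -/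
def sortBy (src dst : ℕ) : Prog :=
  .seq (forLoop (.putR 4 (.reg 1) (.add
      (.mul (.sub (.ofNat (.const 1)) (.reg 5)) (.get 0 (.get src (.reg 1))))
      (.mul (.reg 5) (.get 1 (.get src (.reg 1)))))))
    (.seq sortIndices (forLoop (.putN dst (.reg 1) (.get src (.get 2 (.reg 1))))))

/-- An array that sorts the positions of a ranking sorts it stably. -/
theorem eq_sort_of_before {κ : ℕ → ℝ} {key : Fin n → ℝ} {L : Equiv.Perm (Fin n)} {Z : ℕ → ℕ}
    (hκ : ∀ p : Fin n, κ p = key (L p)) (hZ : ∀ k < n, Z k < n)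
    (hs : ∀ k k', k < k' → k' < n → Before κ (Z k) (Z k')) (j : Fin n) :
    Z j = (Tuple.sort (fun p => -key (L p)) j : ℕ) := by
  let ζ : Fin n → Fin n := fun j => ⟨Z j, hZ j j.2⟩
  have hb : ∀ i j : Fin n, i < j → Before κ (ζ i) (ζ j) := fun i j hij => hs i j hij j.2
  have hinj : Function.Injective ζ := by
    intro i j hij
    by_contra hne
    rcases lt_or_gt_of_ne hne with h | h
    · have := hb i j h
      rw [hij] at this
      rcases this with h | ⟨-, h⟩ <;> exact lt_irrefl _ h
    · have := hb j i h
      rw [hij] at this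
      rcases this with h | ⟨-, h⟩ <;> exact lt_irrefl _ h
  let ξ : Equiv.Perm (Fin n) := Equiv.ofBijective ζ (Finite.injective_iff_bijective.1 hinj)
  have hξ : ξ = Tuple.sort fun p => -key (L p) := by
    refine Tuple.eq_sort_iff.2 ⟨fun i j hij => ?_, fun i j hij he => ?_⟩
    · rcases hij.lt_or_eq with h | rfl
      · have := hb i j h
        simp only [Before, hκ] at this
        exact neg_le_neg (this.elim le_of_lt fun h => h.1.ge)
      · exact le_rfl
    · have := hb i j hij
      simp only [Before, hκ] at this
      have he' : key (L (ζ i)) = key (L (ζ j)) := neg_injective he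
      rcases this with h | h
      · exact absurd he' h.ne'
      · exact h.2
  rw [← hξ]
  rfl

/-- Real array `4` receives the keys along the ranking and array `2` the sorted positions; the
target is their composition with the ranking. Arrays `2` and `3` are the work space of the merge
sort. -/
theorem halts_sortBy {src dst : ℕ} (hne : src ≠ dst) (h2 : src ≠ 2) (h3 : src ≠ 3)
    (h2' : dst ≠ 2) {t : ℝ} {L : Equiv.Perm (Fin n)} (hin : HasInput I P ε ω s)
    (ht : s.rreg 5 = t) (hL : Holds (s.narr src) L) :
    Halts I.f I.gradient (sortBy src dst) s (27 * (n + 1) * (Nat.clog 2 n + 1)) (fun s' =>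
      Holds (s'.narr dst) (resort (I.key t) L) ∧ Frame (sortBy src dst) s s') := by
  apply Halts.frame
  refine ((Halts.forLoop rfl (by simp [Prog.wn]) (by simp [Prog.wn]) (fun k s' =>
      (s'.rreg 5 = t ∧ s'.rarr 0 = toArray I.a ∧ s'.rarr 1 = toArray I.b ∧
        Holds (s'.narr src) L) ∧ ∀ m : Fin n, m < k → s'.rarr 4 m = I.key t (L m)) hin.size
      ⟨⟨ht, hin.a, hin.b, hL⟩, fun m hm => absurd hm (Nat.not_lt_zero _)⟩ ?_).seq
      (T₂ := 21 * (n + 1) * (Nat.clog 2 n + 1) + (n * 3 + 2))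
      (Q := fun s' => Holds (s'.narr dst) (resort (I.key t) L)) ?_).mono ?_ fun _ h => h
  · rintro k hk s₁ h0 h1 ⟨⟨k₁, k₂, k₃, k₄⟩, k₅⟩
    refine ⟨⟨k₁, by simpa [Prog.effect, State.setCounter] using k₂,
      by simpa [Prog.effect, State.setCounter] using k₃, k₄⟩, fun m hm => ?_⟩
    by_cases e : (m : ℕ) = k
    · have e' := k₄ m
      rw [e] at e'
      simp [Prog.effect, State.setCounter, NExpr.eval, RExpr.eval, h1, e, e', k₁, k₂, k₃,
        toArray_val, RankInstance.key]
    · simpa [Prog.effect, State.setCounter, NExpr.eval, h1, e] using k₅ m (by omega)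
  · rintro s₁ ⟨⟨⟨-, -, -, k₄⟩, k₅⟩, hf₁⟩
    refine (halts_sortIndices ((hf₁.nreg 0 (by simp [forLoop, Prog.wn])).trans hin.size)
      rfl).seq ?_
    rintro s₂ ⟨⟨hZ, hs⟩, hf₂⟩
    have hsrc : s₂.narr src = s₁.narr src := hf₂.narr src (by
      simp [sortIndices, mergePass, forLoop, copyArray, Prog.wna, mergeTake, mergeReset, h2, h3])
    have k₀ := (hf₂.nreg 0 (by decide)).trans
      ((hf₁.nreg 0 (by simp [forLoop, Prog.wn])).trans hin.size)
    refine (Halts.forLoop rfl (by simp [Prog.wn]) (by simp [Prog.wn]) (fun k s' =>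
      (s'.narr src = s₁.narr src ∧ s'.narr 2 = s₂.narr 2) ∧
        ∀ m : Fin n, m < k → s'.narr dst m = resort (I.key t) L m) k₀
      ⟨⟨hsrc, rfl⟩, fun m hm => absurd hm (Nat.not_lt_zero _)⟩ ?_).mono le_rfl
      fun s' h j => h.1.2 j j.2
    rintro k hk s₃ h0 h1 ⟨⟨m₁, m₂⟩, m₃⟩
    refine ⟨⟨by simpa [Prog.effect, State.setCounter, hne] using m₁,
      by simpa [Prog.effect, State.setCounter, h2'.symm] using m₂⟩, fun m hm => ?_⟩
    by_cases e : (m : ℕ) = k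
    · have e' := eq_sort_of_before (fun p => k₅ p p.2) hZ hs m
      rw [e] at e'
      simp [Prog.effect, State.setCounter, NExpr.eval, h1, e, m₁, m₂, e', resort,
        k₄ (Tuple.sort (fun p => -I.key t (L p)) m)]
    · simpa [Prog.effect, State.setCounter, NExpr.eval, h1, e] using m₃ m (by omega)
  · simp only [Prog.size]
    nlinarith

/-- Add up the scores of the ranking in array `A`. -/
def scoreOf (A x y : ℕ) : Prog :=
  .seq (.seq (.setR x (.ofNat (.const 0))) (.setR y (.ofNat (.const 0))))
    (forLoop (.seq
      (.setR x (.add (.reg x) (.mul (.get 2 (.reg 1)) (.get 0 (.get A (.reg 1))))))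
      (.setR y (.add (.reg y) (.mul (.get 2 (.reg 1)) (.get 1 (.get A (.reg 1))))))))

theorem sum_toArray {A : ℕ → ℕ} {L : Equiv.Perm (Fin n)} (hA : Holds A L) (w v : Fin n → ℝ) :
    ∑ k ∈ Finset.range n, toArray w k * toArray v (A k) = cs w v L := by
  rw [Finset.sum_range]
  exact Finset.sum_congr rfl fun j _ => by rw [hA j, toArray_val, toArray_val]

theorem halts_scoreOf {A x y : ℕ} (hxy : x ≠ y) {L : Equiv.Perm (Fin n)}
    (hin : HasInput I P ε ω s) (hL : Holds (s.narr A) L) :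
    Halts I.f I.gradient (scoreOf A x y) s (4 * (n + 1)) (fun s' =>
      (s'.rreg x, s'.rreg y) = I.score L ∧ Frame (scoreOf A x y) s s') := by
  apply Halts.frame
  refine ((Halts.of_effect (c := .seq (.setR x (.ofNat (.const 0))) (.setR y (.ofNat (.const 0))))
    rfl (Q := fun s' => s'.nreg = s.nreg ∧ s'.narr = s.narr ∧ s'.rarr = s.rarr ∧
      s'.rreg x = 0 ∧ s'.rreg y = 0) (by simp [Prog.effect, RExpr.eval, NExpr.eval, hxy])).seq
    (T₂ := n * 4 + 2) (Q := fun s' => (s'.rreg x, s'.rreg y) = I.score L) ?_).mono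
    (by simp only [Prog.size]; omega) fun _ h => h
  rintro s₁ ⟨e₁, e₂, e₃, e₄, e₅⟩
  refine (Halts.forLoop rfl (by simp [Prog.wn]) (by simp [Prog.wn]) (fun k s' =>
      (s'.rarr = s.rarr ∧ s'.narr = s.narr) ∧
        s'.rreg x = ∑ m ∈ Finset.range k, toArray I.w m * toArray I.a (s.narr A m) ∧
        s'.rreg y = ∑ m ∈ Finset.range k, toArray I.w m * toArray I.b (s.narr A m))
      (by rw [e₁]; exact hin.size) ⟨⟨e₃, e₂⟩, by simpa [State.setCounter] using e₄,
        by simpa [State.setCounter] using e₅⟩ ?_).mono le_rfl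
      fun s' h => ?_
  · rintro k hk s₂ h0 h1 ⟨⟨m₁, m₂⟩, m₃, m₄⟩
    refine ⟨⟨m₁, m₂⟩, ?_, ?_⟩
    · simp [Prog.effect, State.setCounter, NExpr.eval, RExpr.eval, h1, m₁, m₂, hin.w, hin.a, hxy,
        Finset.sum_range_succ, m₃]
    · simp [Prog.effect, State.setCounter, NExpr.eval, RExpr.eval, h1, m₁, m₂, hin.w, hin.b,
        hxy.symm, Finset.sum_range_succ, m₄]
  · obtain ⟨⟨-, h₁, h₂⟩, -⟩ := h
    rw [h₁, h₂, sum_toArray hL, sum_toArray hL]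
    rfl

/-- The memory contains the stage `c` of the search. -/
structure HasConf (c : Conf n) (s : State) : Prop where
  lo : s.rreg 3 = c.lo
  hi : s.rreg 4 = c.hi
  left : Holds (s.narr 0) c.L
  right : Holds (s.narr 1) c.H
  fin : s.nreg 7 = if c.fin = true then 1 else 0

/-- Compare the optimal direction with the one given by real register `5`. -/
def queryProg : Prog :=
  .seq (sortBy 0 4) (.seq (scoreOf 4 6 7) (.seq (.callGrad 10 11 (.reg 6) (.reg 7))
    (.ite (.rle (.mul (.sub (.ofNat (.const 1)) (.reg 5)) (.add (.reg 1) (.reg 11)))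
        (.mul (.reg 5) (.add (.reg 0) (.reg 10))))
      (.seq (.setR 4 (.reg 5)) (copyArray 4 1))
      (.seq (sortBy 1 5) (.seq (scoreOf 5 6 7) (.seq (.callGrad 10 11 (.reg 6) (.reg 7))
        (.ite (.rle (.mul (.reg 5) (.add (.reg 0) (.reg 10)))
            (.mul (.sub (.ofNat (.const 1)) (.reg 5)) (.add (.reg 1) (.reg 11))))
          (.seq (.setR 3 (.reg 5)) (copyArray 5 0))
          (.seq (.setN 7 (.const 1)) (.seq (copyArray 4 0) (copyArray 5 1))))))))))

theorem HasConf.frame {p : Prog} {c : Conf n} (h : HasConf c s) (hf : Frame p s s')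
    (h₁ : 3 ∉ p.wr) (h₂ : 4 ∉ p.wr) (h₃ : 0 ∉ p.wna) (h₄ : 1 ∉ p.wna) (h₅ : 7 ∉ p.wn) :
    HasConf c s' :=
  ⟨(hf.rreg 3 h₁).trans h.lo, (hf.rreg 4 h₂).trans h.hi, by rw [hf.narr 0 h₃]; exact h.left,
    by rw [hf.narr 1 h₄]; exact h.right, (hf.nreg 7 h₅).trans h.fin⟩

/-- The first sorted ranking stays in array `4` while the second is prepared in array `5`, because
the case that ends the search stores both. -/
theorem halts_queryProg {c : Conf n} {t : ℝ} (hin : HasInput I P ε ω s) (hc : HasConf c s)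
    (ht : s.rreg 5 = t) :
    Halts I.f I.gradient queryProg s (80 * (n + 1) * (Nat.clog 2 n + 1)) (fun s' =>
      HasConf (I.query P c t) s' ∧ Frame queryProg s s') := by
  apply Halts.frame
  obtain ⟨T, hT⟩ : ∃ T, T = 27 * (n + 1) * (Nat.clog 2 n + 1) := ⟨_, rfl⟩
  refine ((halts_sortBy (by decide) (by decide) (by decide) (by decide) hin ht hc.left).seq
    (T₂ := 4 * (n + 1) + (1 + ((T + (4 * (n + 1) + (1 + (1 + (n * 3 + 2 + (n * 3 + 2)) + 1)))) + 1)))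
    (Q := fun s' => HasConf (I.query P c t) s') ?_).mono (by
      have : n + 1 ≤ (n + 1) * (Nat.clog 2 n + 1) := Nat.le_mul_of_pos_right _ (by omega)
      rw [hT, mul_assoc, mul_assoc]
      omega) fun _ h => h
  rintro s₁ ⟨hM, hf₁⟩
  have hin₁ := hin.frame hf₁ (by decide)
  have hc₁ := hc.frame hf₁ (by decide) (by decide) (by decide) (by decide) (by decide)
  have ht₁ := (hf₁.rreg 5 (by decide)).trans ht
  refine (halts_scoreOf (x := 6) (y := 7) (by decide) hin₁ hM).seq ?_
  rintro s₂ ⟨hg, hf₂⟩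
  have hin₂ := hin₁.frame hf₂ (by decide)
  have hc₂ := hc₁.frame hf₂ (by decide) (by decide) (by decide) (by decide) (by decide)
  have ht₂ := (hf₂.rreg 5 (by decide)).trans ht₁
  have hM₂ : Holds (s₂.narr 4) (resort (I.key t) c.L) := by
    rw [hf₂.narr 4 (by decide)]; exact hM
  refine (Halts.of_effect (c := .callGrad 10 11 (.reg 6) (.reg 7)) rfl (Q := fun s' =>
    ((s'.rreg 10, s'.rreg 11) = I.gradient (I.score (resort (I.key t) c.L))) ∧
      Frame (.callGrad 10 11 (.reg 6) (.reg 7)) s₂ s')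
      ⟨by simp [Prog.effect, RExpr.eval, hg], frame_effect rfl _⟩).seq ?_
  rintro s₃ ⟨hd, hf₃⟩
  have hin₃ := hin₂.frame hf₃ (by decide)
  have hc₃ := hc₂.frame hf₃ (by decide) (by decide) (by decide) (by decide) (by decide)
  have ht₃ := (hf₃.rreg 5 (by decide)).trans ht₂
  have hM₃ : Holds (s₃.narr 4) (resort (I.key t) c.L) := by
    rw [hf₃.narr 4 (by decide)]; exact hM₂
  have hd₁ : s₃.rreg 10 = (I.gradient (I.score (resort (I.key t) c.L))).1 := congrArg Prod.fst hd
  have hd₂ : s₃.rreg 11 = (I.gradient (I.score (resort (I.key t) c.L))).2 := congrArg Prod.snd hd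
  have htest : (Test.rle (.mul (.sub (.ofNat (.const 1)) (.reg 5)) (.add (.reg 1) (.reg 11)))
      (.mul (.reg 5) (.add (.reg 0) (.reg 10)))).holds s₃ ↔
      I.BelowDir P t (I.score (resort (I.key t) c.L)) := by
    simp [Test.holds, RExpr.eval, NExpr.eval, hin₃.fst, hin₃.snd, ht₃, hd₁, hd₂,
      RankInstance.BelowDir, RankInstance.direction]
  refine Halts.ite (fun hb => ?_) fun hb => ?_
  · have e : I.query P c t = { c with hi := t, H := resort (I.key t) c.L } :=
      if_pos (htest.1 hb)
    rw [e]
    refine ((Halts.of_effect (c := .setR 4 (.reg 5)) rfl (Q := fun s' =>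
      s' = Prog.effect I.f I.gradient (.setR 4 (.reg 5)) s₃) rfl).seq
      (T₂ := n * 3 + 2) ?_).mono (by simp only [Prog.size]; omega) fun _ h => h
    rintro s₄ rfl
    refine (halts_copyArray (A := 4) (B := 1) (by decide)
      (s := Prog.effect I.f I.gradient (.setR 4 (.reg 5)) s₃) hin₃.size).mono le_rfl ?_
    rintro s₅ ⟨hcopy, hf₅⟩
    refine ⟨?_, ?_, ?_, hM₃.congr hcopy, ?_⟩
    · rw [hf₅.rreg 3 (by decide)]; simpa [Prog.effect] using hc₃.lo
    · rw [hf₅.rreg 4 (by decide)]; simpa [Prog.effect, RExpr.eval] using ht₃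
    · rw [hf₅.narr 0 (by decide)]; exact hc₃.left
    · rw [hf₅.nreg 7 (by decide)]; exact hc₃.fin
  have hb' := fun h => hb (htest.2 h)
  refine ((halts_sortBy (by decide) (by decide) (by decide) (by decide) hin₃ ht₃
    hc₃.right).seq (T₂ := 4 * (n + 1) + (1 + (1 + (n * 3 + 2 + (n * 3 + 2)) + 1))) ?_).mono
    (by rw [hT]) fun _ h => h
  rintro s₄ ⟨hM', hf₄⟩
  have hin₄ := hin₃.frame hf₄ (by decide)
  have hc₄ := hc₃.frame hf₄ (by decide) (by decide) (by decide) (by decide) (by decide)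
  have ht₄ := (hf₄.rreg 5 (by decide)).trans ht₃
  have hM₄ : Holds (s₄.narr 4) (resort (I.key t) c.L) := by
    rw [hf₄.narr 4 (by decide)]; exact hM₃
  refine (halts_scoreOf (x := 6) (y := 7) (by decide) hin₄ hM').seq ?_
  rintro s₅ ⟨hg', hf₅⟩
  have hin₅ := hin₄.frame hf₅ (by decide)
  have hc₅ := hc₄.frame hf₅ (by decide) (by decide) (by decide) (by decide) (by decide)
  have ht₅ := (hf₅.rreg 5 (by decide)).trans ht₄
  have hM₅ : Holds (s₅.narr 4) (resort (I.key t) c.L) := by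
    rw [hf₅.narr 4 (by decide)]; exact hM₄
  have hM₅' : Holds (s₅.narr 5) (resort (I.key t) c.H) := by
    rw [hf₅.narr 5 (by decide)]; exact hM'
  refine (Halts.of_effect (c := .callGrad 10 11 (.reg 6) (.reg 7)) rfl (Q := fun s' =>
    ((s'.rreg 10, s'.rreg 11) = I.gradient (I.score (resort (I.key t) c.H))) ∧
      Frame (.callGrad 10 11 (.reg 6) (.reg 7)) s₅ s')
      ⟨by simp [Prog.effect, RExpr.eval, hg'], frame_effect rfl _⟩).seq ?_
  rintro s₆ ⟨hd', hf₆⟩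
  have hin₆ := hin₅.frame hf₆ (by decide)
  have hc₆ := hc₅.frame hf₆ (by decide) (by decide) (by decide) (by decide) (by decide)
  have ht₆ := (hf₆.rreg 5 (by decide)).trans ht₅
  have hM₆ : Holds (s₆.narr 4) (resort (I.key t) c.L) := by
    rw [hf₆.narr 4 (by decide)]; exact hM₅
  have hM₆' : Holds (s₆.narr 5) (resort (I.key t) c.H) := by
    rw [hf₆.narr 5 (by decide)]; exact hM₅'
  have hd₁' : s₆.rreg 10 = (I.gradient (I.score (resort (I.key t) c.H))).1 :=
    congrArg Prod.fst hd'
  have hd₂' : s₆.rreg 11 = (I.gradient (I.score (resort (I.key t) c.H))).2 :=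
    congrArg Prod.snd hd'
  have htest' : (Test.rle (.mul (.reg 5) (.add (.reg 0) (.reg 10)))
      (.mul (.sub (.ofNat (.const 1)) (.reg 5)) (.add (.reg 1) (.reg 11)))).holds s₆ ↔
      I.AboveDir P t (I.score (resort (I.key t) c.H)) := by
    simp [Test.holds, RExpr.eval, NExpr.eval, hin₆.fst, hin₆.snd, ht₆, hd₁', hd₂',
      RankInstance.AboveDir, RankInstance.direction]
  refine Halts.ite (fun ha => ?_) fun ha => ?_
  · have e : I.query P c t = { c with lo := t, L := resort (I.key t) c.H } :=
      (if_neg hb').trans (if_pos (htest'.1 ha))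
    rw [e]
    refine ((Halts.of_effect (c := .setR 3 (.reg 5)) rfl (Q := fun s' =>
      s' = Prog.effect I.f I.gradient (.setR 3 (.reg 5)) s₆) rfl).seq
      (T₂ := n * 3 + 2) ?_).mono (by simp only [Prog.size]; omega) fun _ h => h
    rintro s₇ rfl
    refine (halts_copyArray (A := 5) (B := 0) (by decide)
      (s := Prog.effect I.f I.gradient (.setR 3 (.reg 5)) s₆) hin₆.size).mono le_rfl ?_
    rintro s₈ ⟨hcopy, hf₈⟩
    refine ⟨?_, ?_, hM₆'.congr hcopy, ?_, ?_⟩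
    · rw [hf₈.rreg 3 (by decide)]; simpa [Prog.effect, RExpr.eval] using ht₆
    · rw [hf₈.rreg 4 (by decide)]; simpa [Prog.effect] using hc₆.hi
    · rw [hf₈.narr 1 (by decide)]; exact hc₆.right
    · rw [hf₈.nreg 7 (by decide)]; exact hc₆.fin
  · have e : I.query P c t =
        { c with L := resort (I.key t) c.L, H := resort (I.key t) c.H, fin := true } :=
      (if_neg hb').trans (if_neg fun h => ha (htest'.2 h))
    rw [e]
    refine (Halts.of_effect (c := .setN 7 (.const 1)) rfl (Q := fun s' =>
      s' = Prog.effect I.f I.gradient (.setN 7 (.const 1)) s₆) rfl).seq ?_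
    rintro s₇ rfl
    refine (halts_copyArray (by decide) (s := Prog.effect I.f I.gradient (.setN 7 (.const 1)) s₆)
      (by simpa [Prog.effect] using hin₆.size)).seq ?_
    rintro s₈ ⟨hcopy, hf₈⟩
    refine (halts_copyArray (by decide) ((hf₈.nreg 0 (by decide)).trans
      (by simpa [Prog.effect] using hin₆.size))).mono le_rfl ?_
    rintro s₉ ⟨hcopy', hf₉⟩
    refine ⟨?_, ?_, ?_, ?_, ?_⟩
    · rw [hf₉.rreg 3 (by decide), hf₈.rreg 3 (by decide)]; exact hc₆.lo
    · rw [hf₉.rreg 4 (by decide), hf₈.rreg 4 (by decide)]; exact hc₆.hi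
    · rw [hf₉.narr 0 (by decide)]; exact hM₆.congr hcopy
    · rw [hf₈.narr 5 (by decide)] at hcopy'; exact hM₆'.congr hcopy'
    · rw [hf₉.nreg 7 (by decide), hf₈.nreg 7 (by decide)]; simp [Prog.effect, NExpr.eval]

end RealRAM

/-! ## The program: the search -/

namespace RealRAM

variable {n : ℕ} {I : RankInstance n} {P : ℝ × ℝ} {ε : ℝ} {ω : ℕ → ℝ} {s s' : State}

/-- Number of positions by which the result at position `k` of array `0` stands lower in the
inverse array `6`. -/
def excessExpr : NExpr := .sub (.get 6 (.get 0 (.reg 1))) (.reg 1)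

/-- Compute positions in array `1`, and the total excess. -/
def excessProg : Prog :=
  .seq (forLoop (.putN 6 (.get 1 (.reg 1)) (.reg 1)))
    (.seq (.setN 8 (.const 0)) (forLoop (.setN 8 (.add (.reg 8) excessExpr))))

/-- The memory contains the positions of all results in the ranking `H`, and the total excess. -/
structure HasExcess (c : Conf n) (s : State) : Prop where
  table : Holds (s.narr 6) c.H.symm
  total : s.nreg 8 = RankInstance.excess c

theorem HasConf.relPos_eq {c : Conf n} (hc : HasConf c s) (ht : Holds (s.narr 6) c.H.symm)
    {p : ℕ} (hp : p < n) : s.narr 6 (s.narr 0 p) = RankInstance.relPos c p := by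
  have h₁ : s.narr 0 p = c.L ⟨p, hp⟩ := hc.left ⟨p, hp⟩
  rw [RankInstance.relPos, dif_pos hp, h₁, ht]

/-- Running through `H` once tabulates its inverse, after which relative positions and their
excesses take linear time. -/
theorem halts_excessProg {c : Conf n} (hin : HasInput I P ε ω s) (hc : HasConf c s) :
    Halts I.f I.gradient excessProg s (6 * (n + 1)) (fun s' =>
      HasExcess c s' ∧ Frame excessProg s s') := by
  apply Halts.frame
  refine ((Halts.forLoop rfl (by decide) (by decide) (fun k s' =>
      s'.narr 1 = s.narr 1 ∧ ∀ x : Fin n, (c.H.symm x : ℕ) < k → s'.narr 6 x = c.H.symm x)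
      hin.size ⟨rfl, fun m hm => absurd hm (Nat.not_lt_zero _)⟩ ?_).seq
      (T₂ := 1 + (n * 3 + 2)) (Q := HasExcess c) ?_).mono
      (by simp only [Prog.size]; omega) fun _ h => h
  · rintro k hk s₁ h0 h1 ⟨k₁, k₂⟩
    refine ⟨by simpa [Prog.effect, State.setCounter] using k₁, fun x hx => ?_⟩
    have e : s₁.narr 1 k = c.H ⟨k, hk⟩ := by rw [k₁]; exact hc.right ⟨k, hk⟩
    by_cases hxk : x = c.H ⟨k, hk⟩
    · simp [Prog.effect, State.setCounter, NExpr.eval, h1, e, hxk]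
    · have hne : (x : ℕ) ≠ c.H ⟨k, hk⟩ := fun h => hxk (Fin.ext h)
      have hne' : (c.H.symm x : ℕ) ≠ k := fun h => hxk (by
        rw [← Equiv.symm_apply_eq]; exact Fin.ext h)
      simpa [Prog.effect, State.setCounter, NExpr.eval, h1, e, hne] using k₂ x (by omega)
  · rintro s₁ ⟨⟨k₁, k₂⟩, hf₁⟩
    have hin₁ := hin.frame hf₁ (by decide)
    have hc₁ := hc.frame hf₁ (by decide) (by decide) (by decide) (by decide) (by decide)
    have htab : Holds (s₁.narr 6) c.H.symm := fun x => k₂ x (Fin.is_lt _)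
    refine (Halts.of_effect (c := .setN 8 (.const 0)) rfl (Q := fun s' => s'.nreg 0 = n ∧
      s'.narr = s₁.narr ∧ s'.nreg 8 = 0)
      ⟨by simpa [Prog.effect] using hin₁.size, rfl, by simp [Prog.effect, NExpr.eval]⟩).seq ?_
    rintro s₂ ⟨e₀, e₁, e₂⟩
    refine (Halts.forLoop rfl (by decide) (by decide) (fun k s' => s'.narr = s₁.narr ∧
      s'.nreg 8 = ∑ p ∈ Finset.range k, (RankInstance.relPos c p - p)) e₀
      ⟨e₁, by simpa [State.setCounter] using e₂⟩ ?_).mono le_rfl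
      fun s' h => ⟨by rw [h.1.1]; exact htab, h.1.2⟩
    rintro k hk s₃ h0 h1 ⟨m₁, m₂⟩
    refine ⟨m₁, ?_⟩
    simp [Prog.effect, State.setCounter, NExpr.eval, excessExpr, h1, m₁, m₂,
      Finset.sum_range_succ, hc₁.relPos_eq htab hk]

/-- Record a possible first entry of an inversion. -/
def leftTake : Prog :=
  .ite (.and (.nle (.const 1) excessExpr) (.rle (.ofNat (.const 0)) (.reg 18)))
    (.seq (.setN 10 (.reg 1)) (.setR 19 (.reg 18))) .skip

/-- Find the first entry of an inversion. -/
def leftStep : Prog :=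
  .seq leftTake (.setR 18 (.sub (.reg 18) (.ofNat excessExpr)))

/-- Record a possible second entry of an inversion. -/
def rightTake : Prog :=
  .ite (.rle (.ofNat (.const 0)) (.reg 19)) (.setN 11 (.reg 1)) .skip

/-- Find the second entry of an inversion. -/
def rightStep : Prog :=
  .ite (.and (.neg (.nle (.reg 1) (.reg 10)))
      (.neg (.nle (.get 6 (.get 0 (.reg 10))) (.get 6 (.get 0 (.reg 1))))))
    (.seq rightTake (.setR 19 (.sub (.reg 19) (.ofNat (.const 1)))))
    .skip

/-- Difference of the entries of real array `A` for the two results of an inversion. -/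
def gapExpr (A : ℕ) : RExpr :=
  .sub (.get A (.get 0 (.reg 10))) (.get A (.get 0 (.reg 11)))

/-- Draw an inversion, and compute the direction in which its results have equal scores. -/
def pivotProg : Prog :=
  .seq (.seq (.seq (.setR 18 (.mul (.get 3 (.reg 9)) (.ofNat (.reg 8)))) (.setR 19 (.reg 18)))
      (.seq (.setN 10 (.const 0)) (.setN 11 (.const 0))))
    (.seq (forLoop leftStep) (.seq (forLoop rightStep)
      (.setR 5 (.div (gapExpr 0) (.sub (gapExpr 0) (gapExpr 1))))))

/-- Two linear scans realise `pickLeft` and `pickRight`. Real register `18` holds `v` minus the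
excesses seen so far, and register `19` keeps this remainder at the latest candidate, for use in the
second scan. -/
theorem halts_pivotProg {c : Conf n} (hin : HasInput I P ε ω s) (hc : HasConf c s)
    (he : HasExcess c s) (hpos : 0 < RankInstance.excess c) {k : ℕ} (hk : s.nreg 9 = k)
    (hω : 0 ≤ ω k) :
    Halts I.f I.gradient pivotProg s (18 * (n + 1)) (fun s' =>
      s'.rreg 5 = I.pivot c ⌊ω k * RankInstance.excess c⌋₊ ∧ Frame pivotProg s s') := by
  apply Halts.frame
  set v := ω k * RankInstance.excess c with hv
  have hv0 : 0 ≤ v := mul_nonneg hω (Nat.cast_nonneg _)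
  set π := RankInstance.relPos c with hπ
  obtain ⟨hi, -, hi'⟩ := pickLeft_spec (π := π) hpos ⌊v⌋₊
  set i := pickLeft π n ⌊v⌋₊ with hi_def
  refine ((Halts.of_effect (c := .seq (.seq (.setR 18 (.mul (.get 3 (.reg 9)) (.ofNat (.reg 8))))
      (.setR 19 (.reg 18))) (.seq (.setN 10 (.const 0)) (.setN 11 (.const 0)))) rfl
      (Q := fun s' => s'.nreg 0 = n ∧ s'.narr = s.narr ∧ s'.rarr = s.rarr ∧ s'.nreg 10 = 0 ∧
        s'.nreg 11 = 0 ∧ s'.rreg 18 = v ∧ s'.rreg 19 = v) (by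
      simp [Prog.effect, NExpr.eval, RExpr.eval, hin.size, hin.tape, hk, he.total, hv])).seq
    (T₂ := n * (leftStep.size + 2) + 2 + (n * (rightStep.size + 2) + 2 + 1))
    (Q := fun s' => s'.rreg 5 = I.pivot c ⌊v⌋₊) ?_).mono
    (by simp only [Prog.size, leftStep, rightStep, leftTake, rightTake]; omega) fun _ h => h
  rintro s₁ ⟨a₀, a₁, a₂, a₃, a₄, a₅, a₆⟩
  refine (Halts.forLoop (c := leftStep) rfl (by decide) (by decide) (fun m s' =>
    (s'.narr = s.narr ∧ s'.rarr = s.rarr ∧ s'.nreg 11 = 0) ∧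
    s'.rreg 18 = v - ((∑ q ∈ Finset.range m, (π q - q) : ℕ) : ℝ) ∧
    s'.nreg 10 = lastSat (fun p => 0 < π p - p ∧ ∑ q ∈ Finset.range p, (π q - q) ≤ ⌊v⌋₊) m ∧
    s'.rreg 19 = v - ((∑ q ∈ Finset.range (s'.nreg 10), (π q - q) : ℕ) : ℝ)) a₀
    ⟨⟨a₁, a₂, a₄⟩, by simpa [State.setCounter] using a₅, a₃, by simp [State.setCounter, a₃, a₆]⟩ ?_).seq ?_
  · rintro m hm s₂ h0 h1 ⟨⟨b₁, b₂, b₃⟩, b₄, b₅, b₆⟩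
    have hx : excessExpr.eval s₂ = π m - m := by
      simp [excessExpr, NExpr.eval, h1, b₁, hc.relPos_eq he.table hm, hπ]
    -- The machine cannot round, but a natural number is at most `⌊v⌋₊` exactly if it is at most
    -- `v`, so the sign of the real remainder decides.
    have hiff : (Test.and (.nle (.const 1) excessExpr) (.rle (.ofNat (.const 0)) (.reg 18))).holds
        s₂ ↔ 0 < π m - m ∧ ∑ q ∈ Finset.range m, (π q - q) ≤ ⌊v⌋₊ := by
      simp only [Test.holds, RExpr.eval, hx, b₄, NExpr.eval, Nat.cast_zero, sub_nonneg,
        Nat.le_floor_iff hv0]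
      rfl
    have hs : ∑ q ∈ Finset.range (m + 1), (π q - q) =
      ∑ q ∈ Finset.range m, (π q - q) + (π m - m) := Finset.sum_range_succ _ _
    by_cases hb : 0 < π m - m ∧ ∑ q ∈ Finset.range m, (π q - q) ≤ ⌊v⌋₊
    · have ht : leftTake.effect I.f I.gradient s₂ = { s₂ with
          nreg := Function.update s₂.nreg 10 m
          rreg := Function.update s₂.rreg 19 (v - ((∑ q ∈ Finset.range m, (π q - q) : ℕ) : ℝ)) } := by
        rw [leftTake, Prog.effect, if_pos (hiff.2 hb)]
        simp [Prog.effect, NExpr.eval, RExpr.eval, h1, b₄]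
      rw [lastSat, if_pos hb, leftStep, Prog.effect, ht, hs]
      have hx' : excessExpr.eval { s₂ with
          nreg := Function.update s₂.nreg 10 m
          rreg := Function.update s₂.rreg 19 (v - ((∑ q ∈ Finset.range m, (π q - q) : ℕ) : ℝ)) } =
          π m - m := by
        simp [excessExpr, NExpr.eval, h1, b₁, hc.relPos_eq he.table hm, hπ]
      simp only [Prog.effect, State.setCounter, RExpr.eval, hx']
      exact ⟨⟨b₁, b₂, by simpa using b₃⟩, by simp [b₄]; ring, by simp, by simp⟩
    · have ht : leftTake.effect I.f I.gradient s₂ = s₂ := by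
        rw [leftTake, Prog.effect, if_neg fun h => hb (hiff.1 h), Prog.effect]
      rw [lastSat, if_neg hb, leftStep, Prog.effect, ht, hs]
      simp only [Prog.effect, State.setCounter, RExpr.eval, hx]
      exact ⟨⟨b₁, b₂, by simpa using b₃⟩, by simp [b₄]; ring, by simpa using b₅,
        by simpa using b₆⟩
  rintro s₂ ⟨⟨⟨b₁, b₂, b₃⟩, -, b₅, b₆⟩, hf₂⟩
  have b₅' : s₂.nreg 10 = i := b₅
  rw [b₅'] at b₆
  refine (Halts.forLoop (c := rightStep) rfl (by decide) (by decide) (fun m s' =>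
    (s'.narr = s.narr ∧ s'.rarr = s.rarr ∧ s'.nreg 10 = i) ∧
    s'.rreg 19 = v - ((∑ q ∈ Finset.range i, (π q - q) : ℕ) : ℝ) -
      ((∑ q ∈ Finset.range m, partner π i q : ℕ) : ℝ) ∧
    s'.nreg 11 = lastSat (fun p => 0 < partner π i p ∧ ∑ q ∈ Finset.range p, partner π i q ≤
      ⌊v⌋₊ - ∑ q ∈ Finset.range i, (π q - q)) m) ((hf₂.nreg 0 (by decide)).trans a₀)
    ⟨⟨b₁, b₂, b₅'⟩, by simpa [State.setCounter] using b₆, b₃⟩ ?_).seq ?_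
  · rintro m hm s₃ h0 h1 ⟨⟨d₁, d₂, d₃⟩, d₄, d₅⟩
    have hiff : (Test.and (.neg (.nle (.reg 1) (.reg 10)))
        (.neg (.nle (.get 6 (.get 0 (.reg 10))) (.get 6 (.get 0 (.reg 1)))))).holds s₃ ↔
        i < m ∧ π m < π i := by
      simp [Test.holds, NExpr.eval, h1, d₁, d₃, hc.relPos_eq he.table hm,
        hc.relPos_eq he.table hi, hπ]
    -- The natural subtraction is not truncated, by `hi'`.
    have hiff' : (Test.rle (.ofNat (.const 0)) (.reg 19)).holds s₃ ↔
        ∑ q ∈ Finset.range m, partner π i q ≤ ⌊v⌋₊ - ∑ q ∈ Finset.range i, (π q - q) := by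
      rw [Nat.le_sub_iff_add_le hi', Nat.le_floor_iff hv0]
      simp only [Test.holds, RExpr.eval, NExpr.eval, Nat.cast_zero, d₄]
      rw [sub_sub, sub_nonneg, Nat.cast_add, add_comm]
    have hs : ∑ q ∈ Finset.range (m + 1), partner π i q =
      ∑ q ∈ Finset.range m, partner π i q + partner π i m := Finset.sum_range_succ _ _
    rw [lastSat, rightStep, Prog.effect, hs]
    by_cases hb : i < m ∧ π m < π i
    · have hp : partner π i m = 1 := if_pos hb
      rw [if_pos (hiff.2 hb), hp]
      by_cases hb' : ∑ q ∈ Finset.range m, partner π i q ≤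
          ⌊v⌋₊ - ∑ q ∈ Finset.range i, (π q - q)
      · have ht : rightTake.effect I.f I.gradient s₃ =
            { s₃ with nreg := Function.update s₃.nreg 11 m } := by
          rw [rightTake, Prog.effect, if_pos (hiff'.2 hb'), Prog.effect, NExpr.eval, h1]
        rw [if_pos ⟨one_pos, hb'⟩, Prog.effect, ht]
        simp only [Prog.effect, State.setCounter, NExpr.eval, RExpr.eval]
        exact ⟨⟨d₁, d₂, by simpa using d₃⟩, by simp [d₄]; ring, by simp⟩
      · have ht : rightTake.effect I.f I.gradient s₃ = s₃ := by
          rw [rightTake, Prog.effect, if_neg fun h => hb' (hiff'.1 h), Prog.effect]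
        rw [if_neg fun h => hb' h.2, Prog.effect, ht]
        simp only [Prog.effect, State.setCounter, NExpr.eval, RExpr.eval]
        exact ⟨⟨d₁, d₂, by simpa using d₃⟩, by simp [d₄]; ring, by simpa using d₅⟩
    · have hp : partner π i m = 0 := if_neg hb
      rw [if_neg fun h => hb (hiff.1 h), hp, if_neg fun h => lt_irrefl _ h.1]
      simp only [Prog.effect, State.setCounter]
      exact ⟨⟨d₁, d₂, by simpa using d₃⟩, by simpa using d₄, by simpa using d₅⟩
  rintro s₃ ⟨⟨⟨d₁, d₂, d₃⟩, -, d₅⟩, -⟩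
  have d₅' : s₃.nreg 11 = pickRight π n ⌊v⌋₊ := d₅
  obtain ⟨h₁, h₂⟩ := RankInstance.pick_lt hpos ⌊v⌋₊
  refine Halts.of_effect rfl ?_
  have eL : s.narr 0 i = c.L ⟨i, h₁⟩ := hc.left ⟨i, h₁⟩
  have eR : s.narr 0 (pickRight π n ⌊v⌋₊) = c.L ⟨_, h₂⟩ := hc.left ⟨_, h₂⟩
  rw [RankInstance.pivot, dif_pos ⟨h₁, h₂⟩]
  simp [Prog.effect, gapExpr, RExpr.eval, NExpr.eval, d₁, d₂, d₃, d₅', eL, eR, hin.a, hin.b,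
    toArray_val, RankInstance.crit, RankInstance.pivotPair]
  rfl

/-- One round of the search. -/
def roundProg : Prog :=
  .seq pivotProg (.seq queryProg (.seq
    (.ite (.nle (.reg 7) (.const 0))
      (.seq (.setR 5 (.div (.add (.reg 3) (.reg 4)) (.ofNat (.const 2)))) queryProg) .skip)
    (.seq excessProg (.setN 9 (.add (.reg 9) (.const 1))))))

/-- The excess is recomputed at the end of the round because both the loop test and the next pivot
use it. Register `9` counts the tape entries used. -/
theorem halts_roundProg {c : Conf n} (hin : HasInput I P ε ω s) (hc : HasConf c s)
    (he : HasExcess c s) (hdone : ¬ RankInstance.Done c) {k : ℕ} (hk : s.nreg 9 = k)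
    (hω : 0 ≤ ω k) :
    Halts I.f I.gradient roundProg s (200 * (n + 1) * (Nat.clog 2 n + 1)) (fun s' =>
      HasInput I P ε ω s' ∧ HasConf (I.advance P c ⌊ω k * RankInstance.excess c⌋₊) s' ∧
        HasExcess (I.advance P c ⌊ω k * RankInstance.excess c⌋₊) s' ∧ s'.nreg 9 = k + 1) := by
  have hpos := RankInstance.excess_pos hdone
  obtain ⟨t, ht⟩ : ∃ t, t = I.pivot c ⌊ω k * RankInstance.excess c⌋₊ := ⟨_, rfl⟩
  obtain ⟨T, hT⟩ : ∃ T, T = 80 * (n + 1) * (Nat.clog 2 n + 1) := ⟨_, rfl⟩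
  refine ((halts_pivotProg hin hc he hpos hk hω).seq
    (T₂ := T + ((1 + T) + 1 + (6 * (n + 1) + 1))) ?_).mono (by
      have : n + 1 ≤ (n + 1) * (Nat.clog 2 n + 1) := Nat.le_mul_of_pos_right _ (by omega)
      rw [hT, mul_assoc, mul_assoc]
      omega) fun _ h => h
  rintro s₁ ⟨ht₁, hf₁⟩
  rw [← ht] at ht₁
  have hin₁ := hin.frame hf₁ (by decide)
  have hc₁ := hc.frame hf₁ (by decide) (by decide) (by decide) (by decide) (by decide)
  have hk₁ := (hf₁.nreg 9 (by decide)).trans hk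
  refine ((halts_queryProg hin₁ hc₁ ht₁).mono hT.ge fun _ h => h).seq ?_
  rintro s₂ ⟨hc₂, hf₂⟩
  have hin₂ := hin₁.frame hf₂ (by decide)
  have hk₂ := (hf₂.nreg 9 (by decide)).trans hk₁
  refine Halts.seq (R := fun s' => HasInput I P ε ω s' ∧ s'.nreg 9 = k ∧
    HasConf (I.advance P c ⌊ω k * RankInstance.excess c⌋₊) s') (Halts.ite ?_ ?_) ?_
  · intro hb
    have hfin : ¬ (I.query P c t).fin = true := by
      intro h
      simp [Test.holds, NExpr.eval, hc₂.fin, h] at hb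
    refine (Halts.of_effect (c := .setR 5 (.div (.add (.reg 3) (.reg 4)) (.ofNat (.const 2)))) rfl
      (Q := fun s' => s'.rreg 5 = ((I.query P c t).lo + (I.query P c t).hi) / 2 ∧
        Frame (.setR 5 (.div (.add (.reg 3) (.reg 4)) (.ofNat (.const 2)))) s₂ s')
      ⟨by simp [Prog.effect, RExpr.eval, NExpr.eval, hc₂.lo, hc₂.hi], frame_effect rfl _⟩).seq ?_
    rintro s₃ ⟨ht₃, hf₃⟩
    have hin₃ := hin₂.frame hf₃ (by decide)
    have hc₃ := hc₂.frame hf₃ (by decide) (by decide) (by decide) (by decide) (by decide)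
    have hk₃ := (hf₃.nreg 9 (by decide)).trans hk₂
    refine (halts_queryProg hin₃ hc₃ ht₃).mono hT.ge ?_
    rintro s₄ ⟨hc₄, hf₄⟩
    refine ⟨hin₃.frame hf₄ (by decide), (hf₄.nreg 9 (by decide)).trans hk₃, ?_⟩
    rw [RankInstance.advance, if_neg hdone, ← ht, if_neg hfin]
    exact hc₄
  · intro hb
    have hfin : (I.query P c t).fin = true := by
      by_contra h
      simp [Test.holds, NExpr.eval, hc₂.fin, h] at hb
    refine ⟨s₂, 1, .skip _, by omega, hin₂, hk₂, ?_⟩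
    rw [RankInstance.advance, if_neg hdone, ← ht, if_pos hfin]
    exact hc₂
  · rintro s₃ ⟨hin₃, hk₃, hc₃⟩
    refine (halts_excessProg hin₃ hc₃).seq ?_
    rintro s₄ ⟨he₄, hf₄⟩
    have hin₄ := hin₃.frame hf₄ (by decide)
    have hc₄ := hc₃.frame hf₄ (by decide) (by decide) (by decide) (by decide) (by decide)
    have hk₄ := (hf₄.nreg 9 (by decide)).trans hk₃
    refine Halts.of_effect (c := .setN 9 (.add (.reg 9) (.const 1))) rfl ?_
    have hf₅ := frame_effect (f := I.f) (f' := I.gradient)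
      (c := .setN 9 (.add (.reg 9) (.const 1))) rfl s₄
    exact ⟨hin₄.frame hf₅ (by decide),
      hc₄.frame hf₅ (by decide) (by decide) (by decide) (by decide) (by decide),
      ⟨by rw [hf₅.narr 6 (by decide)]; exact he₄.table,
        (hf₅.nreg 8 (by decide)).trans he₄.total⟩, by simp [Prog.effect, NExpr.eval, hk₄]⟩

/-- Sort the results for the two extreme directions. -/
def initProg : Prog :=
  .seq (forLoop (.putN 0 (.reg 1) (.reg 1))) (.seq (.setR 5 (.ofNat (.const 1)))
    (.seq (sortBy 0 1) (.seq (.setR 5 (.ofNat (.const 0))) (.seq (sortBy 1 0)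
      (.seq (.setR 5 (.ofNat (.const 1))) (.seq (sortBy 0 1) (.seq
        (.seq (.seq (.setR 3 (.ofNat (.const 0))) (.setR 4 (.ofNat (.const 1))))
          (.seq (.setN 7 (.const 0)) (.setN 9 (.const 0))))
        excessProg)))))))

theorem halts_initProg (hin : HasInput I P ε ω s) :
    Halts I.f I.gradient initProg s (100 * (n + 1) * (Nat.clog 2 n + 1)) (fun s' =>
      HasInput I P ε ω s' ∧ HasConf I.initConf s' ∧ HasExcess I.initConf s' ∧
        s'.nreg 9 = 0) := by
  obtain ⟨T, hT⟩ : ∃ T, T = 27 * (n + 1) * (Nat.clog 2 n + 1) := ⟨_, rfl⟩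
  have hset : ∀ (s : State) (r : ℕ), HasInput I P ε ω s →
      Halts I.f I.gradient (.setR 5 (.ofNat (.const r))) s 1 fun s' =>
        HasInput I P ε ω s' ∧ s'.rreg 5 = r ∧ s'.narr = s.narr := by
    intro s r h
    refine Halts.of_effect (c := .setR 5 (.ofNat (.const r))) rfl ⟨?_, ?_, rfl⟩
    · exact h.frame (frame_effect rfl s) rfl
    · simp [Prog.effect, RExpr.eval, NExpr.eval]
  refine ((Halts.forLoop rfl (by decide) (by decide) (fun k s' => ∀ m < k, s'.narr 0 m = m)
    hin.size (fun m hm => absurd hm (Nat.not_lt_zero _)) ?_).seq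
    (T₂ := 1 + (T + (1 + (T + (1 + (T + (4 + 6 * (n + 1)))))))) ?_).mono (by
      have : n + 1 ≤ (n + 1) * (Nat.clog 2 n + 1) := Nat.le_mul_of_pos_right _ (by omega)
      simp only [Prog.size]
      rw [hT, mul_assoc, mul_assoc]
      omega) fun _ h => h
  · intro k hk s₁ h0 h1 hI m hm
    by_cases e : m = k
    · simp [Prog.effect, State.setCounter, NExpr.eval, h1, e]
    · simpa [Prog.effect, State.setCounter, NExpr.eval, h1, e] using hI m (by omega)
  rintro s₁ ⟨hid, hf₁⟩
  have hin₁ := hin.frame hf₁ (by decide)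
  refine (hset s₁ 1 hin₁).seq ?_
  rintro s₂ ⟨hin₂, ht₂, ha₂⟩
  refine ((halts_sortBy (src := 0) (dst := 1) (by decide) (by decide) (by decide) (by decide) hin₂
    (t := 1) (by simpa using ht₂) (L := 1) (fun j => by rw [ha₂]; exact hid j j.2)).mono hT.ge
    fun _ h => h).seq ?_
  rintro s₃ ⟨hL₃, hf₃⟩
  refine (hset s₃ 0 (hin₂.frame hf₃ (by decide))).seq ?_
  rintro s₄ ⟨hin₄, ht₄, ha₄⟩
  refine ((halts_sortBy (src := 1) (dst := 0) (by decide) (by decide) (by decide) (by decide) hin₄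
    (t := 0) (by simpa using ht₄) (by rw [ha₄]; exact hL₃)).mono hT.ge fun _ h => h).seq ?_
  rintro s₅ ⟨hL₅, hf₅⟩
  refine (hset s₅ 1 (hin₄.frame hf₅ (by decide))).seq ?_
  rintro s₆ ⟨hin₆, ht₆, ha₆⟩
  rw [← ha₆] at hL₅
  refine ((halts_sortBy (src := 0) (dst := 1) (by decide) (by decide) (by decide) (by decide) hin₆
    (t := 1) (by simpa using ht₆) hL₅).mono hT.ge fun _ h => h).seq ?_
  rintro s₇ ⟨hL₇, hf₇⟩
  have hin₇ := hin₆.frame hf₇ (by decide)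
  rw [← hf₇.narr 0 (by decide)] at hL₅
  refine (Halts.of_effect (c := .seq (.seq (.setR 3 (.ofNat (.const 0)))
    (.setR 4 (.ofNat (.const 1)))) (.seq (.setN 7 (.const 0)) (.setN 9 (.const 0)))) rfl
    (Q := fun s' => HasInput I P ε ω s' ∧ HasConf I.initConf s' ∧ s'.nreg 9 = 0)
    ⟨hin₇.frame (frame_effect rfl _) (by decide), ⟨?_, ?_, hL₅, hL₇, ?_⟩, ?_⟩).seq ?_
  · simp [Prog.effect, RExpr.eval, NExpr.eval, RankInstance.initConf]
  · simp [Prog.effect, RExpr.eval, NExpr.eval, RankInstance.initConf]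
  · simp [Prog.effect, NExpr.eval, RankInstance.initConf]
  · simp [Prog.effect, NExpr.eval]
  rintro s₈ ⟨hin₈, hc₈, hk₈⟩
  refine (halts_excessProg hin₈ hc₈).mono le_rfl ?_
  rintro s₉ ⟨he₉, hf₉⟩
  exact ⟨hin₈.frame hf₉ (by decide),
    hc₈.frame hf₉ (by decide) (by decide) (by decide) (by decide) (by decide), he₉,
    (hf₉.nreg 9 (by decide)).trans hk₈⟩

end RealRAM

/-- The recursion of `run` takes rounds off the front, which suits the law of the tape; the loop of
the machine appends them at the end. -/
theorem RankInstance.run_succ {n : ℕ} (I : RankInstance n) (P : ℝ × ℝ) (k : ℕ) (c : Conf n)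
    (ω : ℕ → ℝ) : I.run P (k + 1) c ω =
      I.advance P (I.run P k c ω) ⌊ω k * excess (I.run P k c ω)⌋₊ := by
  induction k generalizing c ω with
  | zero => rfl
  | succ k ih => rw [run, ih]; rfl

namespace RealRAM

variable {n : ℕ} {I : RankInstance n} {P : ℝ × ℝ} {ε : ℝ} {ω : ℕ → ℝ} {s s' : State}

/-- Repeat rounds until the search is done. -/
def searchProg : Prog :=
  .seq initProg (.loop (.and (.nle (.reg 7) (.const 0)) (.neg (.nle (.reg 8) (.const 0))))
    roundProg)

/-- The loop test reads `Done` off the flag in register `7` and the excess in register `8`; the loop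
may well stop before round `N`. -/
theorem halts_searchProg (hin : HasInput I P ε ω s) (hω : ∀ k, 0 ≤ ω k) {N : ℕ}
    (hN : RankInstance.Done (I.run P N I.initConf ω)) :
    Halts I.f I.gradient searchProg s (201 * (N + 1) * ((n + 1) * (Nat.clog 2 n + 1)))
      (fun s' => HasInput I P ε ω s' ∧ ∃ k, HasConf (I.run P k I.initConf ω) s' ∧
        RankInstance.Done (I.run P k I.initConf ω)) := by
  have htest : ∀ (c : Conf n) (s : State), HasConf c s → HasExcess c s →
      ((Test.and (.nle (.reg 7) (.const 0)) (.neg (.nle (.reg 8) (.const 0)))).holds s ↔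
        ¬ RankInstance.Done c) := by
    intro c s hc he
    simp only [Test.holds, NExpr.eval, hc.fin, he.total, RankInstance.Done, not_or,
      ← RankInstance.excess_eq_zero_iff, Nat.le_zero]
    simp
  refine ((halts_initProg hin).seq
    (T₂ := N * (200 * (n + 1) * (Nat.clog 2 n + 1) + 1) + 1) ?_).mono ?_ fun _ h => h
  · rintro s₁ ⟨hin₁, hc₁, he₁, hk₁⟩
    refine (Halts.loop (fun k s' => HasInput I P ε ω s' ∧ HasConf (I.run P k I.initConf ω) s' ∧
      HasExcess (I.run P k I.initConf ω) s' ∧ s'.nreg 9 = k) N ?_ ?_ s₁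
      ⟨hin₁, hc₁, he₁, hk₁⟩).mono le_rfl ?_
    · rintro s₂ ⟨-, hc₂, he₂, -⟩ hb
      exact (htest _ _ hc₂ he₂).1 hb hN
    · rintro k - s₂ ⟨hin₂, hc₂, he₂, hk₂⟩ hb
      rw [RankInstance.run_succ]
      exact halts_roundProg hin₂ hc₂ he₂ ((htest _ _ hc₂ he₂).1 hb) hk₂ (hω k)
    · rintro s₂ ⟨hb, k, -, hin₂, hc₂, he₂, -⟩
      exact ⟨hin₂, k, hc₂, by_contra fun h => hb ((htest _ _ hc₂ he₂).2 h)⟩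
  · have : 1 ≤ (n + 1) * (Nat.clog 2 n + 1) := Nat.mul_pos (by omega) (by omega)
    rw [mul_assoc 100, mul_assoc 200]
    nlinarith

end RealRAM

/-! ## Bisection of the segment between the scores of two rankings -/

namespace RankInstance

variable {n : ℕ} {I : RankInstance n} {P g₁ g₂ : ℝ × ℝ} {c : Conf n} {σ τ : Equiv.Perm (Fin n)}
  {S : ℝ} {k : ℕ}

/-- Two points of the segment from the score of `σ` to the score of `τ` that enclose a maximum of
`y ↦ P ⬝ y + f y` on this segment, with a slope of at most `S / 2 ^ k` at the first point. -/
structure Bracket (I : RankInstance n) (P : ℝ × ℝ) (σ τ : Equiv.Perm (Fin n)) (S : ℝ) (k : ℕ)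
    (g₁ g₂ : ℝ × ℝ) : Prop where
  mem₁ : g₁ ∈ segment ℝ (I.score σ) (I.score τ)
  mem₂ : g₂ ∈ segment ℝ (I.score σ) (I.score τ)
  nonneg : 0 ≤ dot (I.direction P g₁) (g₂ - g₁)
  nonpos : dot (I.direction P g₂) (g₂ - g₁) ≤ 0
  le : dot (I.direction P g₁) (g₂ - g₁) * 2 ^ k ≤ S
  single : g₁ = g₂ → dot (I.direction P g₁) g₁ = I.support (I.direction P g₁)
  normal : g₁ ≠ g₂ → ∀ z ∈ posQuad, dot z (g₂ - g₁) = 0 → dot z g₁ = I.support z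

theorem dot_direction_anti (hI : I.Valid) (h₁ : g₁ ∈ I.hull) (h₂ : g₂ ∈ I.hull) :
    dot (I.direction P g₂) (g₂ - g₁) ≤ dot (I.direction P g₁) (g₂ - g₁) := by
  have := hI.2.2.1.grad_anti (I.hull_subset_dom hI h₁) (I.hull_subset_dom hI h₂)
  rw [direction, direction, add_dot, add_dot]
  exact add_le_add_right this _

/-- If both rankings agree, the bracket is a single optimal point. Otherwise the end gradients lie
strictly on different sides of the common normal, and monotonicity of the gradient fixes the
orientation of the segment. -/
theorem Good.bracket (hI : I.Valid) (h : I.Good P c) (hs : Done c) :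
    I.Bracket P c.L c.H (I.slope P) 0 (I.score c.L) (I.score c.H) := by
  have hle : dot (I.direction P (I.score c.L)) (I.score c.H - I.score c.L) * 2 ^ 0 ≤ I.slope P := by
    rw [pow_zero, mul_one]
    exact Finset.le_sup' (fun στ : Equiv.Perm (Fin n) × Equiv.Perm (Fin n) =>
      dot (P + I.gradient (I.score στ.1)) (I.score στ.2 - I.score στ.1))
      (Finset.mem_univ (c.L, c.H))
  rcases h with h | ⟨-, t, ht₀, ht₁, hL, hH, hb, ha⟩
  · have hL : c.L = c.H := hs.resolve_left (by simp [h.fin])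
    refine ⟨left_mem_segment ℝ _ _, right_mem_segment ℝ _ _, ?_, ?_, hle,
      fun _ => h.dot_direction hI hL, fun hne => absurd (by rw [hL]) hne⟩ <;> simp [hL, dot]
  · have hanti := dot_direction_anti (P := P) hI (I.score_mem_hull c.L) (I.score_mem_hull c.H)
    have hn : dot (1 - t, t) (I.score c.H - I.score c.L) = 0 := by
      rw [dot_sub, hL.dot_score I hI, hH.dot_score I hI, sub_self]
    rw [BelowDir, not_le] at hb
    rw [AboveDir, not_le] at ha
    set d₁ := I.direction P (I.score c.L)
    set d₂ := I.direction P (I.score c.H)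
    set u := I.score c.H - I.score c.L with hu
    have hn' : (1 - t) * u.1 + t * u.2 = 0 := hn
    have ht₁' : 0 < 1 - t := by linarith
    -- Since `u` is orthogonal to `(1 - t, t)`, its pairing with `d` measures the deviation of `d`
    -- from this direction.
    have e : ∀ d : ℝ × ℝ, (1 - t) * dot d u = u.2 * ((1 - t) * d.2 - t * d.1) := by
      intro d
      simp only [dot]
      linear_combination d.1 * hn'
    have hu₂ : 0 ≤ u.2 := by
      have := mul_le_mul_of_nonneg_left hanti ht₁'.le
      rw [e, e] at this
      by_contra hneg
      nlinarith
    refine ⟨left_mem_segment ℝ _ _, right_mem_segment ℝ _ _, ?_, ?_, hle, fun he => ?_,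
      fun hne z hz hzu => ?_⟩
    · exact nonneg_of_mul_nonneg_right
        (by rw [e]; exact mul_nonneg hu₂ (sub_nonneg.2 hb.le)) ht₁'
    · exact nonpos_of_mul_nonpos_right
        (by rw [e]; exact mul_nonpos_of_nonneg_of_nonpos hu₂ (sub_nonpos.2 ha.le)) ht₁'
    · have : d₁ = d₂ := congrArg (I.direction P) he
      rw [this] at hb
      exact absurd hb ha.asymm
    · refine dot_eq_support_of_parallel hz ?_ (hL.dot_score I hI)
      have hzu' : z.1 * u.1 + z.2 * u.2 = 0 := hzu
      -- In the plane, `z` and `(1 - t, t)` are parallel if both are orthogonal to a nonzero `u`.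
      have h₁ : (t * z.1 - (1 - t) * z.2) * u.1 = 0 := by
        linear_combination t * hzu' - z.2 * hn'
      have h₂ : (t * z.1 - (1 - t) * z.2) * u.2 = 0 := by
        linear_combination z.1 * hn' - (1 - t) * hzu'
      by_contra hzt
      have hne' := sub_ne_zero.2 hzt
      refine hne (sub_eq_zero.1 ?_).symm
      exact Prod.ext ((mul_eq_zero.1 h₁).resolve_left hne') ((mul_eq_zero.1 h₂).resolve_left hne')

theorem midpoint_sub_left' (g₁ g₂ : ℝ × ℝ) : midpoint ℝ g₁ g₂ - g₁ = (1 / 2 : ℝ) • (g₂ - g₁) := by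
  ext <;> simp [midpoint_eq_smul_add] <;> ring

theorem right_sub_midpoint' (g₁ g₂ : ℝ × ℝ) : g₂ - midpoint ℝ g₁ g₂ = (1 / 2 : ℝ) • (g₂ - g₁) := by
  ext <;> simp [midpoint_eq_smul_add] <;> ring

theorem Bracket.midpoint_mem (h : I.Bracket P σ τ S k g₁ g₂) :
    midpoint ℝ g₁ g₂ ∈ segment ℝ (I.score σ) (I.score τ) :=
  (convex_segment _ _).segment_subset h.mem₁ h.mem₂ (midpoint_mem_segment _ _)

/-- The gradient at the midpoint gives no larger slope than the one at `g₁`, by monotonicity; the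
factor one half comes from the shorter segment. -/
theorem Bracket.right (hI : I.Valid) (h : I.Bracket P σ τ S k g₁ g₂) (hne : g₁ ≠ g₂)
    (hm : 0 ≤ dot (I.direction P (midpoint ℝ g₁ g₂)) (g₂ - g₁)) :
    I.Bracket P σ τ S (k + 1) (midpoint ℝ g₁ g₂) g₂ := by
  have hanti := dot_direction_anti (P := P) hI (I.segment_subset_hull _ _ h.mem₁)
    (I.segment_subset_hull _ _ h.midpoint_mem)
  rw [midpoint_sub_left', dot_smul, dot_smul] at hanti
  refine ⟨h.midpoint_mem, h.mem₂, ?_, ?_, ?_, fun he => ?_, fun _ z hz hzu => ?_⟩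
  · rw [right_sub_midpoint', dot_smul]; linarith
  · rw [right_sub_midpoint', dot_smul]; linarith [h.nonpos]
  · refine le_trans ?_ h.le
    rw [right_sub_midpoint', dot_smul, pow_succ]
    have : (0 : ℝ) < 2 ^ k := by positivity
    nlinarith
  · exact absurd ((midpoint_eq_right_iff (R := ℝ)).1 he) hne
  · rw [right_sub_midpoint', dot_smul] at hzu
    have hzu' : dot z (g₂ - g₁) = 0 := by linarith
    rw [← h.normal hne z hz hzu', ← sub_eq_zero, ← dot_sub, midpoint_sub_left', dot_smul, hzu',
      mul_zero]

theorem Bracket.left (h : I.Bracket P σ τ S k g₁ g₂) (hne : g₁ ≠ g₂)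
    (hm : dot (I.direction P (midpoint ℝ g₁ g₂)) (g₂ - g₁) ≤ 0) :
    I.Bracket P σ τ S (k + 1) g₁ (midpoint ℝ g₁ g₂) := by
  refine ⟨h.mem₁, h.midpoint_mem, ?_, ?_, ?_, fun he => ?_, fun _ z hz hzu => ?_⟩
  · rw [midpoint_sub_left', dot_smul]; linarith [h.nonneg]
  · rw [midpoint_sub_left', dot_smul]; linarith
  · refine le_trans (le_of_eq ?_) h.le
    rw [midpoint_sub_left', dot_smul, pow_succ]
    ring
  · exact absurd ((midpoint_eq_left_iff (R := ℝ)).1 he.symm) hne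
  · rw [midpoint_sub_left', dot_smul] at hzu
    exact h.normal hne z hz (by linarith)

/-- The quality of the dual variables that interpolate between the gradients. -/
theorem Bracket.localObj_le (hI : I.Valid) (hP : P ∈ posQuad) (h : I.Bracket P σ τ S k g₁ g₂)
    {μ : ℝ} (hμ : μ = dot (I.direction P g₁) (g₂ - g₁) /
      (dot (I.direction P g₁) (g₂ - g₁) - dot (I.direction P g₂) (g₂ - g₁))) {x : ℝ × ℝ}
    (hx : x = I.gradient g₁ + μ • (I.gradient g₂ - I.gradient g₁)) :
    x ∈ posQuad ∧ I.localObj P x ≤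
      ((I.value P g₁ + dot (I.direction P g₁) (g₂ - g₁) : ℝ) : EReal) := by
  have hg₁ := I.segment_subset_hull _ _ h.mem₁
  have hg₂ := I.segment_subset_hull _ _ h.mem₂
  have hd₁ := I.hull_subset_dom hI hg₁
  have hd₂ := I.hull_subset_dom hI hg₂
  set e₁ := dot (I.direction P g₁) (g₂ - g₁) with he₁
  set e₂ := dot (I.direction P g₂) (g₂ - g₁) with he₂
  have h₁ := h.nonneg
  have h₂ := h.nonpos
  rw [← he₁] at h₁
  rw [← he₂] at h₂
  have hμ₀ : 0 ≤ μ := hμ ▸ div_nonneg h₁ (by linarith)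
  have hμ₁ : μ ≤ 1 := hμ ▸ div_le_one_of_le₀ (by linarith) (by linarith)
  -- If `e₁ = 0` then `μ = 0`, also when the denominator vanishes.
  have hμe : μ * (e₁ - e₂) = e₁ := by
    rcases h₁.eq_or_lt with h0 | h0
    · rw [hμ, ← h0, zero_div, zero_mul]
    · rw [hμ, div_mul_cancel₀]; linarith
  have hxpos : x ∈ posQuad := by
    have := convex_posQuad (I.gradient_mem_posQuad hI hg₁) (I.gradient_mem_posQuad hI hg₂)
      (sub_nonneg.2 hμ₁) hμ₀ (by ring)
    rw [hx]
    convert this using 1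
    rw [smul_sub, sub_smul, one_smul]
    abel
  refine ⟨hxpos, ?_⟩
  have hed : e₁ - e₂ = dot (I.gradient g₁) (g₂ - g₁) - dot (I.gradient g₂) (g₂ - g₁) := by
    rw [he₁, he₂, direction, direction, add_dot, add_dot]; ring
  -- The choice of `μ` makes `P + x` orthogonal to the segment.
  have hsup : dot (P + x) g₁ = I.support (P + x) := by
    by_cases hne : g₁ = g₂
    · have hxe : x = I.gradient g₁ := by rw [hx, ← hne, sub_self, smul_zero, add_zero]
      rw [hxe]
      exact h.single hne
    · refine h.normal hne _ (add_mem_posQuad hP hxpos) ?_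
      have : e₁ = dot P (g₂ - g₁) + dot (I.gradient g₁) (g₂ - g₁) := add_dot _ _ _
      rw [hx, add_dot, add_dot, smul_dot, sub_dot]
      linear_combination μ * hed - this - hμe
  -- Convex combination of the tangent inequalities at the two ends.
  have hfen : fenchel I.dom I.f (-x) ≤ (((1 - μ) * (I.f g₁ - dot (I.gradient g₁) g₁) +
      μ * (I.f g₂ - dot (I.gradient g₂) g₂) : ℝ) : EReal) := by
    refine iSup₂_le fun y hy => EReal.coe_le_coe_iff.2 ?_
    have t₁ : I.f y ≤ I.f g₁ + dot (I.gradient g₁) (y - g₁) := hI.2.2.1.le_tangent hd₁ hy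
    have t₂ : I.f y ≤ I.f g₂ + dot (I.gradient g₂) (y - g₂) := hI.2.2.1.le_tangent hd₂ hy
    rw [dot_sub] at t₁ t₂
    rw [hx, neg_dot, add_dot, smul_dot, sub_dot]
    nlinarith [mul_le_mul_of_nonneg_left t₁ (sub_nonneg.2 hμ₁), mul_le_mul_of_nonneg_left t₂ hμ₀]
  refine (add_le_add_right hfen _).trans ?_
  rw [← hsup, ← EReal.coe_add, EReal.coe_le_coe_iff, value]
  have t : I.f g₂ ≤ I.f g₁ + dot (I.gradient g₁) (g₂ - g₁) := hI.2.2.1.le_tangent hd₁ hd₂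
  have t' := mul_le_mul_of_nonneg_left t hμ₀
  rw [dot_sub] at t'
  rw [dot_sub, dot_sub] at hed
  rw [hx, add_dot, add_dot, smul_dot, sub_dot]
  linear_combination t' + hμe - μ * hed

end RankInstance

/-! ## The program: the bisection -/

namespace RealRAM

variable {n : ℕ} {I : RankInstance n} {P g₁ g₂ : ℝ × ℝ} {ε : ℝ} {ω : ℕ → ℝ} {s s' : State}

/-- Slope between the points in real registers `6` to `9` for the gradient in registers `x`, `y`. -/
def slopeExpr (x y : ℕ) : RExpr :=
  .add (.mul (.add (.reg 0) (.reg x)) (.sub (.reg 8) (.reg 6)))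
    (.mul (.add (.reg 1) (.reg y)) (.sub (.reg 9) (.reg 7)))

/-- The memory contains two points and the gradients there. -/
structure HasPoints (I : RankInstance n) (P : ℝ × ℝ) (ε : ℝ) (g₁ g₂ : ℝ × ℝ) (s : State) :
    Prop where
  fst : s.rreg 0 = P.1
  snd : s.rreg 1 = P.2
  eps : s.rreg 2 = ε
  left : s.rreg 6 = g₁.1 ∧ s.rreg 7 = g₁.2
  right : s.rreg 8 = g₂.1 ∧ s.rreg 9 = g₂.2
  gradLeft : s.rreg 10 = (I.gradient g₁).1 ∧ s.rreg 11 = (I.gradient g₁).2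
  gradRight : s.rreg 12 = (I.gradient g₂).1 ∧ s.rreg 13 = (I.gradient g₂).2

theorem HasPoints.slope_left (h : HasPoints I P ε g₁ g₂ s) :
    (slopeExpr 10 11).eval s = dot (I.direction P g₁) (g₂ - g₁) := by
  simp [slopeExpr, RExpr.eval, h.fst, h.snd, h.left, h.right, h.gradLeft, dot,
    RankInstance.direction]

theorem HasPoints.slope_right (h : HasPoints I P ε g₁ g₂ s) :
    (slopeExpr 12 13).eval s = dot (I.direction P g₂) (g₂ - g₁) := by
  simp [slopeExpr, RExpr.eval, h.fst, h.snd, h.left, h.right, h.gradRight, dot,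
    RankInstance.direction]

/-- Halve the segment between the two points. -/
def bisectProg : Prog :=
  .seq (.seq (.setR 14 (.div (.add (.reg 6) (.reg 8)) (.ofNat (.const 2))))
      (.seq (.setR 15 (.div (.add (.reg 7) (.reg 9)) (.ofNat (.const 2))))
        (.callGrad 16 17 (.reg 14) (.reg 15))))
    (.ite (.rle (.ofNat (.const 0)) (slopeExpr 16 17))
      (.seq (.seq (.setR 6 (.reg 14)) (.setR 7 (.reg 15)))
        (.seq (.setR 10 (.reg 16)) (.setR 11 (.reg 17))))
      (.seq (.seq (.setR 8 (.reg 14)) (.setR 9 (.reg 15)))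
        (.seq (.setR 12 (.reg 16)) (.setR 13 (.reg 17)))))

theorem halts_bisectProg (hI : I.Valid) {σ τ : Equiv.Perm (Fin n)} {S : ℝ} {k : ℕ}
    (h : I.Bracket P σ τ S k g₁ g₂) (hne : g₁ ≠ g₂) (hs : HasPoints I P ε g₁ g₂ s) :
    Halts I.f I.gradient bisectProg s 12 (fun s' => s'.narr = s.narr ∧
      ∃ g₁ g₂, HasPoints I P ε g₁ g₂ s' ∧ I.Bracket P σ τ S (k + 1) g₁ g₂) := by
  obtain ⟨m, hm⟩ : ∃ m, m = midpoint ℝ g₁ g₂ := ⟨_, rfl⟩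
  have hm₁ : (g₁.1 + g₂.1) / 2 = m.1 := by rw [hm]; simp [midpoint_eq_smul_add]; ring
  have hm₂ : (g₁.2 + g₂.2) / 2 = m.2 := by rw [hm]; simp [midpoint_eq_smul_add]; ring
  refine (Halts.of_effect (c := .seq (.setR 14 (.div (.add (.reg 6) (.reg 8)) (.ofNat (.const 2))))
      (.seq (.setR 15 (.div (.add (.reg 7) (.reg 9)) (.ofNat (.const 2))))
        (.callGrad 16 17 (.reg 14) (.reg 15)))) rfl
    (Q := fun s' => s'.narr = s.narr ∧ HasPoints I P ε g₁ g₂ s' ∧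
      (s'.rreg 14 = m.1 ∧ s'.rreg 15 = m.2) ∧
      (s'.rreg 16 = (I.gradient m).1 ∧ s'.rreg 17 = (I.gradient m).2)) ?_).seq
    (T₂ := 9) ?_
  · obtain ⟨h₁, h₂, h₃, h₄, h₅, h₆, h₇⟩ := hs
    refine ⟨rfl, ⟨?_, ?_, ?_, ?_, ?_, ?_, ?_⟩, ?_, ?_⟩ <;>
      simp [Prog.effect, RExpr.eval, NExpr.eval, h₁, h₂, h₃, h₄, h₅, h₆, h₇, hm₁, hm₂]
  rintro s₁ ⟨hn, hp, hr, hr'⟩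
  have hv : (slopeExpr 16 17).eval s₁ = dot (I.direction P m) (g₂ - g₁) := by
    simp [slopeExpr, RExpr.eval, hp.fst, hp.snd, hp.left, hp.right, hr', dot,
      RankInstance.direction]
  have ht : (Test.rle (.ofNat (.const 0)) (slopeExpr 16 17)).holds s₁ ↔
      0 ≤ dot (I.direction P m) (g₂ - g₁) := by
    simp only [Test.holds, hv, RExpr.eval, NExpr.eval, Nat.cast_zero]
  obtain ⟨h₁, h₂, h₃, h₄, h₅, h₆, h₇⟩ := hp
  refine Halts.ite (T := 8) (fun hb => ?_) fun hb => ?_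
  · refine (Halts.of_effect rfl ⟨?_, m, g₂, ⟨?_, ?_, ?_, ?_, ?_, ?_, ?_⟩, ?_⟩).mono
      (by decide) fun _ h => h
    · simpa [Prog.effect] using hn
    iterate 7 simp [Prog.effect, RExpr.eval, h₁, h₂, h₃, h₅, h₇, hr, hr']
    rw [ht, hm] at hb
    rw [hm]
    exact h.right hI hne hb
  · refine (Halts.of_effect rfl ⟨?_, g₁, m, ⟨?_, ?_, ?_, ?_, ?_, ?_, ?_⟩, ?_⟩).mono
      (by decide) fun _ h => h
    · simpa [Prog.effect] using hn
    iterate 7 simp [Prog.effect, RExpr.eval, h₁, h₂, h₃, h₄, h₆, hr, hr']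
    rw [ht, hm, not_le] at hb
    rw [hm]
    exact h.left hne hb.le

/-- Compute dual variables and an estimate of the minimum. -/
def outputProg : Prog :=
  .seq (.setR 18 (.div (slopeExpr 10 11) (.sub (slopeExpr 10 11) (slopeExpr 12 13))))
    (.seq (.callF 19 (.reg 6) (.reg 7))
      (.seq (.setR 2 (.add (.add (.mul (.reg 0) (.reg 6)) (.mul (.reg 1) (.reg 7))) (.reg 19)))
        (.seq (.setR 0 (.add (.reg 10) (.mul (.reg 18) (.sub (.reg 12) (.reg 10)))))
          (.setR 1 (.add (.reg 11) (.mul (.reg 18) (.sub (.reg 13) (.reg 11))))))))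

/-- The minimum lies between `value P g₁` and `value P g₁ + ε`, which certifies both numerical
outputs. The value is computed before registers `0` and `1` with `P` are overwritten. -/
theorem halts_outputProg (hI : I.Valid) (hP : P ∈ posQuad) {σ τ : Equiv.Perm (Fin n)} {S : ℝ}
    {k : ℕ} (h : I.Bracket P σ τ S k g₁ g₂) (hε : dot (I.direction P g₁) (g₂ - g₁) ≤ ε)
    (hs : HasPoints I P ε g₁ g₂ s) (hσ : Holds (s.narr 0) σ) (hτ : Holds (s.narr 1) τ)
    (hg : ∃ g ∈ segment ℝ (I.score σ) (I.score τ), g ∈ subgrad I.support (P + I.gradient g)) :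
    Halts I.f I.gradient outputProg s 5 (Solves I P ε) := by
  obtain ⟨μ, hμ⟩ : ∃ μ, μ = dot (I.direction P g₁) (g₂ - g₁) /
    (dot (I.direction P g₁) (g₂ - g₁) - dot (I.direction P g₂) (g₂ - g₁)) := ⟨_, rfl⟩
  obtain ⟨x, hx⟩ : ∃ x, x = I.gradient g₁ + μ • (I.gradient g₂ - I.gradient g₁) := ⟨_, rfl⟩
  obtain ⟨hxpos, hle⟩ := h.localObj_le hI hP hμ hx
  have hvm := I.value_le_localMin hI P (I.segment_subset_hull _ _ h.mem₁)
  have hmx : I.localMin P ≤ I.localObj P x :=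
    iInf₂_le (f := fun x (_ : x ∈ posQuad) => I.localObj P x) x hxpos
  have hle' : I.localObj P x ≤ ((I.value P g₁ + ε : ℝ) : EReal) :=
    hle.trans (EReal.coe_le_coe_iff.2 (by linarith))
  have hε₀ : 0 ≤ ε := h.nonneg.trans hε
  refine (Halts.of_effect (c := outputProg) rfl (Q := fun s' => s'.narr = s.narr ∧
    (s'.rreg 0, s'.rreg 1) = x ∧ s'.rreg 2 = I.value P g₁) ⟨rfl, ?_, ?_⟩).mono
    (by decide) ?_
  · have e₁ := hs.slope_left
    have e₂ := hs.slope_right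
    rw [hx]
    ext <;> simp [outputProg, Prog.effect, RExpr.eval, e₁, e₂, ← hμ, hs.gradLeft, hs.gradRight]
  · simp [outputProg, Prog.effect, RExpr.eval, hs.left, hs.fst, hs.snd, RankInstance.value, dot]
  · rintro s' ⟨hn, hx', hv⟩
    rw [Solves, hn, hx', hv]
    refine ⟨⟨σ, τ, hσ, hτ, ?_⟩, hxpos, ?_, ?_, hmx.trans hle'⟩
    · obtain ⟨g, hg, hg'⟩ := hg
      exact ⟨g, hg, I.gradient_mem_posQuad hI (I.segment_subset_hull _ _ hg), hg'⟩
    · rw [EReal.coe_add] at hle'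
      exact hle'.trans (add_le_add_left hvm _)
    · exact (EReal.coe_le_coe_iff.2 (by linarith)).trans hvm

/-- Bisection, from the two rankings in the first two arrays. -/
def bisectionProg : Prog :=
  .seq (scoreOf 0 6 7) (.seq (scoreOf 1 8 9)
    (.seq (.seq (.callGrad 10 11 (.reg 6) (.reg 7)) (.callGrad 12 13 (.reg 8) (.reg 9)))
      (.seq (.loop (.neg (.rle (slopeExpr 10 11) (.reg 2))) bisectProg) outputProg)))

theorem halts_bisectionProg (hI : I.Valid) (hP : P ∈ posQuad) (hε : 0 < ε) {c : Conf n}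
    (hin : HasInput I P ε ω s) (hc : HasConf c s) (hgood : I.Good P c)
    (hdone : RankInstance.Done c) {K : ℕ} (hK : I.slope P ≤ ε * 2 ^ K) :
    Halts I.f I.gradient bisectionProg s (16 * (n + 1) + 13 * K) (Solves I P ε) := by
  refine ((halts_scoreOf (by decide) hin hc.left).seq (T₂ := 4 * (n + 1) +
    (2 + ((K * 13 + 1) + 5))) ?_).mono (by omega) fun _ h => h
  rintro s₁ ⟨hL, hf₁⟩
  have hin₁ := hin.frame hf₁ rfl
  have hc₁ := hc.frame hf₁ (by decide) (by decide) (by decide) (by decide) (by decide)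
  refine (halts_scoreOf (by decide) hin₁ hc₁.right).seq ?_
  rintro s₂ ⟨hH, hf₂⟩
  have hin₂ := hin₁.frame hf₂ rfl
  have hc₂ := hc₁.frame hf₂ (by decide) (by decide) (by decide) (by decide) (by decide)
  have hL₂ : (s₂.rreg 6, s₂.rreg 7) = I.score c.L := by
    rw [hf₂.rreg 6 (by decide), hf₂.rreg 7 (by decide), hL]
  refine (Halts.of_effect (c := .seq (.callGrad 10 11 (.reg 6) (.reg 7))
    (.callGrad 12 13 (.reg 8) (.reg 9))) rfl (Q := fun s' => s'.narr = s₂.narr ∧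
      HasPoints I P ε (I.score c.L) (I.score c.H) s') ⟨rfl, ?_⟩).seq ?_
  · constructor <;> simp [Prog.effect, RExpr.eval, hin₂.fst, hin₂.snd, hin₂.eps, hL₂, hH]
    · rw [← hL₂]; exact ⟨rfl, rfl⟩
    · rw [← hH]; exact ⟨rfl, rfl⟩
  rintro s₃ ⟨hn₃, hp₃⟩
  refine (Halts.loop (fun k s' => s'.narr = s₂.narr ∧ ∃ g₁ g₂, HasPoints I P ε g₁ g₂ s' ∧
    I.Bracket P c.L c.H (I.slope P) k g₁ g₂) K ?_ ?_ s₃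
    ⟨hn₃, _, _, hp₃, hgood.bracket hI hdone⟩).seq ?_
  · rintro s₄ ⟨-, g₁, g₂, hp, hb⟩ ht
    simp only [Test.holds, hp.slope_left, RExpr.eval, hp.eps] at ht
    exact ht (le_of_mul_le_mul_right (hb.le.trans hK) (by positivity))
  · rintro k - s₄ ⟨hn, g₁, g₂, hp, hb⟩ ht
    simp only [Test.holds, hp.slope_left, RExpr.eval, hp.eps, not_le] at ht
    -- The slope vanishes on a degenerate segment, so the loop test excludes it.
    have hne : g₁ ≠ g₂ := by
      rintro rfl
      simp [dot] at ht
      exact ht.not_gt hε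
    refine (halts_bisectProg hI hb hne hp).mono le_rfl ?_
    rintro s₅ ⟨hn₅, h₅⟩
    exact ⟨hn₅.trans hn, h₅⟩
  · rintro s₄ ⟨ht, k, -, hn, g₁, g₂, hp, hb⟩
    simp only [Test.holds, hp.slope_left, RExpr.eval, hp.eps, not_not] at ht
    refine halts_outputProg hI hP hb ht hp ?_ ?_ (hgood.exists_mem_subgrad hI hP hdone)
    · rw [hn]; exact hc₂.left
    · rw [hn]; exact hc₂.right

/-- The complete program. -/
def solveProg : Prog := .seq searchProg bisectionProg

theorem hasInput_start (I : RankInstance n) (P : ℝ × ℝ) (ε : ℝ) (ω : ℕ → ℝ) :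
    HasInput I P ε ω (start I P ε ω) := by
  constructor <;> simp [start]

end RealRAM

theorem RankInstance.Good.run {n : ℕ} {I : RankInstance n} {P : ℝ × ℝ} {c : Conf n}
    (h : I.Good P c) (k : ℕ) (ω : ℕ → ℝ) : I.Good P (I.run P k c ω) := by
  induction k with
  | zero => exact h
  | succ k ih => rw [I.run_succ]; exact ih.advance _

namespace RealRAM

variable {n : ℕ} {I : RankInstance n} {P : ℝ × ℝ} {ε : ℝ} {ω : ℕ → ℝ}

theorem halts_solveProg (hI : I.Valid) (hP : P ∈ posQuad) (hε : 0 < ε) (hω : ∀ k, 0 ≤ ω k)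
    {N K : ℕ} (hN : RankInstance.Done (I.run P N I.initConf ω)) (hK : I.slope P ≤ ε * 2 ^ K) :
    Halts I.f I.gradient solveProg (start I P ε ω)
      (220 * ((N + 1) * ((n + 1) * (Nat.clog 2 n + 1))) + 13 * K) (Solves I P ε) := by
  refine ((halts_searchProg (hasInput_start I P ε ω) hω hN).seq
    (T₂ := 16 * (n + 1) + 13 * K) ?_).mono ?_ fun _ h => h
  · rintro s ⟨hin, k, hc, hs⟩
    exact halts_bisectionProg hI hP hε hin hc
      (RankInstance.Good.run (.inl (RankInstance.active_initConf hI hP)) k ω) hs hK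
  · have h₁ : n + 1 ≤ (n + 1) * (Nat.clog 2 n + 1) := Nat.le_mul_of_pos_right _ (by omega)
    have h₂ : (n + 1) * (Nat.clog 2 n + 1) ≤ (N + 1) * ((n + 1) * (Nat.clog 2 n + 1)) :=
      Nat.le_mul_of_pos_left _ (by omega)
    rw [mul_assoc 201]
    omega

end RealRAM

/-! ## Splitting of the dual objective -/

theorem EReal.coe_finset_sum {ι : Type*} (s : Finset ι) (v : ι → ℝ) :
    ((∑ i ∈ s, v i : ℝ) : EReal) = ∑ i ∈ s, (v i : EReal) :=
  map_sum (⟨⟨Real.toEReal, EReal.coe_zero⟩, EReal.coe_add⟩ : ℝ →+ EReal) v s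

namespace RankInstance

variable {n : ℕ} {I : RankInstance n} {P : ℝ × ℝ}

theorem potential_le (c : Conf n) : potential c ≤ n * n := by
  unfold potential
  split_ifs
  · exact Nat.zero_le _
  · simpa using Finset.card_le_univ (inversions c.L c.H)

theorem done_run_initConf (hI : I.Valid) (hP : P ∈ posQuad) (ω : ℕ → ℝ) :
    Done (I.run P (n * n) I.initConf ω) :=
  Good.done_run_potential (.inl (active_initConf hI hP)) (potential_le _) ω

/-- The solution is the outcome of the abstract search on the zero tape; no fixed point theorem is
involved. -/
theorem exists_mem_subgrad (hI : I.Valid) (hP : P ∈ posQuad) :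
    ∃ g, g ∈ subgrad I.support (P + I.gradient g) := by
  have hgood : I.Good P I.initConf := .inl (active_initConf hI hP)
  obtain ⟨g, -, hg⟩ := (hgood.run (n * n) 0).exists_mem_subgrad hI hP (done_run_initConf hI hP 0)
  exact ⟨g, hg⟩

/-- The local minimum is finite and attained. -/
theorem exists_localObj_eq (hI : I.Valid) (hP : P ∈ posQuad) :
    ∃ v : ℝ, I.localMin P = v ∧ ∃ x ∈ posQuad, I.localObj P x = v := by
  obtain ⟨g, hg⟩ := exists_mem_subgrad hI hP
  exact ⟨_, I.localMin_eq hI hg, _, I.gradient_mem_posQuad hI (I.mem_subgrad_support_iff.1 hg).1,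
    I.localObj_gradient hI hg⟩

theorem localMin_le (I : RankInstance n) (P : ℝ × ℝ) {x : ℝ × ℝ} (hx : x ∈ posQuad) :
    I.localMin P ≤ I.localObj P x := iInf₂_le (f := fun x (_ : x ∈ posQuad) => I.localObj P x) x hx

theorem isMinOn_localObj_iff {x : ℝ × ℝ} (hx : x ∈ posQuad) :
    IsMinOn (I.localObj P) posQuad x ↔ I.localObj P x = I.localMin P :=
  ⟨fun h => le_antisymm (le_iInf₂ fun _ hy => h hy) (I.localMin_le P hx),
    fun h _ hy => h.le.trans (I.localMin_le P hy)⟩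

end RankInstance

section Splitting

variable {m n : ℕ} {I : Fin m → RankInstance n} {domF : Set (ℝ × ℝ)} {F : ℝ × ℝ → ℝ} {P : ℝ × ℝ}

theorem sum_localMin_le_Psi {x : Fin m → ℝ × ℝ} (hx : x ∈ posTuples m) :
    fenchel domF F (-P) + ∑ i, (I i).localMin P ≤ Psi I domF F P x :=
  add_le_add_right (Finset.sum_le_sum fun i _ => (I i).localMin_le P (hx i)) _

theorem exists_Psi_eq (hI : ∀ i, (I i).Valid) (hP : P ∈ posQuad) :
    ∃ x ∈ posTuples m, Psi I domF F P x = fenchel domF F (-P) + ∑ i, (I i).localMin P := by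
  choose v hv x hx hxv using fun i => RankInstance.exists_localObj_eq (hI i) hP
  refine ⟨x, hx, ?_⟩
  rw [Psi, Finset.sum_congr rfl fun i _ => (hxv i).trans (hv i).symm]

theorem sum_localMin_eq_iInf_Psi (hI : ∀ i, (I i).Valid) (hP : P ∈ posQuad) :
    fenchel domF F (-P) + ∑ i, (I i).localMin P = ⨅ x ∈ posTuples m, Psi I domF F P x := by
  obtain ⟨x, hx, he⟩ := exists_Psi_eq (domF := domF) (F := F) hI hP
  refine le_antisymm (le_iInf₂ fun y hy => sum_localMin_le_Psi hy) ?_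
  rw [← he]
  exact iInf₂_le (f := fun x (_ : x ∈ posTuples m) => Psi I domF F P x) x hx

theorem isMinOn_Psi {x : Fin m → ℝ × ℝ}
    (h : ∀ i, IsMinOn ((I i).localObj P) posQuad (x i)) :
    IsMinOn (Psi I domF F P) (posTuples m) x := by
  intro y hy
  exact add_le_add_right (Finset.sum_le_sum fun i _ => h i (hy i)) (fenchel domF F (-P))

/-- The Fenchel term and the local minima at the other indices are finite, so they can be cancelled
in `EReal`, which isolates the index `i`. -/
theorem IsMinOn.localObj (hI : ∀ i, (I i).Valid) (hF : IsObjective domF F) (hP : P ∈ posQuad)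
    (hfin : fenchel domF F (-P) ≠ ⊤) {x : Fin m → ℝ × ℝ} (hx : x ∈ posTuples m)
    (h : IsMinOn (Psi I domF F P) (posTuples m) x) (i : Fin m) :
    IsMinOn ((I i).localObj P) posQuad (x i) := by
  obtain ⟨y, hy, he⟩ := exists_Psi_eq (domF := domF) (F := F) hI hP
  have hle : Psi I domF F P x ≤ fenchel domF F (-P) + ∑ i, (I i).localMin P := he ▸ h hy
  choose v hv _ _ _ using fun i => RankInstance.exists_localObj_eq (hI i) hP
  rw [Psi, ← EReal.coe_toReal hfin (hF.fenchel_ne_bot _)] at hle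
  have hsum := EReal.addLECancellable_coe _ hle
  rw [← Finset.add_sum_erase _ _ (Finset.mem_univ i),
    ← Finset.add_sum_erase _ (fun i => (I i).localMin P) (Finset.mem_univ i)] at hsum
  have hrest : ∑ j ∈ Finset.univ.erase i, (I j).localMin P =
      ((∑ j ∈ Finset.univ.erase i, v j : ℝ) : EReal) := by
    rw [EReal.coe_finset_sum]
    exact Finset.sum_congr rfl fun j _ => hv j
  have hmono : ∑ j ∈ Finset.univ.erase i, (I j).localMin P ≤
      ∑ j ∈ Finset.univ.erase i, (I j).localObj P (x j) :=
    Finset.sum_le_sum fun j _ => (I j).localMin_le P (hx j)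
  have hcancel := (add_le_add_right hmono ((I i).localObj P (x i))).trans hsum
  rw [hrest, add_comm, add_comm ((I i).localMin P)] at hcancel
  exact (RankInstance.isMinOn_localObj_iff (hx i)).2 (le_antisymm
    (EReal.addLECancellable_coe _ hcancel) ((I i).localMin_le P (hx i)))

theorem Psi_le_of_localObj_le (hI : ∀ i, (I i).Valid) (hP : P ∈ posQuad) {x : Fin m → ℝ × ℝ}
    {ε : Fin m → ℝ} (h : ∀ i, (I i).localObj P (x i) ≤ (I i).localMin P + (ε i : EReal)) :
    Psi I domF F P x ≤ (⨅ y ∈ posTuples m, Psi I domF F P y) + ((∑ i, ε i : ℝ) : EReal) := by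
  rw [← sum_localMin_eq_iInf_Psi hI hP, EReal.coe_finset_sum, add_assoc, ← Finset.sum_add_distrib]
  exact add_le_add_right (Finset.sum_le_sum fun i _ => h i) _

end Splitting

theorem RankInstance.subgrad_support_eq_of_ratio {n : ℕ} (I : RankInstance n) {P x y : ℝ × ℝ}
    (hP : P ∈ posQuad) (hx : x ∈ posQuad) (hy : y ∈ posQuad)
    (h : (P.2 + x.2) / (P.1 + x.1) = (P.2 + y.2) / (P.1 + y.1)) :
    subgrad I.support (P + x) = subgrad I.support (P + y) := by
  have hx₁ : 0 < P.1 + x.1 := (add_mem_posQuad hP hx).1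
  have hy₁ : 0 < P.1 + y.1 := (add_mem_posQuad hP hy).1
  have he : P + x = ((P.1 + x.1) / (P.1 + y.1)) • (P + y) := by
    rw [div_eq_div_iff hx₁.ne' hy₁.ne'] at h
    ext
    · simp only [Prod.smul_fst, Prod.fst_add, smul_eq_mul]
      field_simp
    · simp only [Prod.smul_snd, Prod.snd_add, smul_eq_mul]
      field_simp
      linarith
  rw [he, I.subgrad_support_smul (div_pos hx₁ hy₁)]

/-! ## Running times -/

theorem half_le_log {x : ℝ} (hx : 2 ≤ x) : 1 / 2 ≤ Real.log x := by
  have := Real.log_le_log two_pos hx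
  linarith [Real.log_two_gt_d9]

/-- Since `Real.log 2 ≥ 1 / 2`, the change of base costs a factor `2`, and the rounding error `2` is
at most `4 * Real.log (x + 2)`. -/
theorem clog_add_one_le (x : ℕ) : (Nat.clog 2 x : ℝ) + 1 ≤ 6 * Real.log (x + 2) := by
  have h2 : (1 : ℝ) / 2 ≤ Real.log 2 := half_le_log le_rfl
  have hx2 : (1 : ℝ) / 2 ≤ Real.log (x + 2) := half_le_log (by linarith [x.cast_nonneg (α := ℝ)])
  rcases le_or_gt x 1 with hx | hx
  · rw [Nat.clog_of_right_le_one hx, Nat.cast_zero]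
    linarith
  · have h := Nat.pow_pred_clog_lt_self one_lt_two hx
    obtain ⟨k, hk⟩ := Nat.exists_eq_succ_of_ne_zero (Nat.clog_pos one_lt_two hx).ne'
    rw [hk, Nat.pred_succ] at h
    have h' : (2 : ℝ) ^ k ≤ x + 2 := by
      have : ((2 ^ k : ℕ) : ℝ) < x := Nat.cast_lt.2 h
      push_cast at this
      linarith
    have hl := Real.log_le_log (by positivity) h'
    rw [Real.log_pow] at hl
    rw [hk, Nat.cast_succ]
    have := mul_le_mul_of_nonneg_left h2 k.cast_nonneg (α := ℝ)
    linarith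

theorem log_le_mul_log {x y : ℝ} (hx : 0 < x) (k : ℕ) (h : x ≤ y ^ k) :
    Real.log x ≤ k * Real.log y := by
  rw [← Real.log_pow]
  exact Real.log_le_log hx h

/-! ### Numbers of rounds and of bisection steps -/

namespace RankInstance

variable {n : ℕ} {I : RankInstance n} {P : ℝ × ℝ}

theorem slope_nonneg (I : RankInstance n) (P : ℝ × ℝ) : 0 ≤ I.slope P := by
  have := Finset.le_sup' (fun στ : Equiv.Perm (Fin n) × Equiv.Perm (Fin n) =>
      dot (P + I.gradient (I.score στ.1)) (I.score στ.2 - I.score στ.1))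
      (Finset.mem_univ ((1 : Equiv.Perm (Fin n)), (1 : Equiv.Perm (Fin n))))
  refine le_trans (le_of_eq ?_) this
  simp [dot]

/-- A sufficient number of bisection steps. -/
theorem exists_bisections (I : RankInstance n) (P : ℝ × ℝ) {ε : ℝ} (hε : 0 < ε) :
    ∃ K : ℕ, I.slope P ≤ ε * 2 ^ K ∧ (K : ℝ) ≤ 12 * Real.log (2 + I.slope P / ε) := by
  have hS := I.slope_nonneg P
  have hq : 0 ≤ I.slope P / ε := div_nonneg hS hε.le
  refine ⟨Nat.clog 2 ⌈I.slope P / ε⌉₊, ?_, ?_⟩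
  · have h : ((⌈I.slope P / ε⌉₊ : ℕ) : ℝ) ≤ ((2 ^ Nat.clog 2 ⌈I.slope P / ε⌉₊ : ℕ) : ℝ) :=
      Nat.cast_le.2 (Nat.le_pow_clog one_lt_two _)
    have h' := (Nat.le_ceil _).trans h
    rw [div_le_iff₀ hε] at h'
    push_cast at h'
    linarith
  · have h₁ := clog_add_one_le ⌈I.slope P / ε⌉₊
    have h₂ := Nat.ceil_lt_add_one hq
    have h₃ : Real.log (⌈I.slope P / ε⌉₊ + 2) ≤ (2 : ℕ) * Real.log (2 + I.slope P / ε) :=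
      log_le_mul_log (by positivity) 2 (by nlinarith)
    push_cast at h₃
    linarith

theorem exists_rounds_int (hI : I.Valid) (hP : P ∈ posQuad) {B : ℕ}
    (hA : ∀ j, ∃ k : ℤ, I.a j = k ∧ |k| ≤ B) (hB : ∀ j, ∃ k : ℤ, I.b j = k ∧ |k| ≤ B) :
    ∃ N : ℕ, (∀ ω, Done (I.run P N I.initConf ω)) ∧ (N : ℝ) + 1 ≤ 38 * Real.log (B + 2) := by
  -- The `+ 1` inside makes the bound on the width strict; the one outside is the round in the short
  -- interval.
  refine ⟨Nat.clog 2 (16 * B ^ 2 + 1) + 1, fun ω => ?_, ?_⟩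
  · refine Good.done_run_of_int (.inl (active_initConf hI hP)) hA hB ?_ ω
    have h : ((16 * B ^ 2 + 1 : ℕ) : ℝ) ≤ ((2 ^ Nat.clog 2 (16 * B ^ 2 + 1) : ℕ) : ℝ) :=
      Nat.cast_le.2 (Nat.le_pow_clog one_lt_two _)
    push_cast at h
    simp only [initConf]
    linarith
  · have h₁ := clog_add_one_le (16 * B ^ 2 + 1)
    have hb : (0 : ℝ) ≤ B := B.cast_nonneg
    have h₂ : Real.log ((16 * B ^ 2 + 1 : ℕ) + 2) ≤ (6 : ℕ) * Real.log (B + 2) := by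
      refine log_le_mul_log (by positivity) 6 ?_
      have e₁ : (1 : ℝ) ≤ (B + 2) ^ 2 := by nlinarith
      have e₂ : (16 : ℝ) ≤ (B + 2) ^ 4 := by
        calc (16 : ℝ) = 2 ^ 4 := by norm_num
          _ ≤ (B + 2) ^ 4 := by gcongr; linarith
      have e₃ := mul_le_mul_of_nonneg_right e₂ (sq_nonneg ((B : ℝ) + 2))
      push_cast
      nlinarith
    have h₃ : (1 : ℝ) / 2 ≤ Real.log (B + 2) := half_le_log (by linarith)
    push_cast at h₁ h₂ ⊢
    linarith

theorem exists_rounds_random (hI : I.Valid) (hP : P ∈ posQuad) (d : ℕ) :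
    ∃ N : ℕ, RealRAM.tapeLaw {ω | ¬ Done (I.run P N I.initConf fun j => (ω j : ℝ))} ≤
      ENNReal.ofReal (1 / ((n : ℝ) + 2) ^ d) ∧
      (N : ℝ) + 1 ≤ 72 * (d + 2) * Real.log (n + 2) := by
  set k := Nat.clog 2 (n + 2) with hk
  have hn : (0 : ℝ) ≤ n := n.cast_nonneg
  -- Six rounds at least halve the expectation, as `(7 / 8) ^ 6 ≤ 1 / 2`. Of the exponent `d + 2`,
  -- the `2` pays for the at most `n²` initial inversions.
  refine ⟨6 * (k * (d + 2)), ?_, ?_⟩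
  · refine (Good.measure_not_done_le (.inl (active_initConf hI hP)) _).trans ?_
    have hpot : ((potential I.initConf : ℕ) : ℝ) ≤ ((n : ℝ) + 2) ^ 2 := by
      have : ((potential I.initConf : ℕ) : ℝ) ≤ ((n * n : ℕ) : ℝ) := Nat.cast_le.2 (potential_le _)
      push_cast at this
      nlinarith
    have hpow : ((7 : ℝ) / 8) ^ (6 * (k * (d + 2))) ≤ (((n : ℝ) + 2) ^ (d + 2))⁻¹ := by
      have h₁ : ((n : ℝ) + 2) ≤ 2 ^ k := by
        have : ((n + 2 : ℕ) : ℝ) ≤ ((2 ^ k : ℕ) : ℝ) :=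
          Nat.cast_le.2 (Nat.le_pow_clog one_lt_two _)
        simpa using this
      calc ((7 : ℝ) / 8) ^ (6 * (k * (d + 2))) = ((7 / 8) ^ 6) ^ (k * (d + 2)) := pow_mul _ _ _
        _ ≤ (2⁻¹) ^ (k * (d + 2)) := by gcongr; norm_num
        _ = ((2 ^ k) ^ (d + 2))⁻¹ := by rw [inv_pow, pow_mul]
        _ ≤ _ := by gcongr
    have hreal : ((7 : ℝ) / 8) ^ (6 * (k * (d + 2))) * (potential I.initConf : ℕ) ≤
        1 / ((n : ℝ) + 2) ^ d := by
      refine (mul_le_mul hpow hpot (Nat.cast_nonneg _) (by positivity)).trans (le_of_eq ?_)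
      rw [pow_add]
      field_simp
    refine le_trans (le_of_eq ?_) (ENNReal.ofReal_le_ofReal hreal)
    rw [ENNReal.ofReal_mul (by positivity), ENNReal.ofReal_pow (by norm_num),
      ENNReal.ofReal_natCast, ENNReal.ofReal_div_of_pos (by norm_num)]
    norm_num
  · have h₁ := clog_add_one_le (n + 2)
    have h₂ : Real.log ((n + 2 : ℕ) + 2) ≤ (2 : ℕ) * Real.log (n + 2) := by
      refine log_le_mul_log (by positivity) 2 ?_
      push_cast
      nlinarith
    rw [← hk] at h₁
    push_cast at h₁ h₂ ⊢
    have hd : (0 : ℝ) ≤ d := d.cast_nonneg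
    have h₃ : (k : ℝ) + 1 ≤ 12 * Real.log (n + 2) := by linarith
    nlinarith [mul_le_mul_of_nonneg_right h₃ (show (0 : ℝ) ≤ d + 2 by linarith)]

end RankInstance

theorem time_le {n N K : ℕ} {t : ℕ} {y z : ℝ}
    (ht : t ≤ 220 * ((N + 1) * ((n + 1) * (Nat.clog 2 n + 1))) + 13 * K)
    (hN : (N : ℝ) + 1 ≤ y) (hK : (K : ℝ) ≤ 12 * z) :
    (t : ℝ) ≤ 1320 * (y * ((n + 1) * Real.log (n + 2))) + 156 * z := by
  have h : (t : ℝ) ≤ 220 * ((N + 1) * ((n + 1) * (Nat.clog 2 n + 1))) + 13 * K := by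
    exact_mod_cast ht
  have h₁ : ((N : ℝ) + 1) * ((n + 1) * (Nat.clog 2 n + 1)) ≤
      y * ((n + 1) * (6 * Real.log (n + 2))) := by
    have := clog_add_one_le n
    have : (0 : ℝ) ≤ y := le_trans (by positivity) hN
    gcongr
  linarith

/-! ### Assembly -/

theorem mainTheorem7 :
    ∃ (detProg randProg : RealRAM.Prog) (C : ℝ) (C' : ℕ → ℝ),
    ∀ (m n : ℕ) (I : Fin m → RankInstance n) (domF : Set (ℝ × ℝ)) (F : ℝ × ℝ → ℝ) (P : ℝ × ℝ),
      (∀ i, (I i).Valid) → IsObjective domF F → P ∈ posQuad →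
      -- the minimisation of `Ψ` splits by instance
      ((∃ x ∈ posTuples m, IsMinOn (Psi I domF F P) (posTuples m) x) ∧
        (fenchel domF F (-P) + ∑ i, (I i).localMin P = ⨅ x ∈ posTuples m, Psi I domF F P x) ∧
        (∀ x ∈ posTuples m, (∀ i, IsMinOn ((I i).localObj P) posQuad (x i)) →
          IsMinOn (Psi I domF F P) (posTuples m) x) ∧
        (fenchel domF F (-P) ≠ ⊤ → ∀ x ∈ posTuples m,
          IsMinOn (Psi I domF F P) (posTuples m) x →
            ∀ i, IsMinOn ((I i).localObj P) posQuad (x i)) ∧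
        (∀ x ∈ posTuples m, ∀ ε : Fin m → ℝ,
          (∀ i, (I i).localObj P (x i) ≤ (I i).localMin P + (ε i : EReal)) →
            Psi I domF F P x ≤ (⨅ y ∈ posTuples m, Psi I domF F P y) + ((∑ i, ε i : ℝ) : EReal))) ∧
      ∀ i,
        -- each piece is a fixed point problem, governed by the lines through `-P`
        ((∃ x ∈ posQuad, (I i).IsFixedPoint P x ∧ (I i).localObj P x ≠ ⊤) ∧
          (∀ x ∈ posQuad, (I i).IsFixedPoint P x → IsMinOn ((I i).localObj P) posQuad x) ∧
          ((∀ σ, (I i).score σ ∈ posQuad) → ∀ x ∈ posQuad,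
            IsMinOn ((I i).localObj P) posQuad x → (I i).IsFixedPoint P x) ∧
          (∀ x ∈ posQuad, ∀ y ∈ posQuad,
            (P.2 + x.2) / (P.1 + x.1) = (P.2 + y.2) / (P.1 + y.1) →
              subgrad (I i).support (P + x) = subgrad (I i).support (P + y))) ∧
        -- each piece is solved efficiently
        ∀ ε : ℝ, 0 < ε →
          -- deterministic algorithm for integral scores of absolute value at most `B`
          (∀ B : ℕ,
            (∀ j, ∃ k : ℤ, (I i).a j = k ∧ |k| ≤ B) → (∀ j, ∃ k : ℤ, (I i).b j = k ∧ |k| ≤ B) →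
            ∃ s t, RealRAM.Exec (I i).f (I i).gradient detProg
                (RealRAM.start (I i) P ε fun _ => 0) s t ∧
              RealRAM.Solves (I i) P ε s ∧
              (t : ℝ) ≤ C * ((n + 1) * Real.log (n + 2) * Real.log (B + 2)
                + Real.log (2 + (I i).slope P / ε))) ∧
          -- randomised algorithm for real scores: always correct, fast with high probability
          (∀ ω : ℕ → unitInterval, ∃ s t, RealRAM.Exec (I i).f (I i).gradient randProg
              (RealRAM.start (I i) P ε fun k => ω k) s t ∧ RealRAM.Solves (I i) P ε s) ∧
          (∀ d : ℕ, RealRAM.tapeLaw {ω | ¬ ∃ s t, RealRAM.Exec (I i).f (I i).gradient randProg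
              (RealRAM.start (I i) P ε fun k => ω k) s t ∧
              (t : ℝ) ≤ C' d * ((n + 1) * Real.log (n + 2) ^ 2
                + Real.log (2 + (I i).slope P / ε))} ≤ ENNReal.ofReal (1 / ((n : ℝ) + 2) ^ d)) := by
  -- One program serves both purposes. By `time_le`, the constants have to exceed `1320 * 38` and
  -- `1320 * 72 * (d + 2)`, respectively.
  refine ⟨RealRAM.solveProg, RealRAM.solveProg, 60000, fun d => 100000 * (d + 2), ?_⟩
  intro m n I domF F P hI hF hP
  refine ⟨⟨?_, sum_localMin_eq_iInf_Psi hI hP, fun x _ h => isMinOn_Psi h,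
    fun hfin x hx h i => h.localObj hI hF hP hfin hx i,
    fun x _ ε h => Psi_le_of_localObj_le hI hP h⟩, fun i => ⟨⟨?_, ?_, ?_, ?_⟩, fun ε hε => ?_⟩⟩
  · obtain ⟨x, hx, he⟩ := exists_Psi_eq (domF := domF) (F := F) hI hP
    refine ⟨x, hx, fun y hy => ?_⟩
    show Psi I domF F P x ≤ Psi I domF F P y
    exact he.trans_le (sum_localMin_le_Psi hy)
  · obtain ⟨g, hg⟩ := RankInstance.exists_mem_subgrad (hI i) hP
    refine ⟨(I i).gradient g,
      (I i).gradient_mem_posQuad (hI i) ((I i).mem_subgrad_support_iff.1 hg).1, ⟨g, hg, rfl⟩, ?_⟩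
    rw [(I i).localObj_gradient (hI i) hg]
    exact EReal.coe_ne_top _
  · exact fun x _ h => RankInstance.IsFixedPoint.isMinOn (I i) (hI i) h
  · intro hpos x _ h
    obtain ⟨g, hg⟩ := RankInstance.exists_mem_subgrad (hI i) hP
    exact (I i).isFixedPoint_of_isMinOn (hI i) hpos h hg
  · exact fun x hx y hy h => (I i).subgrad_support_eq_of_ratio hP hx hy h
  obtain ⟨K, hK, hK'⟩ := (I i).exists_bisections P hε
  have hn : (0 : ℝ) ≤ n := n.cast_nonneg
  have hlog : (1 : ℝ) / 2 ≤ Real.log (n + 2) := half_le_log (by linarith)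
  have hz : 0 ≤ Real.log (2 + (I i).slope P / ε) :=
    Real.log_nonneg (by linarith [div_nonneg ((I i).slope_nonneg P) hε.le])
  refine ⟨fun B hA hB => ?_, fun ω => ?_, fun d => ?_⟩
  · obtain ⟨N, hN, hN'⟩ := RankInstance.exists_rounds_int (hI i) hP hA hB
    -- On the zero tape, the pivot is always inversion number `0`.
    obtain ⟨s, t, he, ht, hs⟩ := RealRAM.halts_solveProg (hI i) hP hε (ω := fun _ => 0)
      (fun _ => le_rfl) (hN _) hK
    refine ⟨s, t, he, hs, (time_le ht hN' hK').trans ?_⟩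
    have hB0 : (0 : ℝ) ≤ Real.log (B + 2) :=
      Real.log_nonneg (by linarith [B.cast_nonneg (α := ℝ)])
    have : 0 ≤ (n + 1) * Real.log (n + 2) * Real.log (B + 2) := by positivity
    linarith
  · obtain ⟨s, t, he, -, hs⟩ := RealRAM.halts_solveProg (hI i) hP hε (ω := fun k => ω k)
      (fun k => (ω k).2.1) (RankInstance.done_run_initConf (hI i) hP _) hK
    exact ⟨s, t, he, hs⟩
  · obtain ⟨N, hN, hN'⟩ := RankInstance.exists_rounds_random (hI i) hP d
    -- A tape on which `N` rounds suffice obeys the time bound, so the slow tapes are among the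
    -- unfinished ones.
    refine le_trans (measure_mono ?_) hN
    intro ω hω hdone
    refine hω ?_
    obtain ⟨s, t, he, ht, -⟩ := RealRAM.halts_solveProg (hI i) hP hε (ω := fun k => ω k)
      (fun k => (ω k).2.1) hdone hK
    refine ⟨s, t, he, (time_le ht hN' hK').trans ?_⟩
    have hd : (0 : ℝ) ≤ d := d.cast_nonneg
    have h₁ : 0 ≤ ((d : ℝ) + 2) * ((n + 1) * Real.log (n + 2) ^ 2) := by positivity
    have h₂ : 0 ≤ (d : ℝ) * Real.log (2 + (I i).slope P / ε) := by positivity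
    linarith
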